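/- For a finite group $G$ acting on a finite set $\Omega$, let $b(G)=b(G,\Omega)$ be the minimal size of a base, that is, of a subset of $\Omega$ whose pointwise stabilizer in $G$ is trivial. Let $q$ be a prime power, let $V=\mathbb F^d$ be the natural module, where $\mathbb F=\mathbb F_{q^2}$ for the unitary groups and $\mathbb F=\mathbb F_q$ otherwise, and let $\mathrm{GU}_d(q)$, $\mathrm{Sp}_d(q)$ and $\mathrm{GO}^\varepsilon_d(q)$ be the full isometry groups of the standard unitary form, the standard symplectic form and the standard quadratic form $Q$ of type $\varepsilon$ (with $\varepsilon\in\{+,-\}$ if $d$ is even, and $\varepsilon$ blank if $d$ is odd; for odd $d$ and even $q$ the polar form of $Q$ has a $1$-dimensional radical). Let $G$ be one of $\mathrm{PGL}_d(q)$, $\mathrm{PGU}_d(q)$, $\mathrm{PSp}_d(q)$, $\mathrm{PGO}^\varepsilon_d(q)$, each being the quotient of $\mathrm{GL}_d(q)$, $\mathrm{GU}_d(q)$, $\mathrm{Sp}_d(q)$, $\mathrm{GO}^\varepsilon_d(q)$ by its subgroup of scalars. Let $k\in\{1,2\}$ and let $\Omega$ be a $G$-orbit of $k$-dimensional subspaces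 of $V$ that are totally singular, or non-degenerate, or (for $G$ orthogonal and $k=1$) non-singular, where a $1$-space $\langle v\rangle$ is non-singular if $Q(v)\neq 0$ and $v$ is not in the radical of the polar form of $Q$; if $G=\mathrm{PGL}_d(q)$, all subspaces count as totally singular. 1. If $d\ge 5$, $G=\mathrm{PGL}_d(q)$ and $k=2$, then $b(G)\le\lceil d/2\rceil+2$. 2. If $d\ge 3$, $G$ is $\mathrm{PGU}_d(q)$ or $\mathrm{PSp}_d(q)$, and $k=1$, then $b(G)\le d$. 3. If $d\ge 6$, $G=\mathrm{PGO}^\varepsilon_d(q)$ and $k=1$, then $b(G)=d-1$. 4. If $d\ge 7$, $G$ is not $\mathrm{PGL}_d(q)$, and $k=2$, then $b(G)\le\lceil d/2\rceil$. Additionally, if $q$ and $d$ are even, $d\ge 6$, and $\Omega$ is the coset space of $\mathrm{GO}^{\pm}_d(q)$ in $G=\mathrm{Sp}_d(q)$ (where $\mathrm{GO}^\pm_d(q)$ is the isometry group of a quadratic form of type $\pm$ whose polar form is the symplectic form), then $b(G)=d$. -/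

import Mathlib

/-! ### Base size of a group action -/

/-- `baseSize G Ω` is the minimal size of a base for `G` on `Ω`, that is, of a set `B` of points
whose pointwise stabilizer in `G` is trivial.  The value is `⊤` if there is no base. -/
noncomputable def baseSize (G Ω : Type*) [Group G] [MulAction G Ω] : ℕ∞ :=
  ⨅ (B : Set Ω) (_ : fixingSubgroup G B = ⊥), B.encard

section Groups

variable {F V : Type*} [Field F] [AddCommGroup V] [Module F V]

/-! ### Isometry groups -/

/-- The group of all invertible linear maps that preserve the form `B`. -/
def formIsometryGroup (B : V → V → F) : Subgroup (V ≃ₗ[F] V) where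
  carrier := {g | ∀ u v, B (g u) (g v) = B u v}
  one_mem' := fun _ _ => rfl
  mul_mem' := by
    intro g h hg hh u v
    rw [LinearEquiv.mul_apply, LinearEquiv.mul_apply, hg, hh]
  inv_mem' := by
    intro g hg u v
    have h := hg (g⁻¹ u) (g⁻¹ v)
    rw [← LinearEquiv.mul_apply, ← LinearEquiv.mul_apply, mul_inv_cancel] at h
    exact h.symm

/-- The group of all invertible linear maps that preserve the quadratic form `Q`. -/
def quadraticIsometryGroup (Q : QuadraticForm F V) : Subgroup (V ≃ₗ[F] V) where
  carrier := {g | ∀ v, Q (g v) = Q v}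
  one_mem' := fun _ => rfl
  mul_mem' := by
    intro g h hg hh v
    rw [LinearEquiv.mul_apply, hg, hh]
  inv_mem' := by
    intro g hg v
    have h := hg (g⁻¹ v)
    rw [← LinearEquiv.mul_apply, mul_inv_cancel] at h
    exact h.symm

/-! ### Projective groups and their action on subspaces -/

variable (F V) in
/-- The group of nonzero scalar maps on `V`. -/
def scalarGroup : Subgroup (V ≃ₗ[F] V) :=
  (DistribMulAction.toModuleAut F V : Fˣ →* (V ≃ₗ[F] V)).range

instance scalarGroup_normal : (scalarGroup F V).Normal where
  conj_mem := by
    rintro _ ⟨c, rfl⟩ g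
    refine ⟨c, ?_⟩
    rw [eq_mul_inv_iff_mul_eq]
    ext v
    change c • g v = g (c • v)
    exact (map_smul g (c : F) v).symm

/-- The projective group `H / (H ∩ scalars)` of a group `H` of invertible linear maps. -/
def ProjectiveGroup (H : Subgroup (V ≃ₗ[F] V)) : Type _ :=
  H ⧸ (scalarGroup F V).subgroupOf H

instance ProjectiveGroup.instGroup (H : Subgroup (V ≃ₗ[F] V)) : Group (ProjectiveGroup H) :=
  inferInstanceAs (Group (H ⧸ (scalarGroup F V).subgroupOf H))

/-- The action of the invertible linear maps on the subspaces, `g` sending `U` to its image. -/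
def subspacePerm : (V ≃ₗ[F] V) →* Equiv.Perm (Submodule F V) where
  toFun g :=
    { toFun := fun U => U.map (g : V →ₗ[F] V)
      invFun := fun U => U.map ((g⁻¹ : V ≃ₗ[F] V) : V →ₗ[F] V)
      left_inv := by
        intro U
        ext v
        constructor
        · rintro ⟨_, ⟨w, hw, rfl⟩, rfl⟩
          have h : (g⁻¹ * g) w = w := by rw [inv_mul_cancel]; rfl
          exact h.symm ▸ hw
        · intro hv
          refine ⟨g v, ⟨v, hv, rfl⟩, ?_⟩
          change (g⁻¹ * g) v = v
          rw [inv_mul_cancel]; rfl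
      right_inv := by
        intro U
        ext v
        constructor
        · rintro ⟨_, ⟨w, hw, rfl⟩, rfl⟩
          have h : (g * g⁻¹) w = w := by rw [mul_inv_cancel]; rfl
          exact h.symm ▸ hw
        · intro hv
          refine ⟨g⁻¹ v, ⟨v, hv, rfl⟩, ?_⟩
          change (g * g⁻¹) v = v
          rw [mul_inv_cancel]; rfl }
  map_one' := by
    ext1 U
    exact Submodule.map_id U
  map_mul' g h := by
    ext1 U
    exact Submodule.map_comp (h : V →ₗ[F] V) (g : V →ₗ[F] V) U

theorem subspacePerm_scalar (g : V ≃ₗ[F] V) (hg : g ∈ scalarGroup F V) :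
    subspacePerm g = 1 := by
  obtain ⟨c, rfl⟩ := hg
  ext1 U
  ext v
  constructor
  · rintro ⟨w, hw, rfl⟩
    exact U.smul_mem (c : F) hw
  · intro hv
    refine ⟨c⁻¹ • v, U.smul_mem ((c⁻¹ : Fˣ) : F) hv, ?_⟩
    exact smul_inv_smul c v

/-- The action of the projective group of `H` on the subspaces of `V`, induced by that of `H`. -/
instance ProjectiveGroup.instMulAction (H : Subgroup (V ≃ₗ[F] V)) :
    MulAction (ProjectiveGroup H) (Submodule F V) :=
  MulAction.compHom (Submodule F V)
    (QuotientGroup.lift ((scalarGroup F V).subgroupOf H) (subspacePerm.comp H.subtype)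
      (fun g hg => subspacePerm_scalar (g : V ≃ₗ[F] V) (Subgroup.mem_subgroupOf.mp hg)) :
      ProjectiveGroup H →* Equiv.Perm (Submodule F V))

/-- The quotient map onto the projective group. -/
def ProjectiveGroup.mk (H : Subgroup (V ≃ₗ[F] V)) : H →* ProjectiveGroup H :=
  QuotientGroup.mk' ((scalarGroup F V).subgroupOf H)

theorem ProjectiveGroup.mk_smul (H : Subgroup (V ≃ₗ[F] V)) (g : H) (U : Submodule F V) :
    ProjectiveGroup.mk H g • U = U.map ((g : V ≃ₗ[F] V) : V →ₗ[F] V) := rfl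

/-! ### Subspaces and forms -/

/-- The form `B` vanishes identically on `U`. -/
def IsTotallyIsotropic (B : V → V → F) (U : Submodule F V) : Prop :=
  ∀ u ∈ U, ∀ v ∈ U, B u v = 0

/-- The restriction of the form `B` to `U` is non-degenerate. -/
def IsNondegenerateOn (B : V → V → F) (U : Submodule F V) : Prop :=
  ∀ u ∈ U, (∀ v ∈ U, B u v = 0) → u = 0

/-- The quadratic form `Q` vanishes identically on `U`. -/
def IsTotallySingular (Q : QuadraticForm F V) (U : Submodule F V) : Prop :=
  ∀ u ∈ U, Q u = 0

/-- `U` is a non-singular `1`-space: `Q` has no nonzero zero on `U`, and `U` is not contained in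
the radical of the polar form (that radical is nonzero only in odd dimension and
characteristic two, where it is a `1`-space fixed by all isometries). -/
def IsNonsingularLine (Q : QuadraticForm F V) (U : Submodule F V) : Prop :=
  Module.finrank F U = 1 ∧ (∀ u ∈ U, Q u = 0 → u = 0) ∧
    ∃ u ∈ U, ∃ v : V, QuadraticMap.polar Q u v ≠ 0

end Groups

/-! ### The standard forms -/

section StandardForms

variable (F : Type*) [Field F]

/-- The space of dimension `2 * a + r` with standard basis
`e_1, …, e_a, f_1, …, f_a, x_1, …, x_r`. -/
abbrev FormSpace (a r : ℕ) : Type _ := Fin a ⊕ Fin a ⊕ Fin r → F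

variable {F}

/-- The `e_i`-coordinate of a vector. -/
def eCoord {a r : ℕ} (i : Fin a) : FormSpace F a r →ₗ[F] F :=
  LinearMap.proj (Sum.inl i)

/-- The `f_i`-coordinate of a vector. -/
def fCoord {a r : ℕ} (i : Fin a) : FormSpace F a r →ₗ[F] F :=
  LinearMap.proj (Sum.inr (Sum.inl i))

/-- The `x_j`-coordinate of a vector. -/
def xCoord {a r : ℕ} (j : Fin r) : FormSpace F a r →ₗ[F] F :=
  LinearMap.proj (Sum.inr (Sum.inr j))

/-- The standard symplectic form: `B(e_i, f_j) = δ_ij = - B(f_j, e_i)`,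
`B(e_i, e_j) = B(f_i, f_j) = 0`. -/
def symplecticForm (a : ℕ) (u v : FormSpace F a 0) : F :=
  ∑ i : Fin a, (eCoord i u * fCoord i v - fCoord i u * eCoord i v)

/-- The standard unitary form over the field of order `q ^ 2` (`r` is `0` or `1`):
`B(e_i, f_j) = B(f_j, e_i) = δ_ij`, `B(x_1, x_1) = 1`, and all other values on pairs of basis
vectors are `0`; it is linear in `u` and semilinear in `v` for `c ↦ c ^ q`. -/
def unitaryForm (q a r : ℕ) (u v : FormSpace F a r) : F :=
  ∑ i : Fin a, (eCoord i u * fCoord i v ^ q + fCoord i u * eCoord i v ^ q) +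
    ∑ j : Fin r, xCoord j u * xCoord j v ^ q

/-- The quadratic form with `Q(x) = 1` on the span of `x = x_1`. -/
def anisotropicOne (F : Type*) [Field F] (a : ℕ) : QuadraticForm F (FormSpace F a 1) :=
  QuadraticMap.linMulLin (xCoord 0) (xCoord 0)

/-- The quadratic form with `Q(x) = B(x, y) = 1` and `Q(y) = ζ` on the span of `x = x_1` and
`y = x_2`, where `B` is the polar form. -/
def anisotropicTwo {F : Type*} [Field F] (a : ℕ) (ζ : F) : QuadraticForm F (FormSpace F a 2) :=
  QuadraticMap.linMulLin (xCoord 0) (xCoord 0) + QuadraticMap.linMulLin (xCoord 0) (xCoord 1) +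
    ζ • QuadraticMap.linMulLin (xCoord 1) (xCoord 1)

/-- The anisotropic part of the standard quadratic form, of dimension `r` (only `r ≤ 2` is
used). -/
def anisotropicPart {F : Type*} [Field F] (a : ℕ) (ζ : F) :
    (r : ℕ) → QuadraticForm F (FormSpace F a r)
  | 0 => 0
  | 1 => anisotropicOne F a
  | 2 => anisotropicTwo a ζ
  | _ + 3 => 0

/-- The standard quadratic form in dimension `2 * a + r`: `Q(e_i) = Q(f_i) = 0`,
`B(e_i, f_j) = δ_ij` for the polar form `B`, all other values on pairs `e_i, e_j` and `f_i, f_j`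
being `0`, plus orthogonally the anisotropic part.  It has plus type for `r = 0`, is the standard
form in odd dimension for `r = 1`, and has minus type for `r = 2` when `X ^ 2 + X + ζ` is
irreducible. -/
def standardQuadraticForm (a r : ℕ) (ζ : F) : QuadraticForm F (FormSpace F a r) :=
  ∑ i : Fin a, QuadraticMap.linMulLin (eCoord i) (fCoord i) + anisotropicPart a ζ r

/-! ### The classical groups -/

variable (F)

/-- `PGL_d(q)`, for `F` of order `q`. -/
abbrev PGLGroup (d : ℕ) : Type _ := ProjectiveGroup (⊤ : Subgroup ((Fin d → F) ≃ₗ[F] (Fin d → F)))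

/-- `PGU_{2a+r}(q)`, for `F` of order `q ^ 2`. -/
abbrev PGUGroup (q a r : ℕ) : Type _ :=
  ProjectiveGroup (formIsometryGroup (unitaryForm (F := F) q a r))

/-- `Sp_{2a}(q)`, for `F` of order `q`. -/
abbrev SpGroup (a : ℕ) : Subgroup (FormSpace F a 0 ≃ₗ[F] FormSpace F a 0) :=
  formIsometryGroup (symplecticForm (F := F) a)

/-- `PSp_{2a}(q)`, for `F` of order `q`. -/
abbrev PSpGroup (a : ℕ) : Type _ := ProjectiveGroup (SpGroup F a)

variable {F}

/-- `PGO_{2a+r}(q)`, of plus type, in odd dimension, or of minus type, according to whether `r` is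
`0`, `1` or `2`, for `F` of order `q`. -/
abbrev PGOGroup (a r : ℕ) (ζ : F) : Type _ :=
  ProjectiveGroup (quadraticIsometryGroup (standardQuadraticForm a r ζ))

end StandardForms

/-!
Symplectic, unitary and quadratic spaces are treated together as instances of `FormGeometry`: a
sesquilinear form `B` with a function `τ` (the quadratic form, `v ↦ B v v`, or `0`) that cuts out
the singular vectors.  The part of Witt's theorem that is needed, transitivity on vectors and on
pairs of vectors with given Gram matrix (`exists_isIsom_vector`, `exists_isIsom_pair`), follows from
reflections `v ↦ v + c B(v, x) x`.  By `baseSize_orbit_le` and transitivity, an upper bound for the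
base size amounts to a list of lines or planes of the right isometry type that only scalars
stabilize.

*Planes.*  Fix three hyperbolic pairs and write the remaining standard basis vectors as pairs
`(y, y')`.  Three planes in the span `H` of the hyperbolic pairs have a small common stabilizer.  For
every `(y, y')` there is a further plane `⟨w + y, w' + y'⟩`, with `w, w' ∈ H` adjusting the Gram
matrix; one of these planes reduces the stabilizer to scalars on `H` (`scalar_of_isotropic`,
`scalar_of_nondegenerate`), and then all of them carry the scalar over to the orthogonal complement
of `H` (`IsIsom.eq_smul_of_graph`).  The number of planes is `3 + (⌈d / 2⌉ - 3)`.

*Lines.*  A base consists of lines spanned by vectors with the same value of `τ`, one of which is not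
orthogonal to the others, so that the eigenvalues of an isometry stabilizing them all agree; for
nonsingular lines in characteristic two this is automatic, as the eigenvalues are `1`.  Such
vectors are found in the sets `{e + s f + u : u ⊥ e, f}`, and they span the whole space, or, for
quadratic forms, a hyperplane on which no nontrivial isometry is the identity
(`baseSize_quadratic_line_le`).  The lower bound `d - 1` holds because the pointwise stabilizer of a
subspace of codimension two contains a reflection or a Siegel transformation
(`exists_ne_one_of_finrank_add_two_le`).

*Cosets.*  In characteristic two the quadratic forms with polar form `B` are the forms
`Q + B(·, v) ^ 2`, and an isometry of `Q` fixes such a form if and only if it fixes `v`.  Hence both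
bounds reduce to fixing vectors pointwise (`baseSize_coset_le`, `le_baseSize_coset`).

*General linear groups.*  The planes `⟨e_i, f_i⟩` and the diagonal plane `⟨∑ e_i, ∑ f_i⟩` force a
linear map to act on all blocks by the same `2 × 2` matrix, and one more plane (two in odd dimension)
makes that matrix scalar (`baseSize_PGL_even_le`, `baseSize_PGL_odd_le`).
-/


/-! ### Sesquilinear geometries and their reflections -/

/-- A common framework for symplectic, unitary and quadratic spaces.  `B` is a `σ`-sesquilinear
`ε`-symmetric form and `τ` is the function that singles out the "singular" vectors: it is the
quadratic form on a quadratic space, `v ↦ B v v` on a unitary space, and `0` on a symplectic space.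
The additive map `tr` measures the failure of additivity of `τ`; it is the identity, the trace
`x + σ x`, or `0`.  The constant `κ` with `B v v = κ τ v` is `2`, `1`, or `0`.  The last axiom says
that `τ` has no nontrivial zero in the radical of `B`. -/
structure FormGeometry (F V : Type*) [Field F] [AddCommGroup V] [Module F V] where
  σ : F →+* F
  ε : F
  κ : F
  tr : F →+ F
  B : V → V → F
  τ : V → F
  σ_σ : ∀ x, σ (σ x) = x
  ε_mul_ε : ε * ε = 1
  σ_ε : σ ε = ε
  add_left : ∀ u v w, B (u + v) w = B u w + B v w
  smul_left : ∀ (c : F) u w, B (c • u) w = c * B u w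
  symm : ∀ u v, B v u = ε * σ (B u v)
  tr_σ : ∀ x, tr (σ x) = tr x
  tr_ε : ∀ x, tr (ε * x) = tr x
  tr_mul_norm : ∀ x y, tr (x * (y * σ y)) = tr x * (y * σ y)
  τ_add : ∀ u v, τ (u + v) = τ u + τ v + tr (B u v)
  τ_smul : ∀ (c : F) v, τ (c • v) = c * σ c * τ v
  self : ∀ v, B v v = κ * τ v
  exists_tr : ∀ v, ∃ s, tr s = τ v
  regular : ∀ v, (∀ w, B v w = 0) → τ v = 0 → v = 0

namespace FormGeometry

variable {F V : Type*} [Field F] [AddCommGroup V] [Module F V] (G : FormGeometry F V)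

theorem ε_ne_zero : G.ε ≠ 0 := fun h => by simpa [h] using G.ε_mul_ε

theorem add_right (u v w : V) : G.B u (v + w) = G.B u v + G.B u w := by
  rw [G.symm (v + w) u, G.symm v u, G.symm w u, G.add_left, map_add, mul_add]

theorem smul_right (c : F) (u v : V) : G.B u (c • v) = G.σ c * G.B u v := by
  rw [G.symm (c • v) u, G.symm v u, G.smul_left, map_mul]; ring

theorem zero_left (v : V) : G.B 0 v = 0 := by
  have := G.smul_left 0 0 v
  simpa using this

theorem zero_right (v : V) : G.B v 0 = 0 := by
  have := G.smul_right 0 v 0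
  simpa using this

theorem neg_left (u v : V) : G.B (-u) v = -G.B u v := by
  have := G.smul_left (-1) u v
  simpa using this

theorem neg_right (u v : V) : G.B u (-v) = -G.B u v := by
  have := G.smul_right (-1) u v
  simpa using this

theorem sub_left (u v w : V) : G.B (u - v) w = G.B u w - G.B v w := by
  rw [sub_eq_add_neg, G.add_left, G.neg_left, sub_eq_add_neg]

theorem sub_right (u v w : V) : G.B u (v - w) = G.B u v - G.B u w := by
  rw [sub_eq_add_neg, G.add_right, G.neg_right, sub_eq_add_neg]

theorem τ_zero : G.τ 0 = 0 := by
  have := G.τ_smul 0 0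
  simpa using this

theorem τ_neg (v : V) : G.τ (-v) = G.τ v := by
  have := G.τ_smul (-1) v
  simpa using this

theorem perp_symm {u v : V} (h : G.B u v = 0) : G.B v u = 0 := by
  rw [G.symm, h]; simp

/-- The form is linear in its first argument. -/
def left (w : V) : V →ₗ[F] F where
  toFun v := G.B v w
  map_add' u v := G.add_left u v w
  map_smul' c v := G.smul_left c v w

/-- The vectors orthogonal to all vectors of `A`. -/
def perp (A : Set V) : Submodule F V where
  carrier := {x | ∀ a ∈ A, G.B x a = 0}
  add_mem' hx hy a ha := by rw [G.add_left, hx a ha, hy a ha, add_zero]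
  zero_mem' a _ := G.zero_left a
  smul_mem' c x hx a ha := by rw [G.smul_left, hx a ha, mul_zero]

theorem mem_perp {A : Set V} {x : V} : x ∈ G.perp A ↔ ∀ a ∈ A, G.B x a = 0 := Iff.rfl

theorem perp_span {A : Set V} {x : V} (h : x ∈ G.perp A) {a : V} (ha : a ∈ Submodule.span F A) :
    G.B x a = 0 := by
  have : Submodule.span F A ≤ G.perp {x} := by
    rw [Submodule.span_le]
    rintro a ha _ rfl
    exact G.perp_symm (h a ha)
  exact G.perp_symm (this ha x rfl)

/-- The isometries of a geometry preserve both `B` and `τ`. -/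
def IsIsom (g : V ≃ₗ[F] V) : Prop :=
  (∀ u v, G.B (g u) (g v) = G.B u v) ∧ ∀ v, G.τ (g v) = G.τ v

variable {G}

theorem IsIsom.mul {g h : V ≃ₗ[F] V} (hg : G.IsIsom g) (hh : G.IsIsom h) : G.IsIsom (g * h) :=
  ⟨fun u v => by rw [LinearEquiv.mul_apply, LinearEquiv.mul_apply, hg.1, hh.1],
    fun v => by rw [LinearEquiv.mul_apply, hg.2, hh.2]⟩

variable (G)

/-- A vector `x` is reflective if some nontrivial map `v ↦ v + c B(v, x) x` is an isometry; the
two equations ensure that it preserves `τ` and `B`. -/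
def IsReflective (x : V) : Prop :=
  ∃ c : F, c ≠ 0 ∧ G.tr (G.σ c) + c * G.σ c * G.τ x = 0 ∧
    G.σ c + G.ε * c + c * G.σ c * G.B x x = 0

theorem exists_isIsom_reflection [FiniteDimensional F V] {x : V} {c : F} (hc : c ≠ 0)
    (h1 : G.tr (G.σ c) + c * G.σ c * G.τ x = 0)
    (h2 : G.σ c + G.ε * c + c * G.σ c * G.B x x = 0) :
    ∃ g : V ≃ₗ[F] V, G.IsIsom g ∧ ∀ v, g v = v + (c * G.B v x) • x := by
  let f : V →ₗ[F] V := LinearMap.id + (c • G.left x).smulRight x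
  have hf : ∀ v, f v = v + (c * G.B v x) • x := fun v => rfl
  have hinj : Function.Injective f := by
    rw [← LinearMap.ker_eq_bot, LinearMap.ker_eq_bot']
    intro v hv
    rw [hf] at hv
    have h3 : G.B v x * (1 + c * G.B x x) = 0 := by
      have := congrArg (fun w => G.B w x) hv
      simp only [G.add_left, G.smul_left, G.zero_left] at this
      linear_combination this
    have h4 : 1 + c * G.B x x ≠ 0 := by
      intro h
      have : G.ε * c = 0 := by linear_combination h2 - G.σ c * h
      exact mul_ne_zero G.ε_ne_zero hc this
    have h5 := (mul_eq_zero.mp h3).resolve_right h4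
    simpa [h5] using hv
  refine ⟨LinearEquiv.ofInjectiveEndo f hinj, ⟨fun u v => ?_, fun v => ?_⟩, hf⟩
  · change G.B (f u) (f v) = _
    rw [hf, hf]
    simp only [G.add_left, G.add_right, G.smul_left, G.smul_right, map_mul]
    rw [G.symm v x]
    linear_combination (G.B u x * G.σ (G.B v x)) * h2
  · change G.τ (f v) = _
    rw [hf, G.τ_add, G.τ_smul, G.smul_right, map_mul]
    have : G.σ c * G.σ (G.B v x) * G.B v x = G.σ c * (G.B v x * G.σ (G.B v x)) := by ring
    rw [this, G.tr_mul_norm]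
    linear_combination (G.B v x * G.σ (G.B v x)) * h1

/-- The reflection in `u - v` takes `u` to `v` if `u` is not orthogonal to `u - v`. -/
theorem exists_isIsom_of_not_perp_sub [FiniteDimensional F V] {u v : V} (hτ : G.τ u = G.τ v)
    (h : G.B u (u - v) ≠ 0) :
    ∃ g : V ≃ₗ[F] V, G.IsIsom g ∧ g u = v ∧ ∀ a, G.B a u = G.B a v → g a = a := by
  set w := u - v with hw
  have hv : v = u - w := by rw [hw]; abel
  have hσ : G.σ (G.B u w) ≠ 0 := fun h' => h ((map_eq_zero G.σ).mp h')
  have hw1 : G.tr (G.B u w) = G.τ w := by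
    have : G.τ v = G.τ u + G.τ (-w) + G.tr (G.B u (-w)) := by rw [← G.τ_add, hv, sub_eq_add_neg]
    rw [G.τ_neg, G.neg_right, map_neg, ← hτ] at this
    linear_combination this
  have hw2 : G.B u w + G.B w u = G.B w w := by
    have h1 : G.B u u = G.B v v := by rw [G.self, G.self, hτ]
    rw [hv] at h1
    simp only [G.sub_left, G.sub_right] at h1
    linear_combination h1
  obtain ⟨g, hg, hgv⟩ := G.exists_isIsom_reflection (x := w) (c := -(G.B u w)⁻¹)
    (neg_ne_zero.mpr (inv_ne_zero h))
    (by
      have h3 : G.σ (-(G.B u w)⁻¹) =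
          -(G.B u w * ((G.B u w)⁻¹ * G.σ (G.B u w)⁻¹)) := by
        rw [map_neg]; field_simp
      rw [h3, map_neg, G.tr_mul_norm, hw1]
      linear_combination G.τ w * (G.B u w)⁻¹ * G.σ (G.B u w)⁻¹ * mul_inv_cancel₀ h)
    (by
      rw [← hw2, G.symm u w, map_neg, map_inv₀]
      field_simp
      ring)
  refine ⟨g, hg, ?_, fun a ha => ?_⟩
  · rw [hgv, hv, neg_mul, inv_mul_cancel₀ h, neg_one_smul, sub_eq_add_neg]
  · have h0 : G.B a w = 0 := by rw [hw, G.sub_right, ha, sub_self]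
    rw [hgv, h0, mul_zero, zero_smul, add_zero]

/-! ### Transitivity on vectors and on pairs of vectors -/

/-- One step of Witt's theorem: an isometry taking `u` to `v` that fixes a given set pointwise.
At most two reflections are needed, the first one in the given vector `x`. -/
theorem exists_isIsom_fixing [FiniteDimensional F V] {A : Set V} {u v x : V} (hτ : G.τ u = G.τ v)
    (hA : ∀ a ∈ A, G.B a u = G.B a v) (hx : G.IsReflective x) (hxA : ∀ a ∈ A, G.B a x = 0)
    (hu : G.B u x ≠ 0) (hv : G.B v x ≠ 0) :
    ∃ g : V ≃ₗ[F] V, G.IsIsom g ∧ g u = v ∧ ∀ a ∈ A, g a = a := by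
  by_cases h : G.B u (u - v) = 0
  · -- If `u` is orthogonal to `u - v`, then its image under the reflection in `x` is not.
    obtain ⟨c, hc, h1, h2⟩ := hx
    obtain ⟨r, hr, hrv⟩ := G.exists_isIsom_reflection hc h1 h2
    have hne : G.B (r u) (r u - v) ≠ 0 := by
      have h3 : G.B (r u) (r u - v) = -(c * G.B u x * G.B x v) := by
        rw [G.sub_right, hr.1, hrv, G.add_left, G.smul_left]
        rw [G.sub_right] at h
        linear_combination h
      rw [h3]
      exact neg_ne_zero.mpr (mul_ne_zero (mul_ne_zero hc hu)
        (fun h' => hv (G.perp_symm h')))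
    obtain ⟨g, hg, hgu, hga⟩ := G.exists_isIsom_of_not_perp_sub ((hr.2 u).trans hτ) hne
    refine ⟨g * r, hg.mul hr, by rw [LinearEquiv.mul_apply, hgu], fun a ha => ?_⟩
    have hra : r a = a := by rw [hrv, hxA a ha, mul_zero, zero_smul, add_zero]
    rw [LinearEquiv.mul_apply, hra]
    refine hga a ?_
    rw [← hA a ha, ← hr.1 a u, hra]
  · obtain ⟨g, hg, hgu, hga⟩ := G.exists_isIsom_of_not_perp_sub hτ h
    exact ⟨g, hg, hgu, fun a ha => hga a (hA a ha)⟩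

/-- Every coset of the orthogonal complement of a subspace of dimension at most `n` contains a
reflective vector. -/
def Plentiful (n : ℕ) : Prop :=
  ∀ S : Submodule F V, Module.finrank F S ≤ n → ∀ x, ∃ m ∈ G.perp S, G.IsReflective (x + m)

variable {G}

theorem Plentiful.mono {m n : ℕ} (h : G.Plentiful n) (hmn : m ≤ n) : G.Plentiful m :=
  fun S hS x => h S (hS.trans hmn) x

variable (G)

theorem exists_not_perp_of_not_perp (N : Submodule F V) {u v : V} (hu : ∃ x ∈ N, G.B u x ≠ 0)
    (hv : ∃ x ∈ N, G.B v x ≠ 0) : ∃ x ∈ N, G.B u x ≠ 0 ∧ G.B v x ≠ 0 := by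
  obtain ⟨x, hxN, hx⟩ := hu
  obtain ⟨y, hyN, hy⟩ := hv
  by_cases h1 : G.B v x = 0
  · by_cases h2 : G.B u y = 0
    · refine ⟨x + y, N.add_mem hxN hyN, ?_, ?_⟩
      · rwa [G.add_right, h2, add_zero]
      · rwa [G.add_right, h1, zero_add]
    · exact ⟨y, hyN, h2, hy⟩
  · exact ⟨x, hxN, hx, h1⟩

/-- A vector orthogonal to `l`, but not to `u` and `v`, can be made reflective by adding a vector
orthogonal to all of these. -/
theorem exists_reflective [FiniteDimensional F V] {n : ℕ} (hG : G.Plentiful n) {l : List V}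
    {u v : V}
    (hl : l.length + 2 ≤ n) (hu : ∃ x ∈ G.perp {a | a ∈ l}, G.B u x ≠ 0)
    (hv : ∃ x ∈ G.perp {a | a ∈ l}, G.B v x ≠ 0) :
    ∃ x, G.IsReflective x ∧ (∀ a ∈ l, G.B a x = 0) ∧ G.B u x ≠ 0 ∧ G.B v x ≠ 0 := by
  classical
  obtain ⟨x, hxl, hxu, hxv⟩ := G.exists_not_perp_of_not_perp _ hu hv
  have hS : Module.finrank F (Submodule.span F (((u :: v :: l).toFinset : Finset V) : Set V)) ≤ n :=
    (finrank_span_finset_le_card _).trans ((List.toFinset_card_le _).trans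
      (by simpa [add_assoc] using hl))
  obtain ⟨m, hm, hxm⟩ := hG _ hS x
  have hm' : ∀ a ∈ u :: v :: l, G.B a m = 0 := fun a ha =>
    G.perp_symm (hm a (Submodule.subset_span (by simpa using ha)))
  refine ⟨x + m, hxm, fun a ha => ?_, ?_, ?_⟩
  · rw [G.add_right, G.perp_symm (hxl a ha), hm' a (by simp [ha]), add_zero]
  · rwa [G.add_right, hm' u (by simp), add_zero]
  · rwa [G.add_right, hm' v (by simp), add_zero]

/-- Transitivity on the vectors outside the radical with a given value of `τ`. -/
theorem exists_isIsom_vector [FiniteDimensional F V] (hG : G.Plentiful 2) {u v : V}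
    (hτ : G.τ u = G.τ v) (hu : ∃ x, G.B u x ≠ 0) (hv : ∃ x, G.B v x ≠ 0) :
    ∃ g : V ≃ₗ[F] V, G.IsIsom g ∧ g u = v := by
  obtain ⟨x, hx, -, hxu, hxv⟩ := G.exists_reflective (l := []) hG (by simp)
    (u := u) (v := v) (hu.imp fun x hx => ⟨by simp [mem_perp], hx⟩)
    (hv.imp fun x hx => ⟨by simp [mem_perp], hx⟩)
  obtain ⟨g, hg, hgu, -⟩ := G.exists_isIsom_fixing (A := ∅) hτ (by simp) hx (by simp) hxu hxv
  exact ⟨g, hg, hgu⟩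

/-- A linearly independent pair spanning a plane that meets the radical of `B` trivially has a
vector orthogonal to the first member only. -/
theorem exists_perp_not_perp {u v : V} (hrad : ∀ a b : F, (∀ x, G.B x (a • u + b • v) = 0) →
    a = 0 ∧ b = 0) : ∃ x, G.B x u = 0 ∧ G.B v x ≠ 0 := by
  by_contra! hcon
  obtain ⟨y, hy⟩ : ∃ y, G.B y u ≠ 0 := by
    by_contra! h
    have := (hrad 1 0 (by simpa using h)).1
    exact one_ne_zero this
  set c := G.B y v / G.B y u with hc
  have h : ∀ x, G.B x ((-G.σ c) • u + (1 : F) • v) = 0 := by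
    intro x
    have h1 := G.perp_symm (hcon (x - (G.B x u / G.B y u) • y) (by
      rw [G.sub_left, G.smul_left]; field_simp; ring))
    rw [G.sub_left, G.smul_left] at h1
    rw [G.add_right, G.smul_right, G.smul_right, map_neg, G.σ_σ, hc, map_one]
    linear_combination h1
  exact one_ne_zero (hrad _ _ h).2

/-- Transitivity on pairs of vectors with given Gram matrix. -/
theorem exists_isIsom_pair [FiniteDimensional F V] (hG : G.Plentiful 3) {u u' v v' : V}
    (h1 : G.τ u = G.τ v) (h2 : G.τ u' = G.τ v') (h3 : G.B u u' = G.B v v')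
    (hu : ∀ a b : F, (∀ x, G.B x (a • u + b • u') = 0) → a = 0 ∧ b = 0)
    (hv : ∀ a b : F, (∀ x, G.B x (a • v + b • v') = 0) → a = 0 ∧ b = 0) :
    ∃ g : V ≃ₗ[F] V, G.IsIsom g ∧ g u = v ∧ g u' = v' := by
  have key : ∀ {u u' : V}, (∀ a b : F, (∀ x, G.B x (a • u + b • u') = 0) → a = 0 ∧ b = 0) →
      ∃ x, G.B u x ≠ 0 := by
    intro u u' h
    by_contra! h'
    exact one_ne_zero (h 1 0 (fun x => by simpa using G.perp_symm (h' x))).1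
  -- Move `u` to `v` by `g`, and then `g u'` to `v'` by an isometry fixing `v`.
  obtain ⟨g, hg, hgu⟩ := G.exists_isIsom_vector (hG.mono (by norm_num)) h1 (key hu) (key hv)
  obtain ⟨x, hx1, hx2⟩ := G.exists_perp_not_perp hu
  obtain ⟨y, hy1, hy2⟩ := G.exists_perp_not_perp hv
  obtain ⟨z, hz, hzl, hzu, hzv⟩ := G.exists_reflective (l := [v]) hG (by simp)
    (u := g u') (v := v')
    ⟨g x, by simp only [List.mem_singleton, mem_perp, Set.mem_ofPred_eq]; rintro _ rfl
             rw [← hgu, hg.1, hx1], by rwa [hg.1]⟩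
    ⟨y, by simp only [List.mem_singleton, mem_perp, Set.mem_ofPred_eq]; rintro _ rfl
           exact hy1, hy2⟩
  obtain ⟨k, hk, hku, hkA⟩ := G.exists_isIsom_fixing (A := {v}) (u := g u') (v := v')
    ((hg.2 u').trans h2)
    (by rintro _ rfl; rw [← h3, ← hgu, hg.1]) hz
    (by rintro _ rfl; exact hzl _ (by simp)) hzu hzv
  exact ⟨k * g, hk.mul hg, by rw [LinearEquiv.mul_apply, hgu, hkA v rfl],
    by rw [LinearEquiv.mul_apply, hku]⟩

end FormGeometry

/-! ### Planes with trivial common stabilizer -/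

namespace FormGeometry

variable {F V : Type*} [Field F] [AddCommGroup V] [Module F V] (G : FormGeometry F V)

/-- A family of mutually orthogonal hyperbolic pairs. -/
structure IsHyperbolic {ι : Type*} [DecidableEq ι] (e f : ι → V) : Prop where
  ee : ∀ i j, G.B (e i) (e j) = 0
  ff : ∀ i j, G.B (f i) (f j) = 0
  ef : ∀ i j, G.B (e i) (f j) = if i = j then 1 else 0
  τe : ∀ i, G.τ (e i) = 0
  τf : ∀ i, G.τ (f i) = 0

section Hyperbolic

variable {G} {ι : Type*} {e f : ι → V}

/-- The span of a family of hyperbolic pairs. -/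
def hypSpan (F : Type*) {V ι : Type*} [Field F] [AddCommGroup V] [Module F V] (e f : ι → V) :
    Submodule F V :=
  Submodule.span F (Set.range e ∪ Set.range f)

theorem e_mem_hypSpan (e f : ι → V) (i : ι) : e i ∈ hypSpan F e f :=
  Submodule.subset_span (Or.inl ⟨i, rfl⟩)

theorem f_mem_hypSpan (e f : ι → V) (i : ι) : f i ∈ hypSpan F e f :=
  Submodule.subset_span (Or.inr ⟨i, rfl⟩)

theorem mem_perp_hypSpan {x : V} (he : ∀ i, G.B x (e i) = 0) (hf : ∀ i, G.B x (f i) = 0) :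
    x ∈ G.perp (hypSpan F e f : Set V) := by
  have h : x ∈ G.perp (Set.range e ∪ Set.range f) := by
    rintro _ (⟨i, rfl⟩ | ⟨i, rfl⟩)
    · exact he i
    · exact hf i
  exact fun a ha => G.perp_span h ha

variable [DecidableEq ι]

theorem IsHyperbolic.fe (h : G.IsHyperbolic e f) (i j : ι) :
    G.B (f i) (e j) = if i = j then G.ε else 0 := by
  rw [G.symm, h.ef]
  by_cases hij : i = j
  · simp [hij]
  · simp [hij, Ne.symm hij]

theorem IsHyperbolic.eq_zero [Fintype ι] (h : G.IsHyperbolic e f) {x : V} (hx : x ∈ hypSpan F e f)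
    (he : ∀ i, G.B x (e i) = 0) (hf : ∀ i, G.B x (f i) = 0) : x = 0 := by
  have key : ∀ y ∈ hypSpan F e f,
      y = ∑ i, (G.B y (f i) • e i + (G.ε * G.B y (e i)) • f i) := by
    intro y hy
    induction hy using Submodule.span_induction with
    | mem y hy =>
      rcases hy with ⟨i, rfl⟩ | ⟨i, rfl⟩
      · simp [h.ee, h.ef]
      · simp [h.ff, h.fe, G.ε_mul_ε]
    | zero => simp [G.zero_left]
    | add y z _ _ hy hz =>
      conv_lhs => rw [hy, hz]
      rw [← Finset.sum_add_distrib]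
      refine Finset.sum_congr rfl fun i _ => ?_
      rw [G.add_left, G.add_left]; module
    | smul c y _ hy =>
      conv_lhs => rw [hy]
      rw [Finset.smul_sum]
      refine Finset.sum_congr rfl fun i _ => ?_
      rw [G.smul_left, G.smul_left]; module
  rw [key x hx]
  simp [he, hf]

end Hyperbolic

/-- The plane (or line) spanned by two vectors. -/
abbrev pairSpan (F : Type*) {V : Type*} [Field F] [AddCommGroup V] [Module F V] (u v : V) :
    Submodule F V :=
  Submodule.span F {u, v}

variable {G}

theorem pairSpan_comm (u v : V) : pairSpan F u v = pairSpan F v u := by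
  rw [pairSpan, Set.pair_comm]

theorem left_mem_pairSpan (u v : V) : u ∈ pairSpan F u v := Submodule.subset_span (by simp)

theorem right_mem_pairSpan (u v : V) : v ∈ pairSpan F u v := Submodule.subset_span (by simp)

theorem exists_of_map_eq {g : V ≃ₗ[F] V} {u v x : V}
    (h : (pairSpan F u v).map (g : V →ₗ[F] V) = pairSpan F u v) (hx : x ∈ pairSpan F u v) :
    ∃ a b : F, g x = a • u + b • v := by
  have : g x ∈ pairSpan F u v := by
    rw [← h]; exact ⟨x, hx, rfl⟩
  obtain ⟨a, b, hab⟩ := Submodule.mem_span_pair.mp this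
  exact ⟨a, b, hab.symm⟩

theorem pairSpan_perp {x w w' z : V} (h : G.B x w = 0) (h' : G.B x w' = 0)
    (hz : z ∈ pairSpan F w w') : G.B x z = 0 := by
  obtain ⟨a, b, rfl⟩ := Submodule.mem_span_pair.mp hz
  rw [G.add_right, G.smul_right, G.smul_right, h, h', mul_zero, mul_zero, add_zero]

/-- If the vectors of a plane that are orthogonal to a second plane form a line, then an isometry
stabilizing both planes stabilizes that line. -/
theorem IsIsom.exists_eigenvalue {g : V ≃ₗ[F] V} (hg : G.IsIsom g) {x x' w w' : V}
    (hU : (pairSpan F x x').map (g : V →ₗ[F] V) = pairSpan F x x')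
    (hW : (pairSpan F w w').map (g : V →ₗ[F] V) = pairSpan F w w')
    (h1 : G.B x w = 0) (h2 : G.B x w' = 0) (h3 : G.B x' w ≠ 0 ∨ G.B x' w' ≠ 0) :
    ∃ a : F, g x = a • x := by
  obtain ⟨a, b, hab⟩ := exists_of_map_eq hU (left_mem_pairSpan x x')
  have key : ∀ z ∈ pairSpan F w w', G.B (g x) z = 0 := by
    intro z hz
    rw [← hW] at hz
    obtain ⟨t, ht, rfl⟩ := hz
    exact (hg.1 x t).trans (pairSpan_perp h1 h2 ht)
  have hb : b = 0 := by
    have k1 := key w (left_mem_pairSpan w w')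
    have k2 := key w' (right_mem_pairSpan w w')
    rw [hab, G.add_left, G.smul_left, G.smul_left, h1, mul_zero, zero_add] at k1
    rw [hab, G.add_left, G.smul_left, G.smul_left, h2, mul_zero, zero_add] at k2
    rcases h3 with h3 | h3
    · exact (mul_eq_zero.mp k1).resolve_right h3
    · exact (mul_eq_zero.mp k2).resolve_right h3
  exact ⟨a, by rw [hab, hb, zero_smul, add_zero]⟩

/-- If an isometry is a scalar on a nondegenerate subspace `H` and stabilizes a plane that projects
isomorphically to `H`, then it acts by the same scalar on the projection of that plane to the
orthogonal complement of `H`. -/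
theorem IsIsom.eq_smul_of_graph {g : V ≃ₗ[F] V} (hg : G.IsIsom g) {H : Submodule F V}
    (hH : ∀ x ∈ H, x ∈ G.perp (H : Set V) → x = 0) {ν : F} (hν : ν * G.σ ν = 1)
    (hgH : ∀ x ∈ H, g x = ν • x) {w w' y y' : V} (hw : w ∈ H) (hw' : w' ∈ H)
    (hind : ∀ a b : F, a • w + b • w' = 0 → a = 0 ∧ b = 0)
    (hy : y ∈ G.perp (H : Set V)) (hy' : y' ∈ G.perp (H : Set V))
    (hU : (pairSpan F (w + y) (w' + y')).map (g : V →ₗ[F] V) = pairSpan F (w + y) (w' + y')) :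
    g y = ν • y ∧ g y' = ν • y' := by
  have key : ∀ u ∈ pairSpan F (w + y) (w' + y'), g u = ν • u := by
    intro u hu
    obtain ⟨a, b, hab⟩ := exists_of_map_eq hU hu
    obtain ⟨c, d, hcd⟩ := Submodule.mem_span_pair.mp hu
    have hz : g u - ν • u = ((a - ν * c) • w + (b - ν * d) • w') +
        ((a - ν * c) • y + (b - ν * d) • y') := by
      rw [hab, ← hcd]; module
    have h0 : (a - ν * c) • w + (b - ν * d) • w' = 0 := by
      refine hH _ (H.add_mem (H.smul_mem _ hw) (H.smul_mem _ hw')) fun x hx => ?_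
      have h1 : G.B (g u - ν • u) x = 0 := by
        have h2 : G.B (g u) (g x) = G.B u x := hg.1 u x
        rw [hgH x hx, G.smul_right] at h2
        rw [G.sub_left, G.smul_left]
        linear_combination ν * h2 - G.B (g u) x * hν
      rw [hz, G.add_left] at h1
      have h3 : G.B ((a - ν * c) • y + (b - ν * d) • y') x = 0 :=
        (G.perp (H : Set V)).add_mem (Submodule.smul_mem _ _ hy) (Submodule.smul_mem _ _ hy') x hx
      rwa [h3, add_zero] at h1
    obtain ⟨h4, h5⟩ := hind _ _ h0
    rw [← sub_eq_zero, hz, h4, h5]; module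
  have h1 := key _ (left_mem_pairSpan _ _)
  have h2 := key _ (right_mem_pairSpan _ _)
  rw [map_add, hgH w hw, smul_add] at h1
  rw [map_add, hgH w' hw', smul_add] at h2
  exact ⟨add_left_cancel h1, add_left_cancel h2⟩

section Isotropic

variable {e f : Fin 3 → V}

/-- The torus that stabilizes the planes `⟨e 0, e 1⟩`, `⟨f 0, e 2⟩`, `⟨f 1, f 2⟩` is cut down to
scalars by one more plane, given by the graph of a map into the orthogonal complement. -/
theorem IsHyperbolic.scalar_of_isotropic (h : G.IsHyperbolic e f) {g : V ≃ₗ[F] V}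
    (hg : G.IsIsom g)
    (h0 : (pairSpan F (e 0) (e 1)).map (g : V →ₗ[F] V) = pairSpan F (e 0) (e 1))
    (h1 : (pairSpan F (f 0) (e 2)).map (g : V →ₗ[F] V) = pairSpan F (f 0) (e 2))
    (h2 : (pairSpan F (f 1) (f 2)).map (g : V →ₗ[F] V) = pairSpan F (f 1) (f 2))
    {s x y : F} {z z' : V} (hz : z ∈ G.perp (hypSpan F e f : Set V))
    (hz' : z' ∈ G.perp (hypSpan F e f : Set V))
    (h3 : (pairSpan F (e 0 + e 1 + e 2 + s • f 1 + z) (f 0 + e 2 + x • f 1 + y • f 2 + z')).map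
      (g : V →ₗ[F] V) =
        pairSpan F (e 0 + e 1 + e 2 + s • f 1 + z) (f 0 + e 2 + x • f 1 + y • f 2 + z')) :
    ∃ ν : F, ν * G.σ ν = 1 ∧ ∀ i, g (e i) = ν • e i ∧ g (f i) = ν • f i := by
  have hε := G.ε_ne_zero
  have h0' := h0
  rw [pairSpan_comm] at h0'
  have h1' := h1
  rw [pairSpan_comm] at h1'
  have h2' := h2
  rw [pairSpan_comm] at h2'
  -- In each of the three planes, the two basis vectors are singled out by orthogonality to one of
  -- the other planes.
  obtain ⟨a0, ha0⟩ := hg.exists_eigenvalue h0 h2 (by simp [h.ef]) (by simp [h.ef])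
    (by simp [h.ef])
  obtain ⟨a1, ha1⟩ := hg.exists_eigenvalue h0' h1 (by simp [h.ef]) (by simp [h.ee])
    (by simp [h.ef])
  obtain ⟨b0, hb0⟩ := hg.exists_eigenvalue h1 h2 (by simp [h.ff]) (by simp [h.ff])
    (by simp [h.ef])
  obtain ⟨a2, ha2⟩ := hg.exists_eigenvalue h1' h0 (by simp [h.ee]) (by simp [h.ee])
    (by simp [h.fe, hε])
  obtain ⟨b1, hb1⟩ := hg.exists_eigenvalue h2 h1 (by simp [h.ff]) (by simp [h.fe])
    (by simp [h.fe, hε])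
  obtain ⟨b2, hb2⟩ := hg.exists_eigenvalue h2' h0 (by simp [h.fe]) (by simp [h.fe])
    (by simp [h.fe, hε])
  have m0 : a0 * G.σ b0 = 1 := by
    have := hg.1 (e 0) (f 0)
    rw [ha0, hb0, G.smul_left, G.smul_right, h.ef] at this
    simpa using this
  have m1 : a1 * G.σ b1 = 1 := by
    have := hg.1 (e 1) (f 1)
    rw [ha1, hb1, G.smul_left, G.smul_right, h.ef] at this
    simpa using this
  have m2 : a2 * G.σ b2 = 1 := by
    have := hg.1 (e 2) (f 2)
    rw [ha2, hb2, G.smul_left, G.smul_right, h.ef] at this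
    simpa using this
  set u := e 0 + e 1 + e 2 + s • f 1 + z with hu
  set v := f 0 + e 2 + x • f 1 + y • f 2 + z' with hv
  have ze : ∀ i, G.B z (e i) = 0 := fun i => hz _ (e_mem_hypSpan e f i)
  have zf : ∀ i, G.B z (f i) = 0 := fun i => hz _ (f_mem_hypSpan e f i)
  have ze' : ∀ i, G.B z' (e i) = 0 := fun i => hz' _ (e_mem_hypSpan e f i)
  have zf' : ∀ i, G.B z' (f i) = 0 := fun i => hz' _ (f_mem_hypSpan e f i)
  have ue0 : G.B u (e 0) = 0 := by
    simp [hu, G.add_left, G.smul_left, h.ee, h.fe, ze]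
  have uf : ∀ i, G.B u (f i) = 1 := by
    intro i
    fin_cases i <;> simp [hu, G.add_left, G.smul_left, h.ff, h.ef, zf]
  have ve0 : G.B v (e 0) = G.ε := by
    simp [hv, G.add_left, G.smul_left, h.ee, h.fe, ze']
  have vf0 : G.B v (f 0) = 0 := by
    simp [hv, G.add_left, G.smul_left, h.ff, h.ef, zf']
  have vf2 : G.B v (f 2) = 1 := by
    simp [hv, G.add_left, G.smul_left, h.ff, h.ef, zf']
  -- As `u` spans the part of `⟨u, v⟩` orthogonal to `e 0`, and `v` the part orthogonal to `f 0`,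
  -- both are eigenvectors; their products with the other eigenvectors link the eigenvalues.
  obtain ⟨c, d, hcd⟩ := exists_of_map_eq h3 (left_mem_pairSpan u v)
  obtain ⟨c', d', hcd'⟩ := exists_of_map_eq h3 (right_mem_pairSpan u v)
  have na0 : G.σ a0 ≠ 0 := fun h' => by simp [(map_eq_zero G.σ).mp h'] at m0
  have nb0 : G.σ b0 ≠ 0 := fun h' => by simp [h'] at m0
  have hd : d = 0 := by
    have := hg.1 u (e 0)
    rw [ha0, hcd, G.smul_right, G.add_left, G.smul_left, G.smul_left, ue0, ve0] at this
    simpa [na0, hε] using this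
  have hc' : c' = 0 := by
    have := hg.1 v (f 0)
    rw [hb0, hcd', G.smul_right, G.add_left, G.smul_left, G.smul_left, vf0, uf] at this
    simpa [nb0] using this
  have k0 : G.σ b0 * c = 1 := by
    have := hg.1 u (f 0)
    rw [hb0, hcd, hd, G.smul_right, G.add_left, G.smul_left, G.smul_left, uf] at this
    simpa using this
  have k1 : G.σ b1 * c = 1 := by
    have := hg.1 u (f 1)
    rw [hb1, hcd, hd, G.smul_right, G.add_left, G.smul_left, G.smul_left, uf] at this
    simpa using this
  have k2 : G.σ b2 * c = 1 := by
    have := hg.1 u (f 2)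
    rw [hb2, hcd, hd, G.smul_right, G.add_left, G.smul_left, G.smul_left, uf] at this
    simpa using this
  have l0 : G.σ a0 * d' = 1 := by
    have := hg.1 v (e 0)
    rw [ha0, hcd', hc', G.smul_right, G.add_left, G.smul_left, G.smul_left, ve0] at this
    have h5 : G.ε * (G.σ a0 * d' - 1) = 0 := by linear_combination this
    exact sub_eq_zero.mp ((mul_eq_zero.mp h5).resolve_left hε)
  have l2 : G.σ b2 * d' = 1 := by
    have := hg.1 v (f 2)
    rw [hb2, hcd', hc', G.smul_right, G.add_left, G.smul_left, G.smul_left, vf2] at this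
    simpa using this
  have hinj : ∀ {p q r : F}, G.σ p * r = 1 → G.σ q * r = 1 → p = q := by
    intro p q r hp hq
    have hr : r ≠ 0 := fun h' => by simp [h'] at hp
    exact G.σ.injective (mul_right_cancel₀ hr (hp.trans hq.symm))
  have e01 : b0 = b1 := hinj k0 k1
  have e02 : b0 = b2 := hinj k0 k2
  have ea : a0 = b2 := hinj l0 l2
  have hnb : ∀ {p q : F}, p * G.σ b0 = 1 → q * G.σ b0 = 1 → p = q := by
    intro p q hp hq
    exact mul_right_cancel₀ nb0 (hp.trans hq.symm)
  rw [← e01] at m1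
  rw [← e02] at m2 ea
  have e1 : a1 = b0 := (hnb m1 m0).trans ea
  have e2 : a2 = b0 := (hnb m2 m0).trans ea
  refine ⟨b0, by rw [← ea] at m0 ⊢; exact m0, fun i => ?_⟩
  fin_cases i
  · exact ⟨by simpa [ea] using ha0, hb0⟩
  · exact ⟨by simpa [e1] using ha1, by simpa [e01] using hb1⟩
  · exact ⟨by simpa [e2] using ha2, by simpa [e02] using hb2⟩

end Isotropic

section Nondegenerate

/-- Three planes `⟨p i, h i⟩` in which `p i` is orthogonal to the other two planes have a common
stabilizer that is the scalars, up to maps moving vectors only inside `⟨p 0, p 1, p 2⟩`.  A fourth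
plane, whose projection to the span of the three does not meet `⟨p 0, p 1, p 2⟩`, leaves just
scalars. -/
theorem scalar_of_nondegenerate {p h : Fin 3 → V} (hpp : ∀ i j, i ≠ j → G.B (p i) (p j) = 0)
    (hph : ∀ i j, i ≠ j → G.B (p i) (h j) = 0) (hhh : ∀ i j, i ≠ j → G.B (h i) (h j) ≠ 0)
    {g : V ≃ₗ[F] V} (hg : G.IsIsom g)
    (hU : ∀ i, (pairSpan F (p i) (h i)).map (g : V →ₗ[F] V) = pairSpan F (p i) (h i))
    {H : Submodule F V} (hH : H = ⨆ i, pairSpan F (p i) (h i))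
    (hnd : ∀ x ∈ H, x ∈ G.perp (H : Set V) → x = 0)
    {w w' y y' : V} (hw : w ∈ H) (hw' : w' ∈ H)
    (hy : y ∈ G.perp (H : Set V)) (hy' : y' ∈ G.perp (H : Set V))
    (hwP : ∀ a b : F, a • w + b • w' ∈ Submodule.span F (Set.range p) → a = 0 ∧ b = 0)
    (hwp : ∀ i, G.B w (p i) ≠ 0 ∨ G.B w' (p i) ≠ 0)
    (hT : (pairSpan F (w + y) (w' + y')).map (g : V →ₗ[F] V) = pairSpan F (w + y) (w' + y')) :
    ∃ ν : F, ν * G.σ ν = 1 ∧ ∀ x ∈ H, g x = ν • x := by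
  have hp1 : ∀ i, ∃ l : F, g (p i) = l • p i := fun i => by
    have hi : i ≠ i + 1 := by fin_cases i <;> decide
    exact hg.exists_eigenvalue (hU i) (hU (i + 1)) (hpp _ _ hi) (hph _ _ hi) (Or.inr (hhh _ _ hi))
  choose l hl using hp1
  have hh1 : ∀ i, ∃ m n : F, g (h i) = m • p i + n • h i := fun i =>
    exists_of_map_eq (hU i) (right_mem_pairSpan _ _)
  choose m n hmn using hh1
  have hhp : ∀ i j, i ≠ j → G.B (h i) (p j) = 0 := fun i j hij => G.perp_symm (hph j i hij.symm)
  have hn : ∀ i j, i ≠ j → n i * G.σ (n j) = 1 := by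
    intro i j hij
    have h1 := hg.1 (h i) (h j)
    rw [hmn, hmn] at h1
    simp only [G.add_left, G.add_right, G.smul_left, G.smul_right, hpp i j hij, hph i j hij,
      hhp i j hij] at h1
    have h2 : (n i * G.σ (n j) - 1) * G.B (h i) (h j) = 0 := by linear_combination h1
    exact sub_eq_zero.mp ((mul_eq_zero.mp h2).resolve_right (hhh i j hij))
  have hn1 : n 1 = n 0 := by
    have h02 := hn 0 2 (by decide)
    have h12 := hn 1 2 (by decide)
    have h0 : G.σ (n 2) ≠ 0 := fun h' => by simp [h'] at h02
    exact mul_right_cancel₀ h0 (h12.trans h02.symm)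
  have hn2 : n 2 = n 0 := by
    have h01 := hn 0 1 (by decide)
    have h21 := hn 2 1 (by decide)
    have h0 : G.σ (n 1) ≠ 0 := fun h' => by simp [h'] at h01
    exact mul_right_cancel₀ h0 (h21.trans h01.symm)
  have hnν : ∀ i, n i = n 0 := by
    intro i
    fin_cases i
    · rfl
    · exact hn1
    · exact hn2
  set ν := n 0 with hνdef
  have hν : ν * G.σ ν = 1 := by
    have h01 := hn 0 1 (by decide)
    rwa [hn1] at h01
  have hpP : ∀ i, p i ∈ Submodule.span F (Set.range p) := fun i =>
    Submodule.subset_span ⟨i, rfl⟩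
  -- `g - ν` maps `H` into the span of the `p i`.
  have hgP : ∀ x ∈ H, g x - ν • x ∈ Submodule.span F (Set.range p) := by
    have : H ≤ (Submodule.span F (Set.range p)).comap ((g : V →ₗ[F] V) - ν • LinearMap.id) := by
      rw [hH, iSup_le_iff]
      intro i
      rw [Submodule.span_le]
      rintro x (rfl | rfl)
      · change g (p i) - ν • p i ∈ Submodule.span F (Set.range p)
        rw [hl, ← sub_smul]
        exact Submodule.smul_mem _ _ (hpP i)
      · change g (h i) - ν • h i ∈ Submodule.span F (Set.range p)
        rw [hmn, hnν, add_sub_cancel_right]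
        exact Submodule.smul_mem _ _ (hpP i)
    exact fun x hx => this hx
  have hPH : Submodule.span F (Set.range p) ≤ H := by
    rw [Submodule.span_le, hH]
    rintro _ ⟨i, rfl⟩
    exact Submodule.mem_iSup_of_mem i (left_mem_pairSpan _ _)
  have hgH : H.map (g : V →ₗ[F] V) = H := by
    rw [hH, Submodule.map_iSup]
    exact iSup_congr hU
  have hgperp : ∀ z ∈ G.perp (H : Set V), g z ∈ G.perp (H : Set V) := by
    intro z hz x hx
    rw [SetLike.mem_coe, ← hgH] at hx
    obtain ⟨t, ht, rfl⟩ := hx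
    exact (hg.1 z t).trans (hz t ht)
  -- On the fourth plane, the component of `g - ν` in `H` lies in the span of the `p i`, which that
  -- plane avoids.
  have hTν : ∀ u ∈ pairSpan F (w + y) (w' + y'), g u = ν • u := by
    intro u hu
    obtain ⟨a, b, hab⟩ := exists_of_map_eq hT hu
    obtain ⟨c, d, hcd⟩ := Submodule.mem_span_pair.mp hu
    have hx : c • w + d • w' ∈ H := H.add_mem (H.smul_mem _ hw) (H.smul_mem _ hw')
    have hz : c • y + d • y' ∈ G.perp (H : Set V) :=
      Submodule.add_mem _ (Submodule.smul_mem _ _ hy) (Submodule.smul_mem _ _ hy')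
    have hux : u = (c • w + d • w') + (c • y + d • y') := by rw [← hcd]; module
    have h1 : (a - ν * c) • w + (b - ν * d) • w' -
        (g (c • w + d • w') - ν • (c • w + d • w')) = (g (c • y + d • y') - ν • (c • y + d • y')) -
          ((a - ν * c) • y + (b - ν * d) • y') := by
      have h2 : g (c • w + d • w') + g (c • y + d • y') = a • (w + y) + b • (w' + y') := by
        rw [← map_add, ← hux, hab]
      rw [sub_eq_sub_iff_add_eq_add, ← sub_eq_zero]
      rw [← sub_eq_zero] at h2
      rw [← neg_eq_zero, ← h2]
      module
    have h3 : (a - ν * c) • w + (b - ν * d) • w' = g (c • w + d • w') - ν • (c • w + d • w') := by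
      rw [← sub_eq_zero]
      refine hnd _ (H.sub_mem (H.add_mem (H.smul_mem _ hw) (H.smul_mem _ hw')) (hPH (hgP _ hx))) ?_
      rw [h1]
      exact Submodule.sub_mem _ (Submodule.sub_mem _ (hgperp _ hz) (Submodule.smul_mem _ _ hz))
        (Submodule.add_mem _ (Submodule.smul_mem _ _ hy) (Submodule.smul_mem _ _ hy'))
    obtain ⟨h4, h5⟩ := hwP _ _ (h3 ▸ hgP _ hx)
    rw [hab, ← hcd, ← sub_eq_zero]
    have h6 : a = ν * c := sub_eq_zero.mp h4
    have h7 : b = ν * d := sub_eq_zero.mp h5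
    rw [h6, h7]
    module
  have hpH : ∀ i, p i ∈ H := fun i => hPH (hpP i)
  have hnot : ∀ i, ∃ u ∈ pairSpan F (w + y) (w' + y'), G.B u (p i) ≠ 0 := by
    intro i
    rcases hwp i with h1 | h1
    · exact ⟨_, left_mem_pairSpan _ _, by rwa [G.add_left, hy _ (hpH i), add_zero]⟩
    · exact ⟨_, right_mem_pairSpan _ _, by rwa [G.add_left, hy' _ (hpH i), add_zero]⟩
  have hν0 : ν ≠ 0 := fun h' => by simp [h'] at hν
  -- Products with a vector of the fourth plane that is not orthogonal to `p i` determine `g (p i)`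
  -- and `g (h i)`.
  have hlν : ∀ i, l i = ν := by
    intro i
    obtain ⟨u, hu, hup⟩ := hnot i
    have h1 := hg.1 u (p i)
    rw [hTν u hu, hl, G.smul_left, G.smul_right] at h1
    have h2 : (ν * G.σ (l i) - ν * G.σ ν) * G.B u (p i) = 0 := by
      linear_combination h1 - hν * G.B u (p i)
    have h3 := sub_eq_zero.mp ((mul_eq_zero.mp h2).resolve_right hup)
    exact G.σ.injective (mul_left_cancel₀ hν0 h3)
  have hm0 : ∀ i, m i = 0 := by
    intro i
    obtain ⟨u, hu, hup⟩ := hnot i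
    have h1 := hg.1 u (h i)
    rw [hTν u hu, hmn, hnν, G.smul_left, G.add_right, G.smul_right, G.smul_right] at h1
    have h2 : ν * G.σ (m i) * G.B u (p i) = 0 := by
      linear_combination h1 - hν * G.B u (h i)
    have h3 := (mul_eq_zero.mp ((mul_eq_zero.mp h2).resolve_right hup)).resolve_left hν0
    exact (map_eq_zero G.σ).mp h3
  refine ⟨ν, hν, ?_⟩
  have : H ≤ LinearMap.ker ((g : V →ₗ[F] V) - ν • LinearMap.id) := by
    rw [hH, iSup_le_iff]
    intro i
    rw [Submodule.span_le]
    rintro x (rfl | rfl)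
    · change g (p i) - ν • p i = 0
      rw [hl, hlν, sub_self]
    · change g (h i) - ν • h i = 0
      rw [hmn, hm0, hnν, zero_smul, zero_add, sub_self]
  exact fun x hx => sub_eq_zero.mp (this hx)

end Nondegenerate

end FormGeometry

/-! ### Upper bounds for base sizes -/

section BaseSize

variable {F V : Type*} [Field F] [AddCommGroup V] [Module F V]

/-- A family of images of `U` whose common stabilizer in `H` consists of scalars gives a base. -/
theorem baseSize_orbit_le [Nontrivial V] (H : Subgroup (V ≃ₗ[F] V)) (U : Submodule F V)
    {ι : Type*} [Fintype ι] (S : ι → Submodule F V)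
    (hS : ∀ i, ∃ g ∈ H, U.map ((g : V ≃ₗ[F] V) : V →ₗ[F] V) = S i)
    (hstab : ∀ g ∈ H, (∀ i, (S i).map ((g : V ≃ₗ[F] V) : V →ₗ[F] V) = S i) →
      ∃ c : F, ∀ v, g v = c • v) :
    baseSize (ProjectiveGroup H) (MulAction.orbit (ProjectiveGroup H) U) ≤ Fintype.card ι := by
  have hmem : ∀ i, S i ∈ MulAction.orbit (ProjectiveGroup H) U := by
    intro i
    obtain ⟨g, hg, hgi⟩ := hS i
    exact ⟨ProjectiveGroup.mk H ⟨g, hg⟩, by rw [← hgi]; rfl⟩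
  let b : ι → MulAction.orbit (ProjectiveGroup H) U := fun i => ⟨S i, hmem i⟩
  refine (iInf₂_le (Set.range b) ?_).trans ?_
  · rw [eq_bot_iff]
    intro x hx
    obtain ⟨g, rfl⟩ : ∃ g, ProjectiveGroup.mk H g = x := QuotientGroup.mk'_surjective _ x
    have hfix : ∀ i, (S i).map ((g : V ≃ₗ[F] V) : V →ₗ[F] V) = S i := by
      intro i
      have := (mem_fixingSubgroup_iff _).mp hx (b i) ⟨i, rfl⟩
      exact congrArg Subtype.val this
    obtain ⟨c, hc⟩ := hstab g g.2 hfix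
    obtain ⟨v, hv⟩ := exists_ne (0 : V)
    have hc0 : c ≠ 0 := by
      rintro rfl
      have h1 := hc v
      rw [zero_smul] at h1
      exact hv ((map_eq_zero_iff _ (g : V ≃ₗ[F] V).injective).mp h1)
    rw [Subgroup.mem_bot]
    refine (QuotientGroup.eq_one_iff g).mpr (Subgroup.mem_subgroupOf.mpr ⟨Units.mk0 c hc0, ?_⟩)
    ext w
    exact (hc w).symm
  · rw [← Set.image_univ]
    refine (Set.encard_image_le _ _).trans ?_
    rw [Set.encard_univ, ENat.card_eq_coe_fintype_card]

end BaseSize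

namespace FormGeometry

variable {F V : Type*} [Field F] [AddCommGroup V] [Module F V] {G : FormGeometry F V}

/-- By Witt's theorem for pairs, a family of pairs with the Gram matrix of `(p, p')` gives a base if
only scalars stabilize all the planes spanned by these pairs. -/
theorem baseSize_pairSpan_le [FiniteDimensional F V] [Nontrivial V] (hG : G.Plentiful 3)
    {H : Subgroup (V ≃ₗ[F] V)} (hH : ∀ g, g ∈ H ↔ G.IsIsom g) {p p' : V}
    (hp : ∀ a b : F, (∀ x, G.B x (a • p + b • p') = 0) → a = 0 ∧ b = 0)
    {ι : Type*} [Fintype ι] (u v : ι → V) (h1 : ∀ i, G.τ (u i) = G.τ p)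
    (h2 : ∀ i, G.τ (v i) = G.τ p') (h3 : ∀ i, G.B (u i) (v i) = G.B p p')
    (huv : ∀ i, ∀ a b : F, (∀ x, G.B x (a • u i + b • v i) = 0) → a = 0 ∧ b = 0)
    (hstab : ∀ g, G.IsIsom g →
      (∀ i, (pairSpan F (u i) (v i)).map (g : V →ₗ[F] V) = pairSpan F (u i) (v i)) →
      ∃ c : F, ∀ x, g x = c • x) :
    baseSize (ProjectiveGroup H) (MulAction.orbit (ProjectiveGroup H) (pairSpan F p p')) ≤
      Fintype.card ι := by
  refine baseSize_orbit_le H _ (fun i => pairSpan F (u i) (v i)) (fun i => ?_) fun g hg =>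
    hstab g ((hH g).mp hg)
  obtain ⟨g, hg, hgu, hgv⟩ := G.exists_isIsom_pair hG (h1 i).symm (h2 i).symm (h3 i).symm hp (huv i)
  refine ⟨g, (hH g).mpr hg, ?_⟩
  rw [pairSpan, Submodule.map_span, Set.image_pair]
  change Submodule.span F {g p, g p'} = _
  rw [hgu, hgv]

theorem pair_not_radical {H : Submodule F V} (hH : ∀ x ∈ H, x ∈ G.perp (H : Set V) → x = 0)
    {w w' y y' : V} (hw : w ∈ H) (hw' : w' ∈ H)
    (hind : ∀ a b : F, a • w + b • w' = 0 → a = 0 ∧ b = 0)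
    (hy : y ∈ G.perp (H : Set V)) (hy' : y' ∈ G.perp (H : Set V)) (a b : F)
    (h : ∀ x, G.B x (a • (w + y) + b • (w' + y')) = 0) : a = 0 ∧ b = 0 := by
  refine hind a b (hH _ (H.add_mem (H.smul_mem _ hw) (H.smul_mem _ hw')) fun x hx => ?_)
  have h1 := G.perp_symm (h x)
  have h2 : G.B (a • y + b • y') x = 0 :=
    Submodule.add_mem _ (Submodule.smul_mem _ a hy) (Submodule.smul_mem _ b hy') x hx
  rw [show a • (w + y) + b • (w' + y') = (a • w + b • w') + (a • y + b • y') by module,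
    G.add_left, h2, add_zero] at h1
  exact h1

theorem IsHyperbolic.nondegenerate {ι : Type*} [DecidableEq ι] [Fintype ι] {e f : ι → V}
    (h : G.IsHyperbolic e f) (x : V) (hx : x ∈ hypSpan F e f)
    (hx' : x ∈ G.perp (hypSpan F e f : Set V)) : x = 0 :=
  h.eq_zero hx (fun i => hx' _ (e_mem_hypSpan e f i)) fun i => hx' _ (f_mem_hypSpan e f i)

variable {e f : Fin 3 → V}

/-- An isometry that is a scalar on the span `H` of three hyperbolic pairs is a scalar if it
stabilizes sufficiently many planes that project isomorphically to `H`. -/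
theorem IsHyperbolic.forall_eq_smul (h : G.IsHyperbolic e f) {g : V ≃ₗ[F] V}
    (hg : G.IsIsom g) {ν : F} (hν : ν * G.σ ν = 1) (hgH : ∀ x ∈ hypSpan F e f, g x = ν • x)
    {J : Type*} {y y' w w' : J → V} (hy : ∀ j, y j ∈ G.perp (hypSpan F e f : Set V))
    (hy' : ∀ j, y' j ∈ G.perp (hypSpan F e f : Set V))
    (hspan : hypSpan F e f ⊔ Submodule.span F (Set.range y ∪ Set.range y') = ⊤)
    (hw : ∀ j, w j ∈ hypSpan F e f) (hw' : ∀ j, w' j ∈ hypSpan F e f)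
    (hind : ∀ j, ∀ a b : F, a • w j + b • w' j = 0 → a = 0 ∧ b = 0)
    (hU : ∀ j, (pairSpan F (w j + y j) (w' j + y' j)).map (g : V →ₗ[F] V) =
      pairSpan F (w j + y j) (w' j + y' j)) (x : V) : g x = ν • x := by
  have : (⊤ : Submodule F V) ≤ LinearMap.ker ((g : V →ₗ[F] V) - ν • LinearMap.id) := by
    rw [← hspan, sup_le_iff, Submodule.span_le]
    refine ⟨fun x hx => sub_eq_zero.mpr (hgH x hx), ?_⟩
    rintro _ (⟨j, rfl⟩ | ⟨j, rfl⟩)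
    · exact sub_eq_zero.mpr (hg.eq_smul_of_graph h.nondegenerate hν hgH (hw j) (hw' j) (hind j)
        (hy j) (hy' j) (hU j)).1
    · exact sub_eq_zero.mpr (hg.eq_smul_of_graph h.nondegenerate hν hgH (hw j) (hw' j) (hind j)
        (hy j) (hy' j) (hU j)).2
  exact sub_eq_zero.mp (this (Submodule.mem_top (x := x)))

theorem exists_tr_eq_neg (x : V) : ∃ s, G.tr s = -G.τ x := by
  obtain ⟨s, hs⟩ := G.exists_tr x
  exact ⟨-s, by rw [map_neg, hs]⟩

theorem exists_tr_eq_sub (x y : V) : ∃ s, G.tr s = G.τ x - G.τ y := by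
  obtain ⟨s, hs⟩ := G.exists_tr x
  obtain ⟨t, ht⟩ := G.exists_tr y
  exact ⟨s - t, by rw [map_sub, hs, ht]⟩

theorem hypSpan_le {ι : Type*} {e f : ι → V} (W : Submodule F V)
    (he : ∀ i, e i ∈ W) (hf : ∀ i, f i ∈ W) : hypSpan F e f ≤ W := by
  rw [hypSpan, Submodule.span_le]
  rintro _ (⟨i, rfl⟩ | ⟨i, rfl⟩)
  · exact he i
  · exact hf i

/-- Bases consisting of totally isotropic (or totally singular) planes. -/
theorem IsHyperbolic.baseSize_isotropic_le [FiniteDimensional F V] (h : G.IsHyperbolic e f)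
    (hG : G.Plentiful 3)
    {H : Subgroup (V ≃ₗ[F] V)} (hH : ∀ g, g ∈ H ↔ G.IsIsom g) {p p' : V}
    (hp : ∀ a b : F, (∀ x, G.B x (a • p + b • p') = 0) → a = 0 ∧ b = 0)
    (h1 : G.τ p = 0) (h2 : G.τ p' = 0) (h3 : G.B p p' = 0)
    {J : Type*} [Fintype J] [Nonempty J] (y y' : J → V)
    (hy : ∀ j, y j ∈ G.perp (hypSpan F e f : Set V))
    (hy' : ∀ j, y' j ∈ G.perp (hypSpan F e f : Set V))
    (hspan : hypSpan F e f ⊔ Submodule.span F (Set.range y ∪ Set.range y') = ⊤) :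
    baseSize (ProjectiveGroup H) (MulAction.orbit (ProjectiveGroup H) (pairSpan F p p')) ≤
      (3 + Fintype.card J : ℕ) := by
  have hε := G.ε_ne_zero
  have : Nontrivial V := ⟨e 0, 0, fun h0 => by
    have := h.ef 0 0
    rw [h0, G.zero_left] at this
    simp at this⟩
  choose s hs using fun j => G.exists_tr_eq_neg (y j)
  choose t ht using fun j => G.exists_tr_eq_neg (y' j)
  -- The coefficient of `f 1` in `w' j` for which `B (w j) (w' j) = -B (y j) (y' j)`.
  let x : J → F := fun j => G.σ (-G.B (y j) (y' j) - 1 - G.σ (t j))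
  let w : J → V := fun j => e 0 + e 1 + e 2 + s j • f 1
  let w' : J → V := fun j => f 0 + e 2 + x j • f 1 + t j • f 2
  have he := e_mem_hypSpan (F := F) e f
  have hf := f_mem_hypSpan (F := F) e f
  have hw : ∀ j, w j ∈ hypSpan F e f := fun j =>
    add_mem (add_mem (add_mem (he 0) (he 1)) (he 2)) (Submodule.smul_mem _ _ (hf 1))
  have hw' : ∀ j, w' j ∈ hypSpan F e f := fun j =>
    add_mem (add_mem (add_mem (hf 0) (he 2)) (Submodule.smul_mem _ _ (hf 1)))
      (Submodule.smul_mem _ _ (hf 2))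
  have hind : ∀ j, ∀ a b : F, a • w j + b • w' j = 0 → a = 0 ∧ b = 0 := by
    intro j a b hab
    have k1 := congrArg (fun z => G.B z (f 0)) hab
    have k2 := congrArg (fun z => G.B z (e 0)) hab
    simp [w, w', G.add_left, G.smul_left, h.ef, h.ff, h.ee, h.fe, G.zero_left, hε] at k1 k2
    exact ⟨k1, k2⟩
  let u : Fin 3 ⊕ J → V := Sum.elim ![e 0, f 0, f 1] fun j => w j + y j
  let v : Fin 3 ⊕ J → V := Sum.elim ![e 1, e 2, f 2] fun j => w' j + y' j
  have hcard : (3 + Fintype.card J : ℕ) = Fintype.card (Fin 3 ⊕ J) := by simp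
  rw [hcard]
  have hwy : ∀ j, ∀ a ∈ hypSpan F e f, G.B a (y j) = 0 := fun j a ha => G.perp_symm (hy j a ha)
  have hwy' : ∀ j, ∀ a ∈ hypSpan F e f, G.B a (y' j) = 0 := fun j a ha => G.perp_symm (hy' j a ha)
  refine baseSize_pairSpan_le hG hH hp u v ?_ ?_ ?_ ?_ ?_
  · rintro (i | j)
    · rw [h1]; fin_cases i <;> simp [u, h.τe, h.τf]
    · have k : G.τ (w j) = G.tr (s j) := by
        simp [w, G.τ_add, G.τ_smul, h.τe, h.τf, G.add_left, G.smul_right, h.ef, h.ee, G.tr_σ]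
      change G.τ (w j + y j) = _
      rw [G.τ_add, hwy j _ (hw j), k, hs, h1, map_zero]; ring
  · rintro (i | j)
    · rw [h2]; fin_cases i <;> simp [v, h.τe, h.τf]
    · have k : G.τ (w' j) = G.tr (t j) := by
        simp [w', G.τ_add, G.τ_smul, h.τe, h.τf, G.add_left, G.smul_right, G.smul_left, h.ef, h.fe,
          h.ff, G.tr_σ]
      change G.τ (w' j + y' j) = _
      rw [G.τ_add, hwy' j _ (hw' j), k, ht, h2, map_zero]; ring
  · rintro (i | j)
    · rw [h3]; fin_cases i <;> simp [u, v, h.ee, h.ff, h.fe]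
    · have k : G.B (w j) (w' j) = 1 + G.σ (x j) + G.σ (t j) := by
        simp [w, w', G.add_left, G.add_right, G.smul_left, G.smul_right, h.ee, h.ef, h.fe, h.ff]
      change G.B (w j + y j) (w' j + y' j) = _
      rw [G.add_left (w j), G.add_right (w j), G.add_right (y j), hwy' j _ (hw j), k,
        hy j _ (hw' j), h3]
      simp only [x, G.σ_σ]; ring
  · rintro (i | j)
    · have key : ∀ z z' : V, z ∈ hypSpan F e f → z' ∈ hypSpan F e f →
          (∀ a b : F, a • z + b • z' = 0 → a = 0 ∧ b = 0) →
          ∀ a b : F, (∀ x, G.B x (a • z + b • z') = 0) → a = 0 ∧ b = 0 := by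
        intro z z' hz hz' hzz a b hab
        exact pair_not_radical h.nondegenerate hz hz' hzz (Submodule.zero_mem _)
          (Submodule.zero_mem _) a b (by simpa using hab)
      fin_cases i
      · refine key _ _ (he 0) (he 1) fun a b hab => ?_
        have k1 := congrArg (fun z => G.B z (f 0)) hab
        have k2 := congrArg (fun z => G.B z (f 1)) hab
        simp [u, v, G.add_left, G.smul_left, h.ef, G.zero_left] at k1 k2
        exact ⟨k1, k2⟩
      · refine key _ _ (hf 0) (he 2) fun a b hab => ?_
        have k1 := congrArg (fun z => G.B z (e 0)) hab
        have k2 := congrArg (fun z => G.B z (f 2)) hab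
        simp [u, v, G.add_left, G.smul_left, h.ef, h.ff, h.ee, h.fe, G.zero_left, hε] at k1 k2
        exact ⟨k1, k2⟩
      · refine key _ _ (hf 1) (hf 2) fun a b hab => ?_
        have k1 := congrArg (fun z => G.B z (e 1)) hab
        have k2 := congrArg (fun z => G.B z (e 2)) hab
        simp [u, v, G.add_left, G.smul_left, h.fe, G.zero_left, hε] at k1 k2
        exact ⟨k1, k2⟩
    · exact pair_not_radical h.nondegenerate (hw j) (hw' j) (hind j) (hy j) (hy' j)
  · intro g hg hst
    obtain ⟨j0⟩ := ‹Nonempty J›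
    obtain ⟨ν, hν, hνe⟩ := h.scalar_of_isotropic hg (hst (Sum.inl 0)) (hst (Sum.inl 1))
      (hst (Sum.inl 2)) (hy j0) (hy' j0) (hst (Sum.inr j0))
    have hgH : hypSpan F e f ≤ LinearMap.ker ((g : V →ₗ[F] V) - ν • LinearMap.id) :=
      hypSpan_le _ (fun i => sub_eq_zero.mpr (hνe i).1)
        (fun i => sub_eq_zero.mpr (hνe i).2)
    exact ⟨ν, h.forall_eq_smul hg hν (fun x hx => sub_eq_zero.mp (hgH hx)) hy hy' hspan hw hw' hind
      (fun j => hst (Sum.inr j))⟩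

/-- A plane in the span of three hyperbolic pairs with prescribed Gram matrix and in general
position with respect to the three vectors `e i + s • f i`.  The general choice fails only if
`b = ε`, `ε + t * σ s = 0`, and then other choices, depending on the characteristic, do work. -/
theorem IsHyperbolic.exists_general_plane (h : G.IsHyperbolic e f) (s : F)
    (hs : s = 0 ∨ (∀ x, G.σ x = x) ∧ G.ε = 1) (t t' b : F) :
    ∃ w ∈ hypSpan F e f, ∃ w' ∈ hypSpan F e f, G.τ w = G.tr t ∧ G.τ w' = G.tr t' ∧
      G.B w w' = b ∧
      (∀ c d : F, c • w + d • w' ∈ Submodule.span F (Set.range fun i => e i + s • f i) →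
        c = 0 ∧ d = 0) ∧
      ∀ i, G.B w (e i + s • f i) ≠ 0 ∨ G.B w' (e i + s • f i) ≠ 0 := by
  have hε := G.ε_ne_zero
  have he := e_mem_hypSpan (F := F) e f
  have hf := f_mem_hypSpan (F := F) e f
  -- The vectors `e i - ε σ(s) f i` are orthogonal to all `e i + s • f i`.
  have hperp : ∀ (i : Fin 3), ∀ z ∈ Submodule.span F (Set.range fun i => e i + s • f i),
      G.B z (e i - (G.ε * G.σ s) • f i) = 0 := by
    intro i z hz
    refine G.perp_symm (G.perp_span (A := Set.range fun i => e i + s • f i) ?_ hz)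
    rintro _ ⟨j, rfl⟩
    by_cases hij : i = j
    · simp [hij, G.sub_left, G.add_right, G.smul_left, G.smul_right, h.ee, h.ef, h.fe, h.ff]
      linear_combination (-G.σ s) * G.ε_mul_ε
    · simp [hij, G.sub_left, G.add_right, G.smul_left, G.smul_right, h.ee, h.ef, h.fe, h.ff]
  have htr : ∀ x, G.tr (G.ε * G.σ x) = G.tr x := fun x => by rw [G.tr_ε, G.tr_σ]
  by_cases hbad : G.ε * b - 1 = 0 ∧ G.ε + t * G.σ s = 0
  · obtain ⟨hb, hts⟩ := hbad
    have hs0 : s ≠ 0 := by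
      rintro rfl
      rw [map_zero, mul_zero, add_zero] at hts
      exact hε hts
    obtain ⟨hσ, hε1⟩ := hs.resolve_left hs0
    have hb1 : b = 1 := by rw [hε1] at hb; linear_combination hb
    have hts1 : t * s = -1 := by rw [hε1, hσ] at hts; linear_combination hts
    -- Only the orthogonal case is left, where `ε = 1` and `σ` is trivial.
    by_cases h2 : (2 : F) = 0
    · refine ⟨-f 0 + e 1 + t • f 1 + f 2, ?_, e 0 + f 1 + e 2 + t' • f 2, ?_, ?_, ?_, ?_, ?_, ?_⟩
      · exact add_mem (add_mem (add_mem (neg_mem (hf 0)) (he 1)) (Submodule.smul_mem _ _ (hf 1)))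
          (hf 2)
      · exact add_mem (add_mem (add_mem (he 0) (hf 1)) (he 2)) (Submodule.smul_mem _ _ (hf 2))
      · simp [G.τ_add, G.τ_smul, G.τ_neg, h.τe, h.τf, G.add_left, G.neg_left, G.smul_right,
          G.smul_left, h.ef, h.ff, h.fe, hσ]
      · simp [G.τ_add, G.τ_smul, h.τe, h.τf, G.add_left, G.smul_right, h.ef, h.ee, h.ff, h.fe, hσ]
      · simp [G.add_left, G.add_right, G.neg_left, G.smul_left, G.smul_right, h.ee, h.ef, h.fe,
          h.ff, hε1, hb1]
      · intro c d hcd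
        have k0 := hperp 0 _ hcd
        have k1 := hperp 1 _ hcd
        simp [G.add_left, G.sub_right, G.neg_left, G.smul_left, G.smul_right, h.ee, h.ef, h.fe,
          h.ff, hε1, hσ] at k0 k1
        have hd : s * s * d = 0 := by
          linear_combination k1 + (t - s) * k0 + d * hts1 - d * h2
        have hd0 : d = 0 := (mul_eq_zero.mp hd).resolve_left (mul_ne_zero hs0 hs0)
        refine ⟨?_, hd0⟩
        rw [hd0] at k0
        linear_combination -k0
      · intro i
        fin_cases i
        · left; simp [G.add_left, G.add_right, G.neg_left, G.smul_left, G.smul_right, h.ee, h.ef,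
            h.fe, h.ff, hε1]
        · right; simp [G.add_left, G.add_right, G.smul_left, G.smul_right, h.ee, h.ef,
            h.fe, h.ff, hε1]
        · left; simp [G.add_left, G.add_right, G.neg_left, G.smul_left, G.smul_right, h.ee, h.ef,
            h.fe, h.ff, hε1]
    · refine ⟨f 1 + t • e 1 + f 2, ?_, f 0 - (2 * s) • f 1 - (e 2 + t' • f 2), ?_, ?_, ?_, ?_, ?_,
        ?_⟩
      · exact add_mem (add_mem (hf 1) (Submodule.smul_mem _ _ (he 1))) (hf 2)
      · exact sub_mem (sub_mem (hf 0) (Submodule.smul_mem _ _ (hf 1)))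
          (add_mem (he 2) (Submodule.smul_mem _ _ (hf 2)))
      · simp [G.τ_add, G.τ_smul, h.τe, h.τf, G.add_left, G.smul_right, G.smul_left, h.ef, h.ff,
          h.fe, hσ, hε1]
      · simp [sub_eq_add_neg, G.τ_add, G.τ_smul, G.τ_neg, h.τe, h.τf, G.add_left, G.add_right,
          G.neg_left, G.neg_right, G.smul_right, G.smul_left, h.fe, h.ff, hσ, hε1]
      · simp [G.add_left, G.add_right, G.sub_right, G.smul_left, G.smul_right, h.ee, h.ef, h.fe,
          h.ff, hε1, hb1, hσ]
        linear_combination (-2) * hts1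
      · intro c d hcd
        have k0 := hperp 0 _ hcd
        have k2 := hperp 2 _ hcd
        simp [G.add_left, G.sub_left, G.sub_right, G.smul_left, G.smul_right, h.ee, h.ef, h.fe,
          h.ff, hε1] at k0 k2
        refine ⟨?_, k0⟩
        rw [k0] at k2
        linear_combination k2
      · intro i
        fin_cases i
        · right; simp [G.add_left, G.sub_left, G.add_right, G.smul_left, G.smul_right, h.ee, h.ef,
            h.fe, h.ff, hε1]
        · right; simp [G.add_left, G.sub_left, G.add_right, G.smul_left, G.smul_right, h.ee, h.ef,
            h.fe, h.ff, hε1, h2, hs0]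
        · left; simp [G.add_left, G.add_right, G.smul_left, G.smul_right, h.ee, h.ef,
            h.fe, h.ff, hε1]
  · refine ⟨f 1 + t • e 1 + f 2, ?_, f 0 + G.σ (G.ε * b - 1) • e 1 + (e 2 + t' • f 2), ?_, ?_, ?_,
      ?_, ?_, ?_⟩
    · exact add_mem (add_mem (hf 1) (Submodule.smul_mem _ _ (he 1))) (hf 2)
    · exact add_mem (add_mem (hf 0) (Submodule.smul_mem _ _ (he 1)))
        (add_mem (he 2) (Submodule.smul_mem _ _ (hf 2)))
    · simp [G.τ_add, G.τ_smul, h.τe, h.τf, G.add_left, G.smul_right, G.smul_left, h.ef, h.ff,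
        h.fe, mul_comm _ G.ε, htr]
    · simp [G.τ_add, G.τ_smul, h.τe, h.τf, G.add_left, G.add_right, G.smul_right, G.smul_left,
        h.ef, h.fe, h.ff, h.ee, G.tr_σ]
    · simp [G.add_left, G.add_right, G.smul_left, G.smul_right, h.ee, h.ef, h.fe,
        h.ff, G.σ_σ, -map_sub]
      linear_combination b * G.ε_mul_ε
    · intro c d hcd
      have k0 := hperp 0 _ hcd
      have k2 := hperp 2 _ hcd
      simp [G.add_left, G.sub_right, G.smul_left, G.smul_right, h.ee, h.ef, h.fe,
        h.ff, hε] at k0 k2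
      refine ⟨?_, k0⟩
      rw [k0] at k2
      simpa [hε] using k2
    · intro i
      fin_cases i
      · right; simp [G.add_left, G.add_right, G.smul_left, G.smul_right, h.ee, h.ef, h.fe, h.ff, hε]
      · by_cases hts : G.ε + t * G.σ s = 0
        · right
          have hs0 : s ≠ 0 := by
            rintro rfl
            rw [map_zero, mul_zero, add_zero] at hts
            exact hε hts
          have hb : G.ε * b - 1 ≠ 0 := fun hb => hbad ⟨hb, hts⟩
          simp [G.add_left, G.add_right, G.smul_left, G.smul_right, h.ee, h.ef, h.fe, h.ff, hs0,
            -map_sub, -map_mul, hb]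
        · left
          simp [G.add_left, G.add_right, G.smul_left, G.smul_right, h.ee, h.ef, h.fe, h.ff]
          intro h0
          exact hts (by linear_combination h0)
      · left; simp [G.add_left, G.add_right, G.smul_left, G.smul_right, h.ee, h.ef, h.fe, h.ff, hε]

/-- Bases consisting of nondegenerate planes.  The vectors `p`, `p'` form a basis of such a plane
with `τ p' = -τ p`. -/
theorem IsHyperbolic.baseSize_nondegenerate_le [FiniteDimensional F V] (h : G.IsHyperbolic e f)
    (hG : G.Plentiful 3)
    {H : Subgroup (V ≃ₗ[F] V)} (hH : ∀ g, g ∈ H ↔ G.IsIsom g) {p p' : V}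
    (hp : ∀ a b : F, (∀ x, G.B x (a • p + b • p') = 0) → a = 0 ∧ b = 0) {s : F}
    (h1 : G.τ p = G.tr s) (h2 : G.τ p' = -G.tr s) (h3 : G.B p p' ≠ 0)
    (h4 : G.σ (G.B p p') ^ 3 ≠ (s + G.ε * G.σ s) ^ 3)
    (hs : s = 0 ∨ (∀ x, G.σ x = x) ∧ G.ε = 1)
    {J : Type*} [Fintype J] [Nonempty J] (y y' : J → V)
    (hy : ∀ j, y j ∈ G.perp (hypSpan F e f : Set V))
    (hy' : ∀ j, y' j ∈ G.perp (hypSpan F e f : Set V))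
    (hspan : hypSpan F e f ⊔ Submodule.span F (Set.range y ∪ Set.range y') = ⊤) :
    baseSize (ProjectiveGroup H) (MulAction.orbit (ProjectiveGroup H) (pairSpan F p p')) ≤
      (3 + Fintype.card J : ℕ) := by
  have hε := G.ε_ne_zero
  have : Nontrivial V := ⟨e 0, 0, fun h0 => by
    have := h.ef 0 0
    rw [h0, G.zero_left] at this
    simp at this⟩
  choose t ht using fun j => G.exists_tr_eq_sub p (y j)
  choose t' ht' using fun j => G.exists_tr_eq_sub p' (y' j)
  choose w hw w' hw' hwt hwt' hww hwP hwp using fun j =>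
    h.exists_general_plane s hs (t j) (t' j) (G.B p p' - G.B (y j) (y' j))
  have he := e_mem_hypSpan (F := F) e f
  have hf := f_mem_hypSpan (F := F) e f
  set c := G.σ (G.B p p') with hc
  have hc0 : c ≠ 0 := fun h0 => h3 ((map_eq_zero G.σ).mp h0)
  -- The planes `⟨P i, K i⟩` have the Gram matrix of `(p, p')`, and `P i` is orthogonal to `P j` and
  -- `K j` for `j ≠ i`.
  let P : Fin 3 → V := fun i => e i + s • f i
  let K : Fin 3 → V := fun i => c • f i + (e (i + 1) - (G.ε * G.σ s) • f (i + 1))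
  have hPH : ∀ i, P i ∈ hypSpan F e f := fun i => add_mem (he i) (Submodule.smul_mem _ _ (hf i))
  have hKH : ∀ i, K i ∈ hypSpan F e f := fun i => add_mem (Submodule.smul_mem _ _ (hf i))
    (sub_mem (he _) (Submodule.smul_mem _ _ (hf _)))
  have hPP : ∀ i j, i ≠ j → G.B (P i) (P j) = 0 := by
    intro i j hij
    simp [P, G.add_left, G.add_right, G.smul_left, G.smul_right, h.ee, h.ef, h.fe, h.ff, hij]
  have hPK : ∀ i j, i ≠ j → G.B (P i) (K j) = 0 := by
    intro i j hij
    by_cases hij' : i = j + 1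
    · simp [P, K, G.add_left, G.add_right, G.sub_right, G.smul_left, G.smul_right, h.ee, h.ef, h.fe,
        h.ff, hij', G.σ_ε, G.σ_σ]
      ring
    · simp [P, K, G.add_left, G.add_right, G.sub_right, G.smul_left, G.smul_right, h.ee, h.ef, h.fe,
        h.ff, hij, hij']
  have hPKs : ∀ i, G.B (P i) (K i) = G.B p p' := by
    intro i
    have : i ≠ i + 1 := by fin_cases i <;> decide
    simp [P, K, G.add_left, G.add_right, G.sub_right, G.smul_left, G.smul_right, h.ee, h.ef, h.fe,
      h.ff, this, hc, G.σ_σ]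
  have hKK1 : ∀ i, G.B (K i) (K (i + 1)) = G.σ c := by
    intro i
    have i1 : i ≠ i + 1 := by fin_cases i <;> decide
    have i2 : i ≠ i + 1 + 1 := by fin_cases i <;> decide
    have i3 : i + 1 ≠ i + 1 + 1 := by fin_cases i <;> decide
    simp [K, G.add_left, G.add_right, G.sub_left, G.sub_right, G.smul_left, G.smul_right, h.ee,
      h.ef, h.fe, h.ff, i2, i3]
  have hσc : G.σ c ≠ 0 := fun h0 => hc0 ((map_eq_zero G.σ).mp h0)
  have hKK : ∀ i j, i ≠ j → G.B (K i) (K j) ≠ 0 := by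
    intro i j hij
    have : j = i + 1 ∨ i = j + 1 := by
      revert hij; revert i j; decide
    rcases this with rfl | rfl
    · rw [hKK1]; exact hσc
    · intro h0
      exact hσc ((hKK1 j).symm.trans (G.perp_symm h0))
  have hKτ : ∀ i, G.τ (K i) = -G.tr s := by
    intro i
    have i1 : i ≠ i + 1 := by fin_cases i <;> decide
    simp [K, sub_eq_add_neg, G.τ_add, G.τ_smul, G.τ_neg, h.τe, h.τf, G.add_right, G.neg_right,
      G.smul_left, G.smul_right, h.ef, h.fe, h.ff, i1, G.σ_ε, G.σ_σ, G.tr_ε]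
  have hPτ : ∀ i, G.τ (P i) = G.tr s := by
    intro i
    simp [P, G.τ_add, G.τ_smul, h.τe, h.τf, G.smul_right, h.ef, G.tr_σ]
  -- The three planes span the span of the hyperbolic pairs, because of a circulant determinant.
  have hsup : hypSpan F e f = ⨆ i, pairSpan F (P i) (K i) := by
    refine le_antisymm ?_ (iSup_le fun i => ?_)
    · have hPm : ∀ i, P i ∈ ⨆ i, pairSpan F (P i) (K i) := fun i =>
        Submodule.mem_iSup_of_mem i (left_mem_pairSpan _ _)
      have hKm : ∀ i, K i ∈ ⨆ i, pairSpan F (P i) (K i) := fun i =>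
        Submodule.mem_iSup_of_mem i (right_mem_pairSpan _ _)
      have hfm : ∀ i, f i ∈ ⨆ i, pairSpan F (P i) (K i) := by
        intro i
        set r := s + G.ε * G.σ s with hr
        have k : (c ^ 3 - r ^ 3) • f i = c ^ 2 • (K i - P (i + 1)) +
            (c * r) • (K (i + 1) - P (i + 2)) + r ^ 2 • (K (i + 2) - P i) := by
          have i1 : i + 1 + 1 = i + 2 := by fin_cases i <;> rfl
          have i2 : i + 2 + 1 = i := by fin_cases i <;> rfl
          simp only [K, P, i1, i2, hr]
          module
        have k' : c ^ 3 - r ^ 3 ≠ 0 := sub_ne_zero.mpr h4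
        rw [← inv_smul_smul₀ k' (f i), k]
        refine Submodule.smul_mem _ _ (add_mem (add_mem ?_ ?_) ?_) <;>
        exact Submodule.smul_mem _ _ (sub_mem (hKm _) (hPm _))
      refine hypSpan_le _ (fun i => ?_) hfm
      have : e i = P i - s • f i := by simp [P]
      rw [this]
      exact sub_mem (hPm i) (Submodule.smul_mem _ _ (hfm i))
    · rw [Submodule.span_le]
      rintro _ (rfl | rfl)
      · exact hPH i
      · exact hKH i
  have hind : ∀ j, ∀ a b : F, a • w j + b • w' j = 0 → a = 0 ∧ b = 0 := fun j a b hab =>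
    hwP j a b (by rw [hab]; exact Submodule.zero_mem _)
  let u : Fin 3 ⊕ J → V := Sum.elim P fun j => w j + y j
  let v : Fin 3 ⊕ J → V := Sum.elim K fun j => w' j + y' j
  have hcard : (3 + Fintype.card J : ℕ) = Fintype.card (Fin 3 ⊕ J) := by simp
  rw [hcard]
  have hwy : ∀ j, ∀ a ∈ hypSpan F e f, G.B a (y j) = 0 := fun j a ha => G.perp_symm (hy j a ha)
  have hwy' : ∀ j, ∀ a ∈ hypSpan F e f, G.B a (y' j) = 0 := fun j a ha => G.perp_symm (hy' j a ha)
  refine baseSize_pairSpan_le hG hH hp u v ?_ ?_ ?_ ?_ ?_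
  · rintro (i | j)
    · exact (hPτ i).trans h1.symm
    · change G.τ (w j + y j) = _
      rw [G.τ_add, hwy j _ (hw j), hwt, ht, map_zero]; ring
  · rintro (i | j)
    · exact (hKτ i).trans h2.symm
    · change G.τ (w' j + y' j) = _
      rw [G.τ_add, hwy' j _ (hw' j), hwt', ht', map_zero]; ring
  · rintro (i | j)
    · exact hPKs i
    · change G.B (w j + y j) (w' j + y' j) = _
      rw [G.add_left, G.add_right, G.add_right, hwy' j _ (hw j), hww, hy j _ (hw' j)]
      ring
  · rintro (i | j)
    · intro a b hab
      have i1 : i ≠ i + 1 := by fin_cases i <;> decide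
      have k0 := hab (K (i + 1))
      have k1 : G.B (K (i + 1)) (P i) = 0 := G.perp_symm (hPK _ _ i1)
      change G.B (K (i + 1)) (a • P i + b • K i) = 0 at k0
      rw [G.add_right, G.smul_right, G.smul_right, k1, mul_zero, zero_add] at k0
      have hb : b = 0 := by
        have := (mul_eq_zero.mp k0).resolve_right (hKK _ _ i1.symm)
        exact (map_eq_zero G.σ).mp this
      have k2 := hab (K i)
      change G.B (K i) (a • P i + b • K i) = 0 at k2
      rw [hb, zero_smul, add_zero, G.smul_right] at k2
      have k3 : G.B (K i) (P i) ≠ 0 := fun h0 => h3 ((hPKs i).symm.trans (G.perp_symm h0))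
      exact ⟨(map_eq_zero G.σ).mp ((mul_eq_zero.mp k2).resolve_right k3), hb⟩
    · exact pair_not_radical h.nondegenerate (hw j) (hw' j) (hind j) (hy j) (hy' j)
  · intro g hg hst
    obtain ⟨j0⟩ := ‹Nonempty J›
    obtain ⟨ν, hν, hgH⟩ := scalar_of_nondegenerate hPP hPK hKK hg (fun i => hst (Sum.inl i)) hsup
      h.nondegenerate (hw j0) (hw' j0) (hy j0) (hy' j0) (hwP j0) (hwp j0) (hst (Sum.inr j0))
    exact ⟨ν, h.forall_eq_smul hg hν hgH hy hy' hspan hw hw' hind (fun j => hst (Sum.inr j))⟩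

end FormGeometry

/-! ### Bases consisting of lines -/

/-- A spanning set contains a basis that extends a given linearly independent subset. -/
theorem exists_finite_basis_subset {F V : Type*} [Field F] [AddCommGroup V] [Module F V]
    [FiniteDimensional F V] {T I : Set V} (hIT : I ⊆ T) (hI : LinearIndepOn F id I) :
    ∃ b : Set V, I ⊆ b ∧ b ⊆ T ∧ Submodule.span F b = Submodule.span F T ∧ b.Finite ∧
      b.ncard = Module.finrank F (Submodule.span F T) := by
  obtain ⟨b, hbT, hIb, hTb, hb⟩ := exists_linearIndepOn_extension hI hIT
  rw [Set.image_id, Set.image_id] at hTb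
  have hspan : Submodule.span F b = Submodule.span F T :=
    le_antisymm (Submodule.span_mono hbT) (Submodule.span_le.mpr hTb)
  have hfin : b.Finite := LinearIndependent.setFinite hb
  refine ⟨b, hIb, hbT, hspan, hfin, ?_⟩
  have : Fintype b := hfin.fintype
  rw [← hspan, finrank_span_set_eq_card hb, Set.ncard_eq_toFinset_card']

namespace FormGeometry

variable {F V : Type*} [Field F] [AddCommGroup V] [Module F V] {G : FormGeometry F V}

/-- If the vectors in `T` span `W` and have the same value of `τ`, then a basis of `W` in `T` gives
a base for the action on an orbit of lines, provided that stabilizing the lines in that basis forces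
an isometry to be a scalar on `W` and hence a scalar. -/
theorem baseSize_line_le [FiniteDimensional F V] (hG : G.Plentiful 2)
    {H : Subgroup (V ≃ₗ[F] V)} (hH : ∀ g, g ∈ H ↔ G.IsIsom g) {p : V} (hp : ∃ x, G.B p x ≠ 0)
    {T I : Set V} (hTτ : ∀ v ∈ T, G.τ v = G.τ p) (hTrad : ∀ v ∈ T, ∃ x, G.B v x ≠ 0)
    (hIT : I ⊆ T) (hI : LinearIndepOn F id I)
    (hstab : ∀ g, G.IsIsom g → ∀ b, I ⊆ b → b ⊆ T → (∀ v ∈ b, ∃ a : F, g v = a • v) →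
      ∃ ν : F, ν * G.σ ν = 1 ∧ ∀ v ∈ b, g v = ν • v)
    (hW : ∀ g, G.IsIsom g → ∀ ν : F, ν * G.σ ν = 1 → (∀ x ∈ Submodule.span F T, g x = ν • x) →
      ∀ x, g x = ν • x) :
    baseSize (ProjectiveGroup H) (MulAction.orbit (ProjectiveGroup H) (Submodule.span F {p})) ≤
      Module.finrank F (Submodule.span F T) := by
  obtain ⟨b, hIb, hbT, hspan, hfin, hcard⟩ := exists_finite_basis_subset hIT hI
  have : Nontrivial V := by
    obtain ⟨x, hx⟩ := hp
    exact ⟨p, 0, fun h0 => hx (by rw [h0, G.zero_left])⟩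
  have : Fintype b := hfin.fintype
  have hcard' : Module.finrank F (Submodule.span F T) = Fintype.card b := by
    rw [← hcard, Set.ncard_eq_toFinset_card', Set.toFinset_card]
  rw [hcard']
  refine baseSize_orbit_le H _ (fun v : b => Submodule.span F {(v : V)}) (fun v => ?_)
    fun g hg hst => ?_
  · obtain ⟨g, hg, hgp⟩ := G.exists_isIsom_vector hG (hTτ v (hbT v.2)).symm hp (hTrad v (hbT v.2))
    refine ⟨g, (hH g).mpr hg, ?_⟩
    rw [Submodule.map_span, Set.image_singleton]
    change Submodule.span F {g p} = _
    rw [hgp]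
  · have hgi := (hH g).mp hg
    obtain ⟨ν, hν, hνb⟩ := hstab g hgi b hIb hbT fun v hv => by
      have h1 : g v ∈ Submodule.span F {v} := by
        have h2 := hst ⟨v, hv⟩
        change (Submodule.span F {v}).map (g : V →ₗ[F] V) = Submodule.span F {v} at h2
        rw [← h2]
        exact ⟨v, Submodule.mem_span_singleton_self v, rfl⟩
      obtain ⟨a, ha⟩ := Submodule.mem_span_singleton.mp h1
      exact ⟨a, ha.symm⟩
    refine ⟨ν, hW g hgi ν hν ?_⟩
    have : Submodule.span F T ≤ LinearMap.ker ((g : V →ₗ[F] V) - ν • LinearMap.id) := by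
      rw [← hspan, Submodule.span_le]
      exact fun v hv => sub_eq_zero.mpr (hνb v hv)
    exact fun x hx => sub_eq_zero.mp (this hx)

/-- The orthogonal decomposition of `W` given by a hyperbolic pair in `W`. -/
theorem mem_of_hyperbolic_pair {e f : V} (he : G.τ e = 0) (hf : G.τ f = 0) (hef : G.B e f = 1)
    (W : Submodule F V) (heW : e ∈ W) (hfW : f ∈ W) {x : V} (hx : x ∈ W) :
    ∃ u ∈ W, u ∈ G.perp {e, f} ∧ x = G.B x f • e + (G.ε * G.B x e) • f + u := by
  have hee : G.B e e = 0 := by rw [G.self, he, mul_zero]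
  have hff : G.B f f = 0 := by rw [G.self, hf, mul_zero]
  have hfe : G.B f e = G.ε := by rw [G.symm, hef, map_one, mul_one]
  refine ⟨x - (G.B x f • e + (G.ε * G.B x e) • f), W.sub_mem hx
    (W.add_mem (W.smul_mem _ heW) (W.smul_mem _ hfW)), ?_, by abel⟩
  rintro _ (rfl | rfl)
  · simp only [G.sub_left, G.add_left, G.smul_left, hee, hfe]
    linear_combination (-G.B x _) * G.ε_mul_ε
  · simp only [G.sub_left, G.add_left, G.smul_left, hff, hef]
    ring

/-- The vectors `e + s • f + u` have `τ = c` if `tr s = c - τ u`. -/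
theorem τ_hyperbolic_pair {e f u : V} (he : G.τ e = 0) (hf : G.τ f = 0) (hef : G.B e f = 1)
    (hu : u ∈ G.perp {e, f}) (s : F) : G.τ (e + s • f + u) = G.tr s + G.τ u := by
  have h1 := G.perp_symm (hu e (by simp))
  have h2 := G.perp_symm (hu f (by simp))
  simp [G.τ_add, G.τ_smul, he, hf, G.add_left, G.smul_left, G.smul_right, hef, h1, h2, G.tr_σ]

/-- Bases consisting of isotropic (or singular) lines.  In the set of isotropic vectors of the
form `f` or `e + s • f + u`, the vector `f` is not orthogonal to any other one. -/
theorem baseSize_isotropic_line_le [FiniteDimensional F V] (hG : G.Plentiful 2)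
    {H : Subgroup (V ≃ₗ[F] V)} (hH : ∀ g, g ∈ H ↔ G.IsIsom g) {p : V} (hp : ∃ x, G.B p x ≠ 0)
    (hτp : G.τ p = 0) {e f : V} (he : G.τ e = 0) (hf : G.τ f = 0) (hef : G.B e f = 1)
    {W : Submodule F V} (heW : e ∈ W) (hfW : f ∈ W) {u₀ : V} (hu₀W : u₀ ∈ W)
    (hu₀ : u₀ ∈ G.perp {e, f}) (hu₀0 : u₀ ≠ 0) {s₀ : F} (hs₀ : s₀ ≠ 0) (hs₀' : G.tr s₀ = -G.τ u₀)
    (hW : ∀ g, G.IsIsom g → ∀ ν : F, ν * G.σ ν = 1 → (∀ x ∈ W, g x = ν • x) → ∀ x, g x = ν • x) :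
    baseSize (ProjectiveGroup H) (MulAction.orbit (ProjectiveGroup H) (Submodule.span F {p})) ≤
      Module.finrank F W := by
  have hε := G.ε_ne_zero
  have hee : G.B e e = 0 := by rw [G.self, he, mul_zero]
  have hff : G.B f f = 0 := by rw [G.self, hf, mul_zero]
  have hfe : G.B f e = G.ε := by rw [G.symm, hef, map_one, mul_one]
  let T : Set V := {f} ∪ {v | ∃ u ∈ W, u ∈ G.perp {e, f} ∧ ∃ s, G.tr s = -G.τ u ∧
    v = e + s • f + u}
  have heT : e ∈ T := Or.inr ⟨0, W.zero_mem, Submodule.zero_mem _, 0, by simp [G.τ_zero], by simp⟩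
  have hfT : f ∈ T := Or.inl rfl
  have hBf : ∀ v ∈ T, v = f ∨ G.B v f = 1 := by
    rintro v (hv | ⟨u, -, hu, s, -, rfl⟩)
    · exact Or.inl hv
    · right
      rw [G.add_left, G.add_left, G.smul_left, hff, hef, hu f (by simp)]; simp
  have hTτ : ∀ v ∈ T, G.τ v = G.τ p := by
    rintro v (hv | ⟨u, -, hu, s, hs, rfl⟩)
    · rw [Set.mem_singleton_iff.mp hv, hf, hτp]
    · rw [τ_hyperbolic_pair he hf hef hu, hs, hτp, neg_add_cancel]
  have hspan : Submodule.span F T = W := by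
    refine le_antisymm (Submodule.span_le.mpr ?_) fun x hx => ?_
    · rintro v (hv | ⟨u, huW, -, s, -, rfl⟩)
      · rw [Set.mem_singleton_iff.mp hv]; exact hfW
      · exact add_mem (add_mem heW (W.smul_mem _ hfW)) huW
    · have h1 := Submodule.subset_span (R := F) heT
      have h2 := Submodule.subset_span (R := F) hfT
      obtain ⟨u, huW, hu, hxu⟩ := mem_of_hyperbolic_pair he hf hef W heW hfW hx
      obtain ⟨s, hs⟩ := G.exists_tr_eq_neg u
      have h3 : e + s • f + u ∈ Submodule.span F T :=
        Submodule.subset_span (Or.inr ⟨u, huW, hu, s, hs, rfl⟩)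
      have h4 : u = (e + s • f + u) - e - s • f := by abel
      rw [hxu]
      refine add_mem (add_mem (Submodule.smul_mem _ _ h1) (Submodule.smul_mem _ _ h2)) ?_
      rw [h4]
      exact sub_mem (sub_mem h3 h1) (Submodule.smul_mem _ _ h2)
  -- The pairwise nonorthogonal vectors `f`, `e`, `t` force the common eigenvalue to have norm `1`.
  set t := e + s₀ • f + u₀ with ht
  have htT : t ∈ T := Or.inr ⟨u₀, hu₀W, hu₀, s₀, hs₀', rfl⟩
  have hte : G.B e t ≠ 0 := by
    rw [ht, G.add_right, G.add_right, G.smul_right, hee, hef, G.perp_symm (hu₀ e (by simp))]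
    simpa using hs₀
  have htf : G.B f t = G.ε := by
    rw [ht, G.add_right, G.add_right, G.smul_right, hff, hfe, G.perp_symm (hu₀ f (by simp))]
    simp
  have htf0 : t ≠ f := by
    intro h
    rw [h, hff] at htf
    exact hε htf.symm
  have hef0 : e ≠ f := by
    intro h
    rw [h, hff] at hef
    exact zero_ne_one hef
  have hI : LinearIndepOn F id (Set.range ![f, e, t]) := by
    refine LinearIndependent.linearIndepOn_id (Fintype.linearIndependent_iff.mpr fun a ha => ?_)
    rw [Fin.sum_univ_three] at ha
    change a 0 • f + a 1 • e + a 2 • t = 0 at ha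
    have k1 : a 2 • u₀ = 0 := by
      have h1 := congrArg (fun x => G.B x f) ha
      have h2 := congrArg (fun x => G.B x e) ha
      simp [ht, G.add_left, G.smul_left, hff, hef, hfe, hee, hu₀ f (by simp), hu₀ e (by simp),
        G.zero_left] at h1 h2
      have h3 : G.ε * (a 0 + a 2 * s₀) = 0 := by linear_combination h2
      have h4 := (mul_eq_zero.mp h3).resolve_left hε
      have h5 : a 2 • u₀ = a 0 • f + a 1 • e + a 2 • t - (a 1 + a 2) • e -
          (a 0 + a 2 * s₀) • f := by rw [ht]; module
      rw [h5, ha, h1, h4]; simp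
    have k2 : a 2 = 0 := (smul_eq_zero.mp k1).resolve_right hu₀0
    rw [k2, zero_smul, add_zero] at ha
    have h1 := congrArg (fun x => G.B x f) ha
    have h2 := congrArg (fun x => G.B x e) ha
    simp [G.add_left, G.smul_left, hff, hef, hfe, hee, G.zero_left, hε] at h1 h2
    intro i
    fin_cases i
    · exact h2
    · exact h1
    · exact k2
  have hIT : Set.range ![f, e, t] ⊆ T := by
    rintro _ ⟨i, rfl⟩
    fin_cases i
    · exact hfT
    · exact heT
    · exact htT
  rw [← hspan]
  refine baseSize_line_le hG hH hp hTτ ?_ hIT hI ?_ (by rwa [hspan])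
  · intro v hv
    rcases hBf v hv with rfl | h
    · exact ⟨e, by rwa [hfe]⟩
    · exact ⟨f, by rw [h]; exact one_ne_zero⟩
  · intro g hg b hIb hbT hgb
    have hb : ∀ i, ![f, e, t] i ∈ b := fun i => hIb ⟨i, rfl⟩
    obtain ⟨l, hl⟩ := hgb f (hb 0)
    obtain ⟨m, hm⟩ := hgb e (hb 1)
    obtain ⟨n, hn⟩ := hgb t (hb 2)
    have key : ∀ {x y : V} {a c : F}, g x = a • x → g y = c • y → G.B x y ≠ 0 →
        a * G.σ c = 1 := by
      intro x y a c hx hy hxy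
      have := hg.1 x y
      rw [hx, hy, G.smul_left, G.smul_right] at this
      have h0 : (a * G.σ c - 1) * G.B x y = 0 := by linear_combination this
      exact sub_eq_zero.mp ((mul_eq_zero.mp h0).resolve_right hxy)
    have hl0 : G.σ l ≠ 0 := by
      intro h0
      have := key hm hl (by rw [hef]; exact one_ne_zero)
      rw [h0, mul_zero] at this
      exact zero_ne_one this
    have k1 := key hm hl (by rw [hef]; exact one_ne_zero)
    have k2 := key hn hl (fun h0 => hε (htf.symm.trans (G.perp_symm h0)))
    have k3 := key hm hn hte
    have hmn : m = n := mul_right_cancel₀ hl0 (k1.trans k2.symm)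
    have hm0 : m ≠ 0 := by
      rintro rfl
      rw [zero_mul] at k1
      exact zero_ne_one k1
    have hln : l = m := by
      rw [hmn] at k1 k3 hm0 ⊢
      exact G.σ.injective (mul_left_cancel₀ hm0 (k1.trans k3.symm))
    rw [← hmn] at k3
    refine ⟨m, k3, fun v hv => ?_⟩
    rcases hBf v (hbT hv) with rfl | h
    · rw [hl, hln]
    · obtain ⟨a, ha⟩ := hgb v hv
      have k4 := key ha hl (by rw [h]; exact one_ne_zero)
      rw [ha, mul_right_cancel₀ hl0 (k4.trans k1.symm)]

/-- Bases consisting of nonisotropic (or nonsingular) lines.  Here all eigenvalues have norm `1`, so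
that they agree if one vector `v₀` is not orthogonal to the others; in a quadratic space of
characteristic two, norm `1` already means that the eigenvalue is `1`. -/
theorem baseSize_anisotropic_line_le [FiniteDimensional F V] (hG : G.Plentiful 2)
    {H : Subgroup (V ≃ₗ[F] V)} (hH : ∀ g, g ∈ H ↔ G.IsIsom g) {p : V} (hp : ∃ x, G.B p x ≠ 0)
    (hτp : G.τ p ≠ 0) {T : Set V} (hTτ : ∀ v ∈ T, G.τ v = G.τ p)
    (hTrad : ∀ v ∈ T, ∃ x, G.B v x ≠ 0) {v₀ : V} (hv₀ : v₀ ∈ T)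
    (hT : (∀ v ∈ T, v = v₀ ∨ G.B v v₀ ≠ 0) ∨ (∀ x, G.σ x = x) ∧ (2 : F) = 0)
    (hW : ∀ g, G.IsIsom g → ∀ ν : F, ν * G.σ ν = 1 → (∀ x ∈ Submodule.span F T, g x = ν • x) →
      ∀ x, g x = ν • x) :
    baseSize (ProjectiveGroup H) (MulAction.orbit (ProjectiveGroup H) (Submodule.span F {p})) ≤
      Module.finrank F (Submodule.span F T) := by
  have hv₀0 : v₀ ≠ 0 := by
    rintro rfl
    exact hτp ((hTτ 0 hv₀).symm.trans G.τ_zero)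
  refine baseSize_line_le hG hH hp hTτ hTrad (I := {v₀}) (by simpa using hv₀)
    (LinearIndepOn.singleton hv₀0) ?_ hW
  intro g hg b hIb hbT hgb
  have hv₀b : v₀ ∈ b := hIb rfl
  have hnorm : ∀ {v : V} {a : F}, v ∈ T → g v = a • v → a * G.σ a = 1 := by
    intro v a hv ha
    have h1 := hg.2 v
    rw [ha, G.τ_smul, hTτ v hv] at h1
    exact mul_right_cancel₀ hτp (h1.trans (one_mul _).symm)
  obtain ⟨l, hl⟩ := hgb v₀ hv₀b
  have hl1 := hnorm hv₀ hl
  refine ⟨l, hl1, fun v hv => ?_⟩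
  obtain ⟨a, ha⟩ := hgb v hv
  rcases hT with hT | ⟨hσ, h2⟩
  · rcases hT v (hbT hv) with rfl | h
    · exact hl
    · have h1 := hg.1 v v₀
      rw [ha, hl, G.smul_left, G.smul_right] at h1
      have h0 : (a * G.σ l - 1) * G.B v v₀ = 0 := by linear_combination h1
      have h3 := sub_eq_zero.mp ((mul_eq_zero.mp h0).resolve_right h)
      have hl0 : G.σ l ≠ 0 := fun h0 => by simp [h0] at hl1
      rw [ha, mul_right_cancel₀ hl0 (h3.trans hl1.symm)]
  · -- In characteristic two, `a ^ 2 = 1` implies `a = 1`.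
    have key : ∀ {a : F}, a * G.σ a = 1 → a = 1 := by
      intro a ha
      rw [hσ] at ha
      have : (a - 1) * (a - 1) = 0 := by linear_combination ha + (1 - a) * h2
      exact sub_eq_zero.mp (mul_self_eq_zero.mp this)
    rw [ha, key (hnorm (hbT hv) ha), key hl1]

end FormGeometry

/-! ### Geometries on the standard space -/

section Vectors

variable {F : Type*} [Field F] {a r : ℕ}

/-- The basis vector `e_i`. -/
def eVec (i : Fin a) : FormSpace F a r := Pi.single (Sum.inl i) 1

/-- The basis vector `f_i`. -/
def fVec (i : Fin a) : FormSpace F a r := Pi.single (Sum.inr (Sum.inl i)) 1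

/-- The basis vector `x_j`. -/
def xVec (j : Fin r) : FormSpace F a r := Pi.single (Sum.inr (Sum.inr j)) 1

@[simp] theorem eCoord_eVec (i j : Fin a) :
    eCoord i (eVec j : FormSpace F a r) = if i = j then 1 else 0 := by
  simp [eCoord, eVec, Pi.single_apply]

@[simp] theorem eCoord_fVec (i j : Fin a) : eCoord i (fVec j : FormSpace F a r) = 0 := by
  simp [eCoord, fVec]

@[simp] theorem eCoord_xVec (i : Fin a) (j : Fin r) :
    eCoord i (xVec j : FormSpace F a r) = 0 := by
  simp [eCoord, xVec]

@[simp] theorem fCoord_eVec (i j : Fin a) : fCoord i (eVec j : FormSpace F a r) = 0 := by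
  simp [fCoord, eVec]

@[simp] theorem fCoord_fVec (i j : Fin a) :
    fCoord i (fVec j : FormSpace F a r) = if i = j then 1 else 0 := by
  simp [fCoord, fVec, Pi.single_apply]

@[simp] theorem fCoord_xVec (i : Fin a) (j : Fin r) :
    fCoord i (xVec j : FormSpace F a r) = 0 := by
  simp [fCoord, xVec]

@[simp] theorem xCoord_eVec (i : Fin r) (j : Fin a) :
    xCoord i (eVec j : FormSpace F a r) = 0 := by
  simp [xCoord, eVec]

@[simp] theorem xCoord_fVec (i : Fin r) (j : Fin a) :
    xCoord i (fVec j : FormSpace F a r) = 0 := by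
  simp [xCoord, fVec]

@[simp] theorem xCoord_xVec (i j : Fin r) :
    xCoord i (xVec j : FormSpace F a r) = if i = j then 1 else 0 := by
  simp [xCoord, xVec, Pi.single_apply]

theorem FormSpace.eq_zero {v : FormSpace F a r} (he : ∀ i, eCoord i v = 0)
    (hf : ∀ i, fCoord i v = 0) (hx : ∀ j, xCoord j v = 0) : v = 0 := by
  funext k
  rcases k with i | i | j
  · exact he i
  · exact hf i
  · exact hx j

theorem FormSpace.eq_top {W : Submodule F (FormSpace F a r)} (he : ∀ i, eVec i ∈ W)
    (hf : ∀ i, fVec i ∈ W) (hx : ∀ j, xVec j ∈ W) : W = ⊤ := by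
  rw [eq_top_iff, ← (Pi.basisFun F (Fin a ⊕ Fin a ⊕ Fin r)).span_eq, Submodule.span_le]
  rintro _ ⟨k, rfl⟩
  rw [Pi.basisFun_apply]
  rcases k with i | i | j
  · exact he i
  · exact hf i
  · exact hx j

theorem finrank_formSpace : Module.finrank F (FormSpace F a r) = 2 * a + r := by
  rw [Module.finrank_fintype_fun_eq_card]
  simp
  ring

end Vectors

theorem natCeil_half (d : ℕ) : ⌈(d : ℚ) / 2⌉₊ = (d + 1) / 2 := by
  rcases Nat.even_or_odd' d with ⟨k, rfl | rfl⟩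
  · have : ((2 * k : ℕ) : ℚ) / 2 = (k : ℕ) := by push_cast; ring
    rw [this, Nat.ceil_natCast]; omega
  · rw [Nat.ceil_eq_iff (by omega)]
    have : (2 * k + 1 + 1) / 2 = k + 1 := by omega
    rw [this]
    push_cast
    constructor
    · linarith
    · linarith

theorem exists_independent_pair {F V : Type*} [Field F] [AddCommGroup V] [Module F V]
    {U : Submodule F V} (hU : Module.finrank F U = 2) :
    ∃ p ∈ U, ∃ p' ∈ U, ∀ a b : F, a • p + b • p' = 0 → a = 0 ∧ b = 0 := by
  have : Module.Finite F U := Module.finite_of_finrank_pos (by omega)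
  have b := Module.finBasisOfFinrankEq F U hU
  refine ⟨b 0, (b 0).2, b 1, (b 1).2, fun c d hcd => ?_⟩
  have h1 : c • b 0 + d • b 1 = 0 := Subtype.ext hcd
  have h2 := Fintype.linearIndependent_iff.mp b.linearIndependent ![c, d]
    (by rw [Fin.sum_univ_two]; exact h1)
  exact ⟨h2 0, h2 1⟩

theorem eq_pairSpan {F V : Type*} [Field F] [AddCommGroup V] [Module F V]
    {U : Submodule F V} (hU : Module.finrank F U = 2) {p p' : V} (hp : p ∈ U) (hp' : p' ∈ U)
    (h : ∀ a b : F, a • p + b • p' = 0 → a = 0 ∧ b = 0) : U = Submodule.span F {p, p'} := by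
  have : Module.Finite F U := Module.finite_of_finrank_pos (by omega)
  refine (Submodule.eq_of_le_of_finrank_eq ?_ ?_).symm
  · rw [Submodule.span_le]
    rintro _ (rfl | rfl)
    · exact hp
    · exact hp'
  · have hli : LinearIndependent F ![p, p'] := LinearIndependent.pair_iff.mpr h
    have := finrank_span_eq_card hli
    rw [Matrix.range_cons, Matrix.range_cons, Matrix.range_empty, Set.union_empty] at this
    rw [hU]
    exact this

theorem exists_eq_span_singleton {F V : Type*} [Field F] [AddCommGroup V] [Module F V]
    {U : Submodule F V} (hU : Module.finrank F U = 1) :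
    ∃ p ∈ U, p ≠ 0 ∧ U = Submodule.span F {p} := by
  obtain ⟨p, hp0, hp⟩ := finrank_eq_one_iff'.mp hU
  refine ⟨p, p.2, fun h => hp0 (Subtype.ext h), le_antisymm (fun u hu => ?_) ?_⟩
  · obtain ⟨c, hc⟩ := hp ⟨u, hu⟩
    exact Submodule.mem_span_singleton.mpr ⟨c, congrArg Subtype.val hc⟩
  · rw [Submodule.span_singleton_le_iff_mem]; exact p.2

namespace FormGeometry

section Planes

variable {F V : Type*} [Field F] [AddCommGroup V] [Module F V] {G : FormGeometry F V}

/-- A nondegenerate plane that contains an isotropic vector is a hyperbolic plane. -/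
theorem exists_hyperbolic_pair {U : Submodule F V}
    (hnd : ∀ u ∈ U, (∀ v ∈ U, G.B u v = 0) → u = 0) {p : V} (hp : p ∈ U) (hp0 : p ≠ 0)
    (hτ : G.τ p = 0) : ∃ p' ∈ U, G.τ p' = 0 ∧ G.B p p' = 1 := by
  obtain ⟨v, hv, hpv⟩ : ∃ v ∈ U, G.B p v ≠ 0 := by
    by_contra! h
    exact hp0 (hnd p hp h)
  have hpp : G.B p p = 0 := by rw [G.self, hτ, mul_zero]
  obtain ⟨w, hwU, hpw⟩ : ∃ w ∈ U, G.B p w = 1 :=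
    ⟨(G.σ (G.B p v))⁻¹ • v, U.smul_mem _ hv, by
      rw [G.smul_right, map_inv₀, G.σ_σ, inv_mul_cancel₀ hpv]⟩
  obtain ⟨s, hs⟩ := G.exists_tr_eq_neg w
  refine ⟨w + s • p, U.add_mem hwU (U.smul_mem _ hp), ?_, ?_⟩
  · rw [G.τ_add, G.τ_smul, hτ, G.smul_right, G.symm p w, hpw, map_one, mul_one,
      mul_comm (G.σ s), G.tr_ε, G.tr_σ, hs]
    ring
  · rw [G.add_right, G.smul_right, hpp, hpw]; ring

theorem pair_not_radical_of_nondegenerate {U : Submodule F V}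
    (hnd : ∀ u ∈ U, (∀ v ∈ U, G.B u v = 0) → u = 0) {p p' : V} (hp : p ∈ U) (hp' : p' ∈ U)
    (hind : ∀ a b : F, a • p + b • p' = 0 → a = 0 ∧ b = 0) (a b : F)
    (h : ∀ x, G.B x (a • p + b • p') = 0) : a = 0 ∧ b = 0 :=
  hind a b (hnd _ (U.add_mem (U.smul_mem _ hp) (U.smul_mem _ hp')) fun v _ => G.perp_symm (h v))

theorem pair_not_radical_of_singular {U : Submodule F V} (hτ : ∀ u ∈ U, G.τ u = 0)
    {p p' : V} (hp : p ∈ U) (hp' : p' ∈ U)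
    (hind : ∀ a b : F, a • p + b • p' = 0 → a = 0 ∧ b = 0) (a b : F)
    (h : ∀ x, G.B x (a • p + b • p') = 0) : a = 0 ∧ b = 0 :=
  hind a b (G.regular _ (fun v => G.perp_symm (h v))
    (hτ _ (U.add_mem (U.smul_mem _ hp) (U.smul_mem _ hp'))))

end Planes

section Standard

variable {F : Type*} [Field F] {a r : ℕ} {G : FormGeometry F (FormSpace F a r)}

/-- The vectors `e_i`, `f_i` are orthogonal hyperbolic pairs that are orthogonal to all `x_j`. -/
structure IsStandard (G : FormGeometry F (FormSpace F a r)) : Prop where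
  right_e : ∀ u i, G.B u (eVec i) = G.ε * fCoord i u
  right_f : ∀ u i, G.B u (fVec i) = eCoord i u
  τe : ∀ i, G.τ (eVec i) = 0
  τf : ∀ i, G.τ (fVec i) = 0

theorem IsStandard.isHyperbolic (h : G.IsStandard) {ι : Type*} [DecidableEq ι] {k : ι → Fin a}
    (hk : Function.Injective k) :
    G.IsHyperbolic (fun i => eVec (k i)) fun i => fVec (k i) where
  ee i j := by simp [h.right_e]
  ff i j := by simp [h.right_f]
  ef i j := by simp [h.right_f, hk.eq_iff, eq_comm]
  τe i := h.τe _
  τf i := h.τf _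

/-- The vectors completing three hyperbolic pairs to the standard basis, arranged in pairs, the last
one of which is `(x_r, 0)` if `r` is odd. -/
def complementPair (a r : ℕ) : Fin (a - 3) ⊕ Fin ((r + 1) / 2) → FormSpace F a r × FormSpace F a r
  | Sum.inl i => (eVec ⟨i + 3, by omega⟩, fVec ⟨i + 3, by omega⟩)
  | Sum.inr j => (xVec ⟨2 * j, by omega⟩,
      if h : 2 * (j : ℕ) + 1 < r then xVec ⟨2 * j + 1, h⟩ else 0)

theorem IsStandard.complementPair_perp (h : G.IsStandard) (ha : 3 ≤ a)
    (j : Fin (a - 3) ⊕ Fin ((r + 1) / 2)) :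
    (complementPair a r j).1 ∈ G.perp (hypSpan F
      (fun i : Fin 3 => (eVec (Fin.castLE ha i) : FormSpace F a r))
      (fun i => fVec (Fin.castLE ha i)) : Set (FormSpace F a r)) ∧
    (complementPair a r j).2 ∈ G.perp (hypSpan F
      (fun i : Fin 3 => (eVec (Fin.castLE ha i) : FormSpace F a r))
      (fun i => fVec (Fin.castLE ha i)) : Set (FormSpace F a r)) := by
  have key : ∀ (i : Fin 3) (k : Fin (a - 3)), Fin.castLE ha i ≠ ⟨k + 3, by omega⟩ := by
    intro i k hik
    have := congrArg Fin.val hik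
    simp at this
    omega
  have hx : ∀ k : Fin r, xVec k ∈ G.perp (hypSpan F
      (fun i : Fin 3 => (eVec (Fin.castLE ha i) : FormSpace F a r))
      (fun i => fVec (Fin.castLE ha i)) : Set (FormSpace F a r)) := fun k =>
    mem_perp_hypSpan (fun i => by simp [h.right_e]) fun i => by simp [h.right_f]
  rcases j with k | k
  · exact ⟨mem_perp_hypSpan (fun i => by simp [h.right_e, complementPair])
        fun i => by simp [h.right_f, complementPair, key i k],
      mem_perp_hypSpan (fun i => by simp [h.right_e, complementPair, key i k])
        fun i => by simp [h.right_f, complementPair]⟩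
  · refine ⟨hx _, ?_⟩
    simp only [complementPair]
    split_ifs
    · exact hx _
    · exact Submodule.zero_mem _

theorem complementPair_span (ha : 3 ≤ a) :
    hypSpan F (fun i : Fin 3 => (eVec (Fin.castLE ha i) : FormSpace F a r))
      (fun i => fVec (Fin.castLE ha i)) ⊔
      Submodule.span F (Set.range (fun j => (complementPair (F := F) a r j).1) ∪
        Set.range fun j => (complementPair (F := F) a r j).2) = ⊤ := by
  refine FormSpace.eq_top (fun i => ?_) (fun i => ?_) fun j => ?_
  · by_cases hi : (i : ℕ) < 3
    · exact Submodule.mem_sup_left (e_mem_hypSpan (F := F)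
        (fun i : Fin 3 => (eVec (Fin.castLE ha i) : FormSpace F a r)) _ ⟨i, hi⟩)
    · refine Submodule.mem_sup_right (Submodule.subset_span (Or.inl
        ⟨Sum.inl ⟨i - 3, by omega⟩, ?_⟩))
      simp only [complementPair]
      congr 1
      ext
      simp only
      omega
  · by_cases hi : (i : ℕ) < 3
    · exact Submodule.mem_sup_left (f_mem_hypSpan (F := F) _
        (fun i : Fin 3 => (fVec (Fin.castLE ha i) : FormSpace F a r)) ⟨i, hi⟩)
    · refine Submodule.mem_sup_right (Submodule.subset_span (Or.inr
        ⟨Sum.inl ⟨i - 3, by omega⟩, ?_⟩))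
      simp only [complementPair]
      congr 1
      ext
      simp only
      omega
  · refine Submodule.mem_sup_right (Submodule.subset_span ?_)
    rcases Nat.even_or_odd' (j : ℕ) with ⟨k, hk | hk⟩
    · refine Or.inl ⟨Sum.inr ⟨k, by omega⟩, ?_⟩
      simp only [complementPair]
      congr 1
      ext
      simp only
      omega
    · refine Or.inr ⟨Sum.inr ⟨k, by omega⟩, ?_⟩
      have : 2 * k + 1 < r := by omega
      simp only [complementPair, this, dif_pos]
      congr 1
      ext
      simp only
      omega

theorem card_complementPair (ha : 3 ≤ a) :
    3 + Fintype.card (Fin (a - 3) ⊕ Fin ((r + 1) / 2)) = ⌈((2 * a + r : ℕ) : ℚ) / 2⌉₊ := by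
  rw [natCeil_half]
  simp only [Fintype.card_sum, Fintype.card_fin]
  omega

theorem nonempty_complementPair (ha : 3 ≤ a) (hd : 7 ≤ 2 * a + r) :
    Nonempty (Fin (a - 3) ⊕ Fin ((r + 1) / 2)) := by
  by_cases h : 3 < a
  · exact ⟨Sum.inl ⟨0, by omega⟩⟩
  · exact ⟨Sum.inr ⟨0, by omega⟩⟩

theorem IsStandard.baseSize_isotropic_plane_le (h : G.IsStandard) (hG : G.Plentiful 3)
    {H : Subgroup (FormSpace F a r ≃ₗ[F] FormSpace F a r)} (hH : ∀ g, g ∈ H ↔ G.IsIsom g)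
    (ha : 3 ≤ a) (hd : 7 ≤ 2 * a + r) {U : Submodule F (FormSpace F a r)}
    (hU : Module.finrank F U = 2) (hτ : ∀ u ∈ U, G.τ u = 0)
    (hB : ∀ u ∈ U, ∀ v ∈ U, G.B u v = 0) :
    baseSize (ProjectiveGroup H) (MulAction.orbit (ProjectiveGroup H) U) ≤
      (⌈((2 * a + r : ℕ) : ℚ) / 2⌉₊ : ℕ) := by
  obtain ⟨p, hp, p', hp', hind⟩ := exists_independent_pair hU
  have := nonempty_complementPair (r := r) ha hd
  rw [← card_complementPair ha, eq_pairSpan hU hp hp' hind]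
  exact (h.isHyperbolic (Fin.castLE_injective ha)).baseSize_isotropic_le hG hH
    (pair_not_radical_of_singular hτ hp hp' hind) (hτ p hp) (hτ p' hp') (hB p hp p' hp') _ _
    (fun j => (h.complementPair_perp ha j).1) (fun j => (h.complementPair_perp ha j).2)
    (complementPair_span ha)

theorem IsStandard.baseSize_nondegenerate_plane_le (h : G.IsStandard) (hG : G.Plentiful 3)
    {H : Subgroup (FormSpace F a r ≃ₗ[F] FormSpace F a r)} (hH : ∀ g, g ∈ H ↔ G.IsIsom g)
    (ha : 3 ≤ a) (hd : 7 ≤ 2 * a + r) {U : Submodule F (FormSpace F a r)}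
    (hU : Module.finrank F U = 2) (hnd : ∀ u ∈ U, (∀ v ∈ U, G.B u v = 0) → u = 0)
    {p p' : FormSpace F a r} (hp : p ∈ U) (hp' : p' ∈ U)
    (hind : ∀ a b : F, a • p + b • p' = 0 → a = 0 ∧ b = 0) {s : F}
    (h1 : G.τ p = G.tr s) (h2 : G.τ p' = -G.tr s) (h3 : G.B p p' ≠ 0)
    (h4 : G.σ (G.B p p') ^ 3 ≠ (s + G.ε * G.σ s) ^ 3)
    (hs : s = 0 ∨ (∀ x, G.σ x = x) ∧ G.ε = 1) :
    baseSize (ProjectiveGroup H) (MulAction.orbit (ProjectiveGroup H) U) ≤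
      (⌈((2 * a + r : ℕ) : ℚ) / 2⌉₊ : ℕ) := by
  have := nonempty_complementPair (r := r) ha hd
  rw [← card_complementPair ha, eq_pairSpan hU hp hp' hind]
  exact (h.isHyperbolic (Fin.castLE_injective ha)).baseSize_nondegenerate_le hG hH
    (pair_not_radical_of_nondegenerate hnd hp hp' hind) h1 h2 h3 h4 hs _ _
    (fun j => (h.complementPair_perp ha j).1) (fun j => (h.complementPair_perp ha j).2)
    (complementPair_span ha)

/-- The previous bound for a nondegenerate plane that contains an isotropic vector. -/
theorem IsStandard.baseSize_hyperbolic_plane_le (h : G.IsStandard) (hG : G.Plentiful 3)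
    {H : Subgroup (FormSpace F a r ≃ₗ[F] FormSpace F a r)} (hH : ∀ g, g ∈ H ↔ G.IsIsom g)
    (ha : 3 ≤ a) (hd : 7 ≤ 2 * a + r) {U : Submodule F (FormSpace F a r)}
    (hU : Module.finrank F U = 2) (hnd : ∀ u ∈ U, (∀ v ∈ U, G.B u v = 0) → u = 0)
    {p : FormSpace F a r} (hp : p ∈ U) (hp0 : p ≠ 0) (hτ : G.τ p = 0) :
    baseSize (ProjectiveGroup H) (MulAction.orbit (ProjectiveGroup H) U) ≤
      (⌈((2 * a + r : ℕ) : ℚ) / 2⌉₊ : ℕ) := by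
  obtain ⟨p', hp', hτ', hpp'⟩ := exists_hyperbolic_pair hnd hp hp0 hτ
  have hpp : G.B p p = 0 := by rw [G.self, hτ, mul_zero]
  refine h.baseSize_nondegenerate_plane_le hG hH ha hd hU hnd hp hp' (s := 0) ?_ ?_ ?_ ?_ ?_ ?_
  · intro c d hcd
    have h1 := congrArg (fun x => G.B p x) hcd
    simp only [G.add_right, G.smul_right, hpp, hpp', G.zero_right, mul_zero, zero_add,
      mul_one] at h1
    have hd0 : d = 0 := (map_eq_zero G.σ).mp h1
    rw [hd0, zero_smul, add_zero] at hcd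
    exact ⟨(smul_eq_zero.mp hcd).resolve_right hp0, hd0⟩
  · rw [hτ, map_zero]
  · rw [hτ', map_zero, neg_zero]
  · rw [hpp']; exact one_ne_zero
  · simp [hpp']
  · exact Or.inl rfl

end Standard

end FormGeometry

/-! ### Symplectic groups -/

section Symplectic

variable {F : Type*} [Field F] {a : ℕ}

theorem symplecticForm_eVec (u : FormSpace F a 0) (i : Fin a) :
    symplecticForm a u (eVec i) = -fCoord i u := by
  simp [symplecticForm]

theorem symplecticForm_fVec (u : FormSpace F a 0) (i : Fin a) :
    symplecticForm a u (fVec i) = eCoord i u := by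
  simp [symplecticForm]

variable (F a) in
/-- The geometry of the standard symplectic form. -/
def symplecticGeometry : FormGeometry F (FormSpace F a 0) where
  σ := RingHom.id F
  ε := -1
  κ := 0
  tr := 0
  B := symplecticForm a
  τ := 0
  σ_σ _ := rfl
  ε_mul_ε := by ring
  σ_ε := rfl
  add_left u v w := by
    simp only [symplecticForm, ← Finset.sum_add_distrib, map_add]
    exact Finset.sum_congr rfl fun i _ => by ring
  smul_left c u w := by
    simp only [symplecticForm, Finset.mul_sum, map_smul, smul_eq_mul]
    exact Finset.sum_congr rfl fun i _ => by ring
  symm u v := by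
    simp only [symplecticForm, RingHom.id_apply, Finset.mul_sum]
    exact Finset.sum_congr rfl fun i _ => by ring
  tr_σ _ := rfl
  tr_ε _ := rfl
  tr_mul_norm _ _ := by simp
  τ_add _ _ := by simp
  τ_smul _ _ := by simp
  self v := by
    simp only [symplecticForm, zero_mul]
    exact Finset.sum_eq_zero fun i _ => by ring
  exists_tr v := ⟨0, rfl⟩
  regular v hv _ := by
    refine FormSpace.eq_zero (fun i => ?_) (fun i => ?_) fun j => j.elim0
    · have := hv (fVec i)
      rwa [symplecticForm_fVec] at this
    · have := hv (eVec i)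
      rwa [symplecticForm_eVec, neg_eq_zero] at this

theorem symplecticGeometry_isStandard : (symplecticGeometry F a).IsStandard where
  right_e u i := (symplecticForm_eVec u i).trans (by simp [symplecticGeometry])
  right_f := symplecticForm_fVec
  τe _ := rfl
  τf _ := rfl

theorem symplecticGeometry_plentiful (n : ℕ) : (symplecticGeometry F a).Plentiful n := by
  refine fun S _ x => ⟨0, Submodule.zero_mem _, 1, one_ne_zero, ?_, ?_⟩
  · simp [symplecticGeometry]
  · rw [FormGeometry.self]
    simp [symplecticGeometry]

theorem mem_SpGroup_iff (g : FormSpace F a 0 ≃ₗ[F] FormSpace F a 0) :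
    g ∈ SpGroup F a ↔ (symplecticGeometry F a).IsIsom g :=
  ⟨fun h => ⟨h, fun _ => rfl⟩, fun h => h.1⟩

theorem baseSize_PSp_line_le (ha : 2 ≤ a) {U : Submodule F (FormSpace F a 0)}
    (hU : Module.finrank F U = 1) :
    baseSize (PSpGroup F a) (MulAction.orbit (PSpGroup F a) U) ≤ (2 * a : ℕ) := by
  obtain ⟨p, -, hp0, rfl⟩ := exists_eq_span_singleton hU
  have hG := symplecticGeometry_isStandard (F := F) (a := a)
  have hne : (⟨1, by omega⟩ : Fin a) ≠ ⟨0, by omega⟩ := by simp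
  have h := FormGeometry.baseSize_isotropic_line_le (symplecticGeometry_plentiful 2)
    mem_SpGroup_iff (p := p)
    (by
      by_contra! h
      exact hp0 ((symplecticGeometry F a).regular p h rfl)) rfl
    (e := eVec ⟨0, by omega⟩) (f := fVec ⟨0, by omega⟩) rfl rfl (by simp [hG.right_f])
    (W := ⊤) Submodule.mem_top Submodule.mem_top (u₀ := eVec ⟨1, by omega⟩) Submodule.mem_top
    (by rintro _ (rfl | rfl) <;> simp [hG.right_e, hG.right_f])
    (fun h0 => by
      have := congrArg (eCoord ⟨1, by omega⟩) h0
      simp at this) (s₀ := 1) one_ne_zero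
    (by change (0 : F) = -0; simp) fun g _ ν _ hg x => hg x Submodule.mem_top
  rw [finrank_top, finrank_formSpace] at h
  exact h

theorem baseSize_PSp_plane_le (hd : 7 ≤ 2 * a) {U : Submodule F (FormSpace F a 0)}
    (hU : Module.finrank F U = 2)
    (h : IsTotallyIsotropic (symplecticForm a) U ∨ IsNondegenerateOn (symplecticForm a) U) :
    baseSize (PSpGroup F a) (MulAction.orbit (PSpGroup F a) U) ≤
      (⌈((2 * a : ℕ) : ℚ) / 2⌉₊ : ℕ) := by
  have hG := symplecticGeometry_isStandard (F := F) (a := a)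
  rcases h with h | h
  · exact hG.baseSize_isotropic_plane_le (symplecticGeometry_plentiful 3) mem_SpGroup_iff
      (by omega) (by omega) hU (fun _ _ => rfl) h
  · obtain ⟨p, hp, p', -, hind⟩ := exists_independent_pair hU
    refine hG.baseSize_hyperbolic_plane_le (symplecticGeometry_plentiful 3) mem_SpGroup_iff
      (by omega) (by omega) hU h hp (fun h0 => ?_) rfl
    exact one_ne_zero (hind 1 0 (by simp [h0])).1

end Symplectic

/-! ### Unitary groups -/

section FiniteFieldSquare

variable {F : Type*} [Field F] [Finite F] {q : ℕ}

theorem one_lt_of_card_eq_sq (hq : Nat.card F = q ^ 2) : 1 < q := by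
  have := Finite.one_lt_card (α := F)
  rw [hq] at this
  by_contra! h
  interval_cases q <;> simp at this

theorem exists_frobenius_of_card_eq_sq (hq : Nat.card F = q ^ 2) :
    ∃ σ : F →+* F, ∀ x, σ x = x ^ q := by
  have := Fintype.ofFinite F
  obtain ⟨p, hp⟩ := CharP.exists F
  obtain ⟨n, hpp, hn⟩ := FiniteField.card F p
  have : ExpChar F p := ExpChar.prime hpp
  rw [Nat.card_eq_fintype_card, hn] at hq
  obtain ⟨m, -, hm⟩ := (Nat.dvd_prime_pow hpp).mp
    (Dvd.intro_left q ((pow_two q).symm.trans hq.symm))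
  exact ⟨iterateFrobenius F p m, fun x => by rw [iterateFrobenius_def, hm]⟩

theorem pow_pow_of_card_eq_sq (hq : Nat.card F = q ^ 2) (x : F) : (x ^ q) ^ q = x := by
  have := Fintype.ofFinite F
  rw [← pow_mul, ← pow_two, ← hq, Nat.card_eq_fintype_card, FiniteField.pow_card]

theorem exists_pow_ne_of_card_eq_sq (hq : Nat.card F = q ^ 2) : ∃ x : F, x ^ q ≠ x := by
  have hq1 := one_lt_of_card_eq_sq hq
  by_contra! h
  obtain ⟨g, hg⟩ := IsCyclic.exists_generator (α := Fˣ)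
  have h1 : g ^ (q - 1) = 1 := by
    have h2 : g ^ q = g := Units.ext (by push_cast; exact h g)
    have h3 : g ^ (q - 1) * g = 1 * g := by
      rw [← pow_succ, Nat.sub_add_cancel hq1.le, h2, one_mul]
    exact mul_right_cancel h3
  have h2 := Nat.le_of_dvd (by omega) (orderOf_dvd_of_pow_eq_one h1)
  rw [orderOf_eq_card_of_forall_mem_zpowers hg, Nat.card_units, hq] at h2
  have : q * 2 ≤ q ^ 2 := by nlinarith
  omega

/-- The norm to the subfield of order `q` is surjective. -/
theorem exists_mul_pow_eq (hq : Nat.card F = q ^ 2) {c : F} (hc : c ^ q = c) (hc0 : c ≠ 0) :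
    ∃ z : F, z * z ^ q = c := by
  have hq1 := one_lt_of_card_eq_sq hq
  obtain ⟨g, hg⟩ := IsCyclic.exists_generator (α := Fˣ)
  obtain ⟨k, hk⟩ := (Submonoid.mem_powers_iff _ _).mp
    ((mem_powers_iff_mem_zpowers (x := g)).mpr (hg (Units.mk0 c hc0)))
  have h1 : g ^ (k * (q - 1)) = 1 := by
    rw [pow_mul, hk]
    have h2 : Units.mk0 c hc0 ^ q = Units.mk0 c hc0 := Units.ext (by push_cast; exact hc)
    have h3 : Units.mk0 c hc0 ^ (q - 1) * Units.mk0 c hc0 = 1 * Units.mk0 c hc0 := by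
      rw [← pow_succ, Nat.sub_add_cancel hq1.le, h2, one_mul]
    exact mul_right_cancel h3
  have h2 := orderOf_dvd_of_pow_eq_one h1
  rw [orderOf_eq_card_of_forall_mem_zpowers hg, Nat.card_units, hq] at h2
  have h3 : q ^ 2 - 1 = (q + 1) * (q - 1) := by
    have := Nat.sq_sub_sq q 1
    simpa using this
  rw [h3] at h2
  obtain ⟨m, rfl⟩ := Nat.dvd_of_mul_dvd_mul_right (by omega) h2
  refine ⟨((g ^ m : Fˣ) : F), ?_⟩
  have h4 : g ^ m * (g ^ m) ^ q = Units.mk0 c hc0 := by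
    rw [← hk, ← pow_mul, ← pow_add]
    congr 1
    ring
  have h5 := congrArg Units.val h4
  push_cast at h5
  simpa using h5

end FiniteFieldSquare

section Unitary

variable {F : Type*} [Field F] {q a r : ℕ}

theorem unitaryForm_eVec (hq : q ≠ 0) (u : FormSpace F a r) (i : Fin a) :
    unitaryForm q a r u (eVec i) = fCoord i u := by
  simp [unitaryForm, hq]

theorem unitaryForm_fVec (hq : q ≠ 0) (u : FormSpace F a r) (i : Fin a) :
    unitaryForm q a r u (fVec i) = eCoord i u := by
  simp [unitaryForm, hq]

theorem unitaryForm_xVec (hq : q ≠ 0) (u : FormSpace F a r) (i : Fin r) :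
    unitaryForm q a r u (xVec i) = xCoord i u := by
  simp [unitaryForm, hq]

theorem unitaryForm_symm {σ : F →+* F} (hσ : ∀ x, σ x = x ^ q) (hσσ : ∀ x, σ (σ x) = x)
    (u v : FormSpace F a r) : unitaryForm q a r v u = σ (unitaryForm q a r u v) := by
  simp only [unitaryForm, ← hσ, map_add, map_sum, map_mul, hσσ]
  congr 1
  · exact Finset.sum_congr rfl fun i _ => by ring
  · exact Finset.sum_congr rfl fun i _ => by ring

theorem unitaryForm_add_left (u v w : FormSpace F a r) :
    unitaryForm q a r (u + v) w = unitaryForm q a r u w + unitaryForm q a r v w := by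
  simp only [unitaryForm, map_add, add_mul, Finset.sum_add_distrib]
  ring

theorem unitaryForm_smul_left (c : F) (u w : FormSpace F a r) :
    unitaryForm q a r (c • u) w = c * unitaryForm q a r u w := by
  simp only [unitaryForm, map_smul, smul_eq_mul, mul_add, Finset.mul_sum, mul_assoc]

variable (a r) in
/-- The geometry of the standard unitary form. -/
def unitaryGeometry (q : ℕ) (σ : F →+* F) (hσ : ∀ x, σ x = x ^ q) (hσσ : ∀ x, σ (σ x) = x)
    (hne : ∃ x, σ x ≠ x) : FormGeometry F (FormSpace F a r) where
  σ := σ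
  ε := 1
  κ := 1
  tr := AddMonoidHom.id F + (σ : F →+ F)
  B := unitaryForm q a r
  τ v := unitaryForm q a r v v
  σ_σ := hσσ
  ε_mul_ε := by ring
  σ_ε := map_one σ
  add_left := unitaryForm_add_left
  smul_left := unitaryForm_smul_left
  symm u v := by rw [one_mul]; exact unitaryForm_symm hσ hσσ u v
  tr_σ x := by simp [hσσ, add_comm]
  tr_ε x := by simp
  tr_mul_norm x y := by simp [hσσ]; ring
  τ_add u v := by
    change unitaryForm q a r (u + v) (u + v) = unitaryForm q a r u u + unitaryForm q a r v v +
      (unitaryForm q a r u v + σ (unitaryForm q a r u v))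
    rw [unitaryForm_symm hσ hσσ (u + v) (u + v), unitaryForm_add_left, map_add,
      ← unitaryForm_symm hσ hσσ u (u + v), ← unitaryForm_symm hσ hσσ v (u + v),
      unitaryForm_add_left, unitaryForm_add_left, unitaryForm_symm hσ hσσ u v]
    ring
  τ_smul c v := by
    rw [unitaryForm_smul_left, unitaryForm_symm hσ hσσ (c • v) v, unitaryForm_smul_left, map_mul,
      ← unitaryForm_symm hσ hσσ v v, mul_assoc]
  self v := (one_mul _).symm
  exists_tr v := by
    obtain ⟨θ, hθ⟩ : ∃ θ, θ + σ θ ≠ 0 := by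
      by_contra! h
      obtain ⟨x, hx⟩ := hne
      have h1 := h 1
      rw [map_one] at h1
      exact hx (by linear_combination h x - x * h1)
    have hfix : σ (θ + σ θ) = θ + σ θ := by rw [map_add, hσσ, add_comm]
    refine ⟨unitaryForm q a r v v * (θ / (θ + σ θ)), ?_⟩
    simp only [AddMonoidHom.add_apply, AddMonoidHom.id_apply, AddMonoidHom.coe_coe, map_mul,
      map_div₀, hfix, ← unitaryForm_symm hσ hσσ v v]
    field_simp
  regular v hv _ := by
    have hq : q ≠ 0 := by
      rintro rfl
      have h0 := hσ 0
      simp at h0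
    refine FormSpace.eq_zero (fun i => ?_) (fun i => ?_) fun j => ?_
    · rw [← unitaryForm_fVec hq]; exact hv _
    · rw [← unitaryForm_eVec hq]; exact hv _
    · rw [← unitaryForm_xVec hq]; exact hv _

variable {σ : F →+* F} {hσ : ∀ x, σ x = x ^ q} {hσσ : ∀ x, σ (σ x) = x} {hne : ∃ x, σ x ≠ x}

theorem unitaryGeometry_isStandard (hq : q ≠ 0) :
    (unitaryGeometry a r q σ hσ hσσ hne).IsStandard where
  right_e u i := (unitaryForm_eVec hq u i).trans (by simp [unitaryGeometry])
  right_f := unitaryForm_fVec hq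
  τe i := (unitaryForm_eVec hq _ i).trans (by simp)
  τf i := (unitaryForm_fVec hq _ i).trans (by simp)

theorem unitaryGeometry_plentiful (n : ℕ) :
    (unitaryGeometry a r q σ hσ hσσ hne).Plentiful n := by
  refine fun S _ x => ⟨0, Submodule.zero_mem _, ?_⟩
  rw [add_zero]
  set G := unitaryGeometry a r q σ hσ hσσ hne with hG
  -- The constant is `-1 / s`, where `s ≠ 0` has trace `τ x`.
  obtain ⟨s, hs0, hs⟩ : ∃ s, s ≠ 0 ∧ G.tr s = G.τ x := by
    by_cases h0 : G.τ x = 0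
    · obtain ⟨y, hy⟩ := hne
      refine ⟨y - σ y, sub_ne_zero.mpr (Ne.symm hy), ?_⟩
      rw [h0]
      change (y - σ y) + σ (y - σ y) = 0
      rw [map_sub, hσσ]; ring
    · obtain ⟨s, hs⟩ := G.exists_tr x
      exact ⟨s, fun h => h0 (by rw [← hs, h, map_zero]), hs⟩
  have hσs : σ s ≠ 0 := fun h => hs0 ((map_eq_zero σ).mp h)
  have key : σ (-s⁻¹) + -s⁻¹ + -s⁻¹ * σ (-s⁻¹) * G.τ x = 0 := by
    rw [← hs]
    change σ (-s⁻¹) + -s⁻¹ + -s⁻¹ * σ (-s⁻¹) * (s + σ s) = 0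
    rw [map_neg, map_inv₀]
    field_simp
    ring
  refine ⟨-s⁻¹, neg_ne_zero.mpr (inv_ne_zero hs0), ?_, ?_⟩
  · change σ (-s⁻¹) + σ (σ (-s⁻¹)) + -s⁻¹ * σ (-s⁻¹) * G.τ x = 0
    rw [hσσ, key]
  · change σ (-s⁻¹) + 1 * -s⁻¹ + -s⁻¹ * σ (-s⁻¹) * G.B x x = 0
    rw [one_mul]
    exact key

theorem mem_unitaryGroup_iff (g : FormSpace F a r ≃ₗ[F] FormSpace F a r) :
    g ∈ formIsometryGroup (unitaryForm (F := F) q a r) ↔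
      (unitaryGeometry a r q σ hσ hσσ hne).IsIsom g :=
  ⟨fun h => ⟨h, fun v => h v v⟩, fun h => h.1⟩

theorem exists_perp_τ_ne_zero (hq : q ≠ 0) (ha : 0 < a) (hd : 3 ≤ 2 * a + r) :
    ∃ u : FormSpace F a r, u ∈ (unitaryGeometry a r q σ hσ hσσ hne).perp
      {eVec ⟨0, ha⟩, fVec ⟨0, ha⟩} ∧ (unitaryGeometry a r q σ hσ hσσ hne).τ u ≠ 0 := by
  set G := unitaryGeometry a r q σ hσ hσσ hne with hG
  have hst : G.IsStandard := unitaryGeometry_isStandard hq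
  rcases Nat.eq_zero_or_pos r with rfl | hr
  · obtain ⟨θ, hθ⟩ : ∃ θ, θ + σ θ ≠ 0 := by
      by_contra! h
      obtain ⟨x, hx⟩ := hne
      have h1 := h 1
      rw [map_one] at h1
      exact hx (by linear_combination h x - x * h1)
    refine ⟨eVec ⟨1, by omega⟩ + θ • fVec ⟨1, by omega⟩, ?_, ?_⟩
    · rintro _ (rfl | rfl)
      · simp [hst.right_e]
      · simp [hst.right_f]
    · rw [G.τ_add, G.τ_smul, hst.τe, hst.τf, G.smul_right, hst.right_f]
      simp only [eCoord_eVec, if_true, mul_one, mul_zero, zero_add, G.tr_σ]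
      exact hθ
  · refine ⟨xVec ⟨0, hr⟩, ?_, ?_⟩
    · rintro _ (rfl | rfl)
      · simp [hst.right_e]
      · simp [hst.right_f]
    · change unitaryForm q a r _ _ ≠ 0
      rw [unitaryForm_xVec hq]
      simp

variable [Finite F]

theorem baseSize_PGU_line_le (hq : Nat.card F = q ^ 2) (hr : r ≤ 1) (hd : 3 ≤ 2 * a + r)
    {U : Submodule F (FormSpace F a r)} (hU : Module.finrank F U = 1) :
    baseSize (PGUGroup F q a r) (MulAction.orbit (PGUGroup F q a r) U) ≤ (2 * a + r : ℕ) := by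
  obtain ⟨p, -, hp0, rfl⟩ := exists_eq_span_singleton hU
  obtain ⟨σ, hσ⟩ := exists_frobenius_of_card_eq_sq hq
  have hσσ : ∀ x, σ (σ x) = x := fun x => by rw [hσ, hσ]; exact pow_pow_of_card_eq_sq hq x
  have hne : ∃ x, σ x ≠ x := by
    obtain ⟨x, hx⟩ := exists_pow_ne_of_card_eq_sq hq
    exact ⟨x, by rwa [hσ]⟩
  have hq0 : q ≠ 0 := by have := one_lt_of_card_eq_sq hq; omega
  have ha : 0 < a := by omega
  set G := unitaryGeometry a r q σ hσ hσσ hne with hG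
  have hst : G.IsStandard := unitaryGeometry_isStandard hq0
  have hpl : G.Plentiful 2 := unitaryGeometry_plentiful 2
  have hrad : ∀ v, v ≠ 0 → ∃ x, G.B v x ≠ 0 := by
    intro v hv
    by_contra! h
    exact hv (G.regular v h (h v))
  obtain ⟨u₀, hu₀, hτu₀⟩ := exists_perp_τ_ne_zero (σ := σ) (hσ := hσ) (hσσ := hσσ) (hne := hne)
    hq0 ha hd
  have hu₀0 : u₀ ≠ 0 := fun h => hτu₀ (by rw [h]; exact G.τ_zero)
  set e : FormSpace F a r := eVec ⟨0, ha⟩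
  set f : FormSpace F a r := fVec ⟨0, ha⟩
  have he : G.τ e = 0 := hst.τe _
  have hf : G.τ f = 0 := hst.τf _
  have hef : G.B e f = 1 := by simp [hst.right_f, e, f]
  have hff : G.B f f = 0 := hf
  have hee : G.B e e = 0 := he
  have hfe : G.B f e = 1 := by
    rw [G.symm, hef, map_one, mul_one]
    rfl
  by_cases hτp : G.τ p = 0
  · obtain ⟨s₀, hs₀⟩ := G.exists_tr_eq_neg u₀
    have h := FormGeometry.baseSize_isotropic_line_le hpl mem_unitaryGroup_iff (hrad p hp0) hτp
      he hf hef (W := ⊤) Submodule.mem_top Submodule.mem_top (u₀ := u₀) Submodule.mem_top hu₀ hu₀0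
      (s₀ := s₀) (fun h0 => hτu₀ (by rw [h0, map_zero] at hs₀; exact neg_eq_zero.mp hs₀.symm)) hs₀
      fun g _ ν _ hg x => hg x Submodule.mem_top
    rw [finrank_top, finrank_formSpace] at h
    exact h
  · obtain ⟨s, hs⟩ := G.exists_tr p
    -- Vectors with the same value of `τ` as `p` that are not orthogonal to `e + s • f`.
    set T : Set (FormSpace F a r) := {e + s • f} ∪ {v | ∃ u ∈ G.perp {e, f}, ∃ t,
      G.tr t = G.τ p - G.τ u ∧ σ s + t ≠ 0 ∧ v = e + t • f + u} with hT
    have hv₀ : e + s • f ∈ T := Or.inl rfl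
    have hBf : ∀ v ∈ T, G.B v f = 1 := by
      rintro v (hv | ⟨u, hu, t, -, -, rfl⟩)
      · rw [Set.mem_singleton_iff.mp hv, G.add_left, G.smul_left, hff, hef]; simp
      · rw [G.add_left, G.add_left, G.smul_left, hff, hef, hu f (by simp)]; simp
    have hTτ : ∀ v ∈ T, G.τ v = G.τ p := by
      rintro v (hv | ⟨u, hu, t, ht, -, rfl⟩)
      · have := FormGeometry.τ_hyperbolic_pair he hf hef (Submodule.zero_mem (G.perp {e, f})) s
        rw [add_zero, G.τ_zero, add_zero, hs] at this
        rw [Set.mem_singleton_iff.mp hv, this]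
      · rw [FormGeometry.τ_hyperbolic_pair he hf hef hu, ht, sub_add_cancel]
    have hstar : ∀ v ∈ T, v = e + s • f ∨ G.B v (e + s • f) ≠ 0 := by
      rintro v (hv | ⟨u, hu, t, -, ht, rfl⟩)
      · exact Or.inl hv
      · right
        have h1 : G.B (e + t • f + u) (e + s • f) = σ s + t := by
          simp only [G.add_left, G.add_right, G.smul_left, G.smul_right, hee, hef, hfe, hff,
            hu e (by simp), hu f (by simp)]
          change 0 + σ s * 1 + (t * 1 + t * (σ s * 0)) + (0 + σ s * 0) = _
          ring
        rwa [h1]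
    -- A suitable coefficient exists for every `u`; it can be changed by an element of trace zero.
    have hex : ∀ u, ∃ t, G.tr t = G.τ p - G.τ u ∧ σ s + t ≠ 0 := by
      intro u
      obtain ⟨t, ht⟩ := G.exists_tr_eq_sub p u
      by_cases h0 : σ s + t = 0
      · obtain ⟨y, hy⟩ := hne
        refine ⟨t + (y - σ y), ?_, ?_⟩
        · have : G.tr (y - σ y) = 0 := by
            change (y - σ y) + σ (y - σ y) = 0
            rw [map_sub, hσσ]; ring
          rw [map_add, this, ht, add_zero]
        · rw [← add_assoc, h0, zero_add]
          exact sub_ne_zero.mpr (Ne.symm hy)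
      · exact ⟨t, ht, h0⟩
    have hmem : ∀ u ∈ G.perp {e, f}, ∀ t, G.tr t = G.τ p - G.τ u → σ s + t ≠ 0 →
        u + (t - s) • f ∈ Submodule.span F T := by
      intro u hu t ht ht0
      have h1 : u + (t - s) • f = (e + t • f + u) - (e + s • f) := by module
      rw [h1]
      exact sub_mem (Submodule.subset_span (Or.inr ⟨u, hu, t, ht, ht0, rfl⟩))
        (Submodule.subset_span hv₀)
    -- Scaling `u₀` by an element `ω ≠ 1` of norm one shows that a multiple of `f` lies in the span.
    have hfT : f ∈ Submodule.span F T := by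
      obtain ⟨y, hy⟩ := hne
      have hy0 : y ≠ 0 := fun h => hy (by rw [h, map_zero])
      have hσy0 : σ y ≠ 0 := fun h => hy0 ((map_eq_zero σ).mp h)
      set ω := σ y / y with hω
      have hω1 : ω ≠ 1 := fun h => hy ((div_eq_one_iff_eq hy0).mp h)
      have hωn : ω * σ ω = 1 := by rw [hω, map_div₀, hσσ]; field_simp
      obtain ⟨t, ht, ht0⟩ := hex u₀
      have hts : t - s ≠ 0 := by
        intro h
        rw [sub_eq_zero.mp h, hs] at ht
        exact hτu₀ (by linear_combination ht)
      have h1 := hmem u₀ hu₀ t ht ht0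
      have h2 := hmem (ω • u₀) (Submodule.smul_mem _ _ hu₀) t
        (by
          rw [G.τ_smul, show ω * G.σ ω = 1 from hωn, one_mul]
          exact ht) ht0
      have h3 : ((1 - ω) * (t - s)) • f =
          (ω • u₀ + (t - s) • f) - ω • (u₀ + (t - s) • f) := by module
      have h4 : (1 - ω) * (t - s) ≠ 0 := mul_ne_zero (sub_ne_zero.mpr (Ne.symm hω1)) hts
      rw [← inv_smul_smul₀ h4 f, h3]
      exact Submodule.smul_mem _ _ (sub_mem h2 (Submodule.smul_mem _ _ h1))
    have hspan : Submodule.span F T = ⊤ := by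
      rw [eq_top_iff]
      intro x hx
      obtain ⟨u, -, hu, hxu⟩ := FormGeometry.mem_of_hyperbolic_pair he hf hef ⊤ hx hx
        (Submodule.mem_top (x := x))
      obtain ⟨t, ht, ht0⟩ := hex u
      have h1 : u = (u + (t - s) • f) - (t - s) • f := by abel
      have h2 : e = (e + s • f) - s • f := by abel
      have h3 : u ∈ Submodule.span F T := by
        rw [h1]
        exact sub_mem (hmem u hu t ht ht0) (Submodule.smul_mem _ _ hfT)
      have h4 : e ∈ Submodule.span F T := by
        rw [h2]
        exact sub_mem (Submodule.subset_span hv₀) (Submodule.smul_mem _ _ hfT)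
      rw [hxu]
      exact add_mem (add_mem (Submodule.smul_mem _ _ h4) (Submodule.smul_mem _ _ hfT)) h3
    have h := FormGeometry.baseSize_anisotropic_line_le hpl mem_unitaryGroup_iff (hrad p hp0) hτp
      hTτ (fun v hv => ⟨f, by rw [hBf v hv]; exact one_ne_zero⟩) hv₀ (Or.inl hstar)
      fun g _ ν _ hg x => hg x (by rw [hspan]; exact Submodule.mem_top)
    rw [hspan, finrank_top, finrank_formSpace] at h
    exact h

theorem baseSize_PGU_plane_le (hq : Nat.card F = q ^ 2) (hr : r ≤ 1) (hd : 7 ≤ 2 * a + r)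
    {U : Submodule F (FormSpace F a r)} (hU : Module.finrank F U = 2)
    (h : IsTotallyIsotropic (unitaryForm q a r) U ∨ IsNondegenerateOn (unitaryForm q a r) U) :
    baseSize (PGUGroup F q a r) (MulAction.orbit (PGUGroup F q a r) U) ≤
      (⌈((2 * a + r : ℕ) : ℚ) / 2⌉₊ : ℕ) := by
  obtain ⟨σ, hσ⟩ := exists_frobenius_of_card_eq_sq hq
  have hσσ : ∀ x, σ (σ x) = x := fun x => by rw [hσ, hσ]; exact pow_pow_of_card_eq_sq hq x
  have hne : ∃ x, σ x ≠ x := by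
    obtain ⟨x, hx⟩ := exists_pow_ne_of_card_eq_sq hq
    exact ⟨x, by rwa [hσ]⟩
  have hq0 : q ≠ 0 := by have := one_lt_of_card_eq_sq hq; omega
  set G := unitaryGeometry a r q σ hσ hσσ hne with hG
  have hst : G.IsStandard := unitaryGeometry_isStandard hq0
  have hpl : G.Plentiful 3 := unitaryGeometry_plentiful 3
  rcases h with h | h
  · exact hst.baseSize_isotropic_plane_le hpl mem_unitaryGroup_iff (by omega) hd hU
      (fun u hu => h u hu u hu) h
  · -- A nondegenerate plane contains an isotropic vector, as the norm is surjective.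
    obtain ⟨p, hp, hp0, hτ⟩ : ∃ p ∈ U, p ≠ 0 ∧ G.τ p = 0 := by
      obtain ⟨u, hu, v, hv, hind⟩ := exists_independent_pair hU
      by_cases hτu : G.τ u = 0
      · exact ⟨u, hu, fun h0 => one_ne_zero (hind 1 0 (by simp [h0])).1, hτu⟩
      set w := v - (G.B v u / G.τ u) • u with hw
      have hwu : G.B w u = 0 := by
        rw [hw, G.sub_left, G.smul_left, show G.B u u = G.τ u from rfl, div_mul_cancel₀ _ hτu,
          sub_self]
      have hwU : w ∈ U := U.sub_mem hv (U.smul_mem _ hu)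
      have hw0 : ∀ c : F, c • u + w ≠ 0 := by
        intro c hc
        refine one_ne_zero (hind (c - G.B v u / G.τ u) 1 ?_).2
        rw [← hc, hw]; module
      by_cases hτw : G.τ w = 0
      · exact ⟨w, hwU, fun h0 => hw0 0 (by simp [h0]), hτw⟩
      have hfix : ∀ x, (G.τ x) ^ q = G.τ x := fun x => by
        rw [← hσ]; exact (unitaryForm_symm hσ hσσ x x).symm
      obtain ⟨z, hz⟩ := exists_mul_pow_eq hq (c := -(G.τ w / G.τ u))
        (by rw [← hσ, map_neg, map_div₀, hσ, hσ, hfix, hfix])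
        (neg_ne_zero.mpr (div_ne_zero hτw hτu))
      refine ⟨z • u + w, U.add_mem (U.smul_mem _ hu) hwU, hw0 z, ?_⟩
      rw [G.τ_add, G.τ_smul, G.smul_left, G.perp_symm hwu, mul_zero, map_zero,
        show G.σ z = z ^ q from hσ z, hz]
      field_simp
      ring
    exact hst.baseSize_hyperbolic_plane_le hpl mem_unitaryGroup_iff (by omega) hd hU h hp hp0 hτ

end Unitary

/-! ### Quadratic spaces over finite fields -/

section Quadratic

open QuadraticMap

variable {F V : Type*} [Field F] [AddCommGroup V] [Module F V]

/-- The geometry of a quadratic form without nonzero singular vectors in its radical. -/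
def quadraticGeometry (Q : QuadraticForm F V)
    (hQ : ∀ v, (∀ w, polar Q v w = 0) → Q v = 0 → v = 0) : FormGeometry F V where
  σ := RingHom.id F
  ε := 1
  κ := 2
  tr := AddMonoidHom.id F
  B := polar Q
  τ := Q
  σ_σ _ := rfl
  ε_mul_ε := one_mul 1
  σ_ε := rfl
  add_left := polar_add_left Q
  smul_left c u w := by rw [polar_smul_left, smul_eq_mul]
  symm u v := by rw [RingHom.id_apply, one_mul, polar_comm]
  tr_σ _ := rfl
  tr_ε _ := by rw [one_mul]
  tr_mul_norm _ _ := rfl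
  τ_add u v := by
    rw [QuadraticMap.map_add Q]
    rfl
  τ_smul c v := by
    rw [QuadraticMap.map_smul, smul_eq_mul]
    rfl
  self v := by
    rw [polar_self, two_nsmul, two_mul]
  exists_tr v := ⟨Q v, rfl⟩
  regular := hQ

variable {Q : QuadraticForm F V} {hQ : ∀ v, (∀ w, polar Q v w = 0) → Q v = 0 → v = 0}

theorem mem_quadraticIsometryGroup_iff (g : V ≃ₗ[F] V) :
    g ∈ quadraticIsometryGroup Q ↔ (quadraticGeometry Q hQ).IsIsom g := by
  refine ⟨fun h => ⟨fun u v => ?_, h⟩, fun h => h.2⟩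
  change polar Q (g u) (g v) = polar Q u v
  have h' : ∀ v, Q (g v) = Q v := h
  rw [polar, polar, ← map_add, h', h', h']

theorem isReflective_of_ne_zero {x : V} (hx : Q x ≠ 0) :
    (quadraticGeometry Q hQ).IsReflective x := by
  refine ⟨-(Q x)⁻¹, neg_ne_zero.mpr (inv_ne_zero hx), ?_, ?_⟩
  · change -(Q x)⁻¹ + -(Q x)⁻¹ * -(Q x)⁻¹ * Q x = 0
    field_simp
    ring
  · rw [(quadraticGeometry Q hQ).self]
    change -(Q x)⁻¹ + 1 * -(Q x)⁻¹ + -(Q x)⁻¹ * -(Q x)⁻¹ * (2 * Q x) = 0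
    field_simp
    ring

/-- If a coset of `Sᗮ` consisted of singular vectors, then `Sᗮ` would be totally isotropic, and the
radical would be zero. -/
theorem quadraticGeometry_plentiful [FiniteDimensional F V] {n : ℕ}
    (hn : 2 * n < Module.finrank F V) : (quadraticGeometry Q hQ).Plentiful n := by
  intro S hS x
  set G := quadraticGeometry Q hQ with hG
  by_contra! hcon
  have h0 : ∀ m ∈ G.perp S, Q (x + m) = 0 := fun m hm => by
    by_contra h
    exact hcon m hm (isReflective_of_ne_zero h)
  have hx : Q x = 0 := by simpa using h0 0 (Submodule.zero_mem _)
  have h1 : ∀ m ∈ G.perp S, Q m = -polar Q x m := fun m hm => by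
    have := h0 m hm
    rw [QuadraticMap.map_add Q, hx] at this
    linear_combination this
  have h2 : ∀ m ∈ G.perp S, ∀ m' ∈ G.perp S, polar Q m m' = 0 := fun m hm m' hm' => by
    have := h1 (m + m') (add_mem hm hm')
    rw [QuadraticMap.map_add Q, h1 m hm, h1 m' hm', polar_add_right] at this
    linear_combination this
  have hnd : ∀ v, (∀ w, polar Q v w = 0) → v = 0 := fun v hv =>
    hQ v hv (by rw [h1 v fun s _ => hv s, polar_comm, hv, neg_zero])
  have hB : (polarBilin Q).Nondegenerate :=
    ⟨fun v hv => hnd v hv, fun v hv => hnd v fun w => (polar_comm Q v w).trans (hv w)⟩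
  have e1 : G.perp S = LinearMap.BilinForm.orthogonal (polarBilin Q) S := by
    ext m
    exact ⟨fun h s hs => (polar_comm Q s m).trans (h s hs),
      fun h s hs => (polar_comm Q m s).trans (h s hs)⟩
  have e2 : G.perp S ≤ LinearMap.BilinForm.orthogonal (polarBilin Q) (G.perp S) :=
    fun m hm m' hm' => h2 m' hm' m hm
  have f1 := LinearMap.BilinForm.finrank_orthogonal hB S
  have f2 := Submodule.finrank_mono e2
  rw [LinearMap.BilinForm.finrank_orthogonal hB, e1, f1] at f2
  have f3 := Submodule.finrank_le S
  omega

/-! ### Nondegenerate planes -/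

section FiniteField

variable [Finite F]

theorem exists_sq_eq_of_two_eq_zero (h2 : (2 : F) = 0) (x : F) : ∃ y, y * y = x := by
  have := Fintype.ofFinite F
  obtain ⟨y, hy⟩ := FiniteField.isSquare_of_char_two
    (CharP.ringChar_of_prime_eq_zero Nat.prime_two (by exact_mod_cast h2)) x
  exact ⟨y, hy.symm⟩

/-- A binary diagonal form over a finite field of odd characteristic represents everything. -/
theorem exists_diagonal_eq (h2 : (2 : F) ≠ 0) {a b : F} (ha : a ≠ 0) (hb : b ≠ 0) (c : F) :
    ∃ x y : F, a * x ^ 2 + b * y ^ 2 = c := by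
  have := Fintype.ofFinite F
  have hchar : ringChar F ≠ 2 := fun h => h2 (by
    have := ringChar.Nat.cast_ringChar (R := F)
    rw [h] at this
    exact_mod_cast this)
  obtain ⟨x, y, hxy⟩ := FiniteField.exists_root_sum_quadratic
    (f := Polynomial.C a * Polynomial.X ^ 2) (g := Polynomial.C b * Polynomial.X ^ 2 +
      Polynomial.C (-c)) (by compute_degree!) (by compute_degree!)
    (FiniteField.odd_card_of_char_ne_two hchar)
  refine ⟨x, y, ?_⟩
  simp at hxy
  linear_combination hxy

/-- An anisotropic nondegenerate plane has a basis with opposite values of `Q`. -/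
theorem exists_opposite_basis {U : Submodule F V} (hU : Module.finrank F U = 2)
    (hnd : ∀ u ∈ U, (∀ v ∈ U, polar Q u v = 0) → u = 0) (han : ∀ u ∈ U, Q u = 0 → u = 0) :
    ∃ p ∈ U, ∃ p' ∈ U, (∀ a b : F, a • p + b • p' = 0 → a = 0 ∧ b = 0) ∧ Q p' = -Q p ∧
      polar Q p p' ≠ 0 ∧ polar Q p p' ^ 3 ≠ (Q p + Q p) ^ 3 := by
  obtain ⟨u, hu, v, hv, hind⟩ := exists_independent_pair hU
  have hu0 : u ≠ 0 := fun h0 => one_ne_zero (hind 1 0 (by simp [h0])).1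
  have hv0 : v ≠ 0 := fun h0 => one_ne_zero (hind 0 1 (by simp [h0])).2
  have hQu : Q u ≠ 0 := fun h => hu0 (han u hu h)
  have hQv : Q v ≠ 0 := fun h => hv0 (han v hv h)
  by_cases h2 : (2 : F) = 0
  · obtain ⟨c, hc⟩ := exists_sq_eq_of_two_eq_zero h2 (Q u / Q v)
    have hc0 : c ≠ 0 := by
      rintro rfl
      rw [mul_zero] at hc
      exact div_ne_zero hQu hQv hc.symm
    have huv : polar Q u v ≠ 0 := by
      intro h
      refine hu0 (hnd u hu fun x hx => ?_)
      rw [eq_pairSpan hU hu hv hind] at hx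
      obtain ⟨s, t, rfl⟩ := Submodule.mem_span_pair.mp hx
      rw [polar_add_right, polar_smul_right, polar_smul_right, h, polar_self, two_nsmul,
        ← two_mul, h2]
      simp
    have hpp : polar Q u (c • v) ≠ 0 := by
      rw [polar_smul_right]
      exact smul_ne_zero hc0 huv
    refine ⟨u, hu, c • v, U.smul_mem _ hv, fun a b hab => ?_, ?_, hpp, ?_⟩
    · rw [smul_smul] at hab
      obtain ⟨h3, h4⟩ := hind _ _ hab
      exact ⟨h3, (mul_eq_zero.mp h4).resolve_right hc0⟩
    · rw [QuadraticMap.map_smul, hc, smul_eq_mul, div_mul_cancel₀ _ hQv]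
      linear_combination (Q u) * h2
    · rw [← two_mul, h2, zero_mul, zero_pow three_ne_zero]
      exact pow_ne_zero 3 hpp
  · -- The condition on the cubes can be achieved by changing the sign of `p'`.
    suffices h : ∃ p ∈ U, ∃ p' ∈ U, (∀ a b : F, a • p + b • p' = 0 → a = 0 ∧ b = 0) ∧
        Q p' = -Q p ∧ polar Q p p' ≠ 0 by
      obtain ⟨p, hp, p', hp', h3, h4, h5⟩ := h
      by_cases h6 : polar Q p p' ^ 3 = (Q p + Q p) ^ 3
      · refine ⟨p, hp, -p', U.neg_mem hp', fun a b hab => ?_, by rw [QuadraticMap.map_neg, h4],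
          by rw [polar_neg_right]; exact neg_ne_zero.mpr h5, ?_⟩
        · obtain ⟨h7, h8⟩ := h3 a (-b) (by rw [← hab]; module)
          exact ⟨h7, neg_eq_zero.mp h8⟩
        · rw [polar_neg_right, ← h6]
          intro h7
          refine mul_ne_zero h2 (pow_ne_zero 3 h5) ?_
          linear_combination -h7
      · exact ⟨p, hp, p', hp', h3, h4, h5, h6⟩
    set w := v - (polar Q v u / (2 * Q u)) • u with hw
    have hwU : w ∈ U := U.sub_mem hv (U.smul_mem _ hu)
    have huu : polar Q u u = 2 * Q u := by rw [polar_self, two_nsmul, two_mul]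
    have huw : polar Q u w = 0 := by
      rw [polar_comm, hw, polar_sub_left, polar_smul_left, huu, smul_eq_mul,
        div_mul_cancel₀ _ (mul_ne_zero h2 hQu), sub_self]
    have hind' : ∀ a b : F, a • u + b • w = 0 → a = 0 ∧ b = 0 := by
      intro a b hab
      obtain ⟨h3, h4⟩ := hind (a - b * (polar Q v u / (2 * Q u))) b (by rw [← hab, hw]; module)
      rw [h4, zero_mul, sub_zero] at h3
      exact ⟨h3, h4⟩
    have hval : ∀ a b : F, Q (a • u + b • w) = Q u * a ^ 2 + Q w * b ^ 2 := by
      intro a b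
      rw [QuadraticMap.map_add Q, QuadraticMap.map_smul, QuadraticMap.map_smul, polar_smul_left,
        polar_smul_right, huw]
      simp only [smul_eq_mul]
      ring
    have hmem : ∀ a b : F, a • u + b • w ∈ U := fun a b =>
      U.add_mem (U.smul_mem _ hu) (U.smul_mem _ hwU)
    have hpol : ∀ a b c d : F, polar Q (a • u + b • w) (c • u + d • w) =
        2 * (Q u * a * c + Q w * b * d) := by
      intro a b c d
      have hww : polar Q w w = 2 * Q w := by rw [polar_self, two_nsmul, two_mul]
      have hwu : polar Q w u = 0 := by rw [polar_comm, huw]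
      simp only [polar_add_left, polar_add_right, polar_smul_left, polar_smul_right, huw, hwu, huu,
        hww, smul_eq_mul]
      ring
    have hQw : Q w ≠ 0 := fun h => one_ne_zero (hind' 0 1 (by simp [han w hwU h])).2
    by_cases hsq : IsSquare (-1 : F)
    · obtain ⟨s, hs⟩ := hsq
      have hs0 : s ≠ 0 := by
        rintro rfl
        rw [mul_zero] at hs
        exact one_ne_zero (neg_eq_zero.mp hs)
      refine ⟨(1 : F) • u + (1 : F) • w, hmem _ _, s • u + (-s) • w, hmem _ _, fun a b hab => ?_,
        ?_, ?_⟩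
      · obtain ⟨h3, h4⟩ := hind' (a + b * s) (a - b * s) (by rw [← hab]; module)
        have h5 : 2 * a = 0 := by linear_combination h3 + h4
        have h6 : a = 0 := (mul_eq_zero.mp h5).resolve_left h2
        rw [h6, zero_add] at h3
        exact ⟨h6, (mul_eq_zero.mp h3).resolve_right hs0⟩
      · rw [hval, hval]
        linear_combination (-(Q u) - Q w) * hs
      · rw [hpol]
        intro h3
        have h4 : Q u = Q w := by
          have h5 : (2 * s) * (Q u - Q w) = 0 := by linear_combination h3
          exact sub_eq_zero.mp ((mul_eq_zero.mp h5).resolve_left (mul_ne_zero h2 hs0))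
        refine one_ne_zero (hind' s 1 (han _ (hmem _ _) ?_)).2
        rw [hval]
        linear_combination (-(Q u)) * hs - h4
    · obtain ⟨x, y, hxy⟩ := exists_diagonal_eq h2 hQu hQw (-Q u)
      have hy0 : y ≠ 0 := by
        rintro rfl
        refine hsq ⟨x, mul_left_cancel₀ hQu ?_⟩
        linear_combination -hxy
      have hx0 : x ≠ 0 := by
        rintro rfl
        refine one_ne_zero (hind' 1 y (han _ (hmem _ _) ?_)).1
        rw [hval]
        linear_combination hxy
      refine ⟨(1 : F) • u + (0 : F) • w, hmem _ _, x • u + y • w, hmem _ _, fun a b hab => ?_,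
        ?_, ?_⟩
      · obtain ⟨h3, h4⟩ := hind' (a + b * x) (b * y) (by rw [← hab]; module)
        have h5 : b = 0 := (mul_eq_zero.mp h4).resolve_right hy0
        rw [h5, zero_mul, add_zero] at h3
        exact ⟨h3, h5⟩
      · rw [hval, hval]
        linear_combination hxy
      · rw [hpol]
        simp [h2, hQu, hx0]

end FiniteField

/-! ### Upper bounds for orbits of lines in quadratic spaces -/

/-- Bases spanning a subspace `W` that contains a hyperbolic pair `e`, `f`.  The hypotheses ask that
the orthogonal complement of that pair in `W` be sufficiently rich. -/
theorem baseSize_quadratic_line_le [FiniteDimensional F V] (hd : 4 < Module.finrank F V)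
    {p : V} (hp : ∃ x, polar Q p x ≠ 0) {e f : V} (he : Q e = 0) (hf : Q f = 0)
    (hef : polar Q e f = 1) {W : Submodule F V} (heW : e ∈ W) (hfW : f ∈ W)
    (h1 : ∃ u ∈ W, u ∈ (quadraticGeometry Q hQ).perp {e, f} ∧ Q u ≠ 0)
    (h2 : (2 : F) ≠ 0 → ∀ c : F, c ≠ 0 →
      ∃ u ∈ W, u ∈ (quadraticGeometry Q hQ).perp {e, f} ∧ Q u ≠ 0 ∧ Q u ≠ 2 * c)
    (h3 : ∃ u ∈ W, u ∈ (quadraticGeometry Q hQ).perp {e, f} ∧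
      ∃ v ∈ W, v ∈ (quadraticGeometry Q hQ).perp {e, f} ∧ polar Q u v ≠ 0)
    (hW : ∀ g ∈ quadraticIsometryGroup Q, (∀ x ∈ W, g x = x) → g = 1) :
    baseSize (ProjectiveGroup (quadraticIsometryGroup Q))
      (MulAction.orbit (ProjectiveGroup (quadraticIsometryGroup Q)) (Submodule.span F {p})) ≤
      Module.finrank F W := by
  set G := quadraticGeometry Q hQ with hG
  have hpl : G.Plentiful 2 := quadraticGeometry_plentiful (by omega)
  -- An isometry that is a scalar on `W` is a scalar.
  have hW' : ∀ g, G.IsIsom g → ∀ ν : F, ν * G.σ ν = 1 → (∀ x ∈ W, g x = ν • x) →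
      ∀ x, g x = ν • x := by
    intro g hg ν hν hgW x
    have hν0 : ν ≠ 0 := fun h0 => by simp [h0] at hν
    have hν' : ν * ν = 1 := hν
    set m : V ≃ₗ[F] V := LinearEquiv.smulOfNeZero F V ν hν0 with hm
    have hmv : ∀ v, m v = ν • v := fun v => rfl
    have hgQ : ∀ v, Q (g v) = Q v := hg.2
    have h4 : m * g = 1 := by
      refine hW _ (fun v => ?_) fun y hy => ?_
      · rw [LinearEquiv.mul_apply, hmv, QuadraticMap.map_smul, hν', one_smul, hgQ]
      · rw [LinearEquiv.mul_apply, hmv, hgW y hy, smul_smul, hν', one_smul]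
    have h5 : ν • g x = x := by
      have := congrArg (fun k : V ≃ₗ[F] V => k x) h4
      exact this
    rw [← h5, smul_smul, hν', one_smul, h5]
  by_cases hτp : Q p = 0
  · obtain ⟨u₀, hu₀W, hu₀, hQu₀⟩ := h1
    exact FormGeometry.baseSize_isotropic_line_le hpl mem_quadraticIsometryGroup_iff hp hτp he hf
      hef heW hfW hu₀W hu₀ (fun h0 => hQu₀ (by rw [h0, QuadraticMap.map_zero])) (s₀ := -Q u₀)
      (neg_ne_zero.mpr hQu₀) rfl hW'
  · have hee : polar Q e e = 0 := by rw [polar_self, he, smul_zero]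
    have hff : polar Q f f = 0 := by rw [polar_self, hf, smul_zero]
    have hfe : polar Q f e = 1 := by rw [polar_comm, hef]
    have hperp : ∀ u ∈ G.perp {e, f}, polar Q u e = 0 ∧ polar Q u f = 0 := fun u hu =>
      ⟨hu e (by simp), hu f (by simp)⟩
    -- If `2 ≠ 0`, the condition on `Q u` says that the vector is not orthogonal to `e + Q p • f`.
    set T : Set V := {v | ∃ u ∈ W, u ∈ G.perp {e, f} ∧ ((2 : F) ≠ 0 → Q u ≠ 2 * Q p) ∧
      v = e + (Q p - Q u) • f + u} with hT
    have hv₀ : e + Q p • f ∈ T :=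
      ⟨0, W.zero_mem, Submodule.zero_mem _, fun h => by
        rw [QuadraticMap.map_zero]; exact (mul_ne_zero h hτp).symm, by simp⟩
    have hTτ : ∀ v ∈ T, G.τ v = G.τ p := by
      rintro v ⟨u, -, hu, -, rfl⟩
      rw [FormGeometry.τ_hyperbolic_pair (G := G) he hf hef hu]
      exact sub_add_cancel (Q p) (Q u)
    have hBf : ∀ v ∈ T, polar Q v f = 1 := by
      rintro v ⟨u, -, hu, -, rfl⟩
      rw [polar_add_left, polar_add_left, polar_smul_left, hef, hff, (hperp u hu).2]; simp
    have hstar : (∀ v ∈ T, v = e + Q p • f ∨ G.B v (e + Q p • f) ≠ 0) ∨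
        (∀ x, G.σ x = x) ∧ (2 : F) = 0 := by
      by_cases h4 : (2 : F) = 0
      · exact Or.inr ⟨fun _ => rfl, h4⟩
      · left
        rintro v ⟨u, -, hu, hu2, rfl⟩
        right
        change polar Q _ _ ≠ 0
        simp only [polar_add_left, polar_add_right, polar_smul_left, polar_smul_right, hee, hef,
          hfe, hff, (hperp u hu).1, (hperp u hu).2, smul_eq_mul]
        intro h5
        exact hu2 h4 (by linear_combination -h5)
    have hmem : ∀ u ∈ W, u ∈ G.perp {e, f} → ((2 : F) ≠ 0 → Q u ≠ 2 * Q p) →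
        u - Q u • f ∈ Submodule.span F T := by
      intro u huW hu hu2
      have h4 : u - Q u • f = (e + (Q p - Q u) • f + u) - (e + Q p • f) := by module
      rw [h4]
      exact sub_mem (Submodule.subset_span ⟨u, huW, hu, hu2, rfl⟩) (Submodule.subset_span hv₀)
    have hmemf : ∀ c : F, c ≠ 0 → c • f ∈ Submodule.span F T → f ∈ Submodule.span F T := by
      intro c hc hcf
      rw [← inv_smul_smul₀ hc f]
      exact Submodule.smul_mem _ _ hcf
    have hkey : f ∈ Submodule.span F T ∧
        ∀ u ∈ W, u ∈ G.perp {e, f} → u ∈ Submodule.span F T := by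
      by_cases h4 : (2 : F) = 0
      · have hm : ∀ u ∈ W, u ∈ G.perp {e, f} → u - Q u • f ∈ Submodule.span F T :=
          fun u huW hu => hmem u huW hu fun h => absurd h4 h
        have hfT : f ∈ Submodule.span F T := by
          obtain ⟨u, huW, hu, v, hvW, hv, huv⟩ := h3
          refine hmemf _ huv ?_
          have h5 : polar Q u v • f = (u - Q u • f) + (v - Q v • f) -
              ((u + v) - Q (u + v) • f) := by
            rw [QuadraticMap.map_add Q]; module
          rw [h5]
          exact sub_mem (add_mem (hm u huW hu) (hm v hvW hv))
            (hm _ (add_mem huW hvW) (add_mem hu hv))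
        refine ⟨hfT, fun u huW hu => ?_⟩
        have h5 : u = (u - Q u • f) + Q u • f := by abel
        rw [h5]
        exact add_mem (hm u huW hu) (Submodule.smul_mem _ _ hfT)
      · obtain ⟨w, hwW, hw, hw0, hw2⟩ := h2 h4 (Q p) hτp
        have hfT : f ∈ Submodule.span F T := by
          refine hmemf (-(2 * Q w)) (neg_ne_zero.mpr (mul_ne_zero h4 hw0)) ?_
          have h5 : (-(2 * Q w)) • f = (w - Q w • f) + (-w - Q (-w) • f) := by
            rw [QuadraticMap.map_neg]; module
          rw [h5]
          exact add_mem (hmem w hwW hw fun _ => hw2) (hmem (-w) (neg_mem hwW) (neg_mem hw)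
            fun _ => by rwa [QuadraticMap.map_neg])
        have hm : ∀ u ∈ W, u ∈ G.perp {e, f} → Q u ≠ 2 * Q p → u ∈ Submodule.span F T := by
          intro u huW hu hu2
          have h5 : u = (u - Q u • f) + Q u • f := by abel
          rw [h5]
          exact add_mem (hmem u huW hu fun _ => hu2) (Submodule.smul_mem _ _ hfT)
        have hwT := hm w hwW hw hw2
        refine ⟨hfT, fun u huW hu => ?_⟩
        by_cases hu2 : Q u = 2 * Q p
        · -- If `Q u = 2 Q p`, then `u + w` or `u - w` has a different value of `Q`.
          by_cases h5 : Q (u + w) = 2 * Q p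
          · have h6 : Q (u - w) ≠ 2 * Q p := by
              intro h6
              rw [QuadraticMap.map_add Q] at h5
              rw [sub_eq_add_neg, QuadraticMap.map_add Q, QuadraticMap.map_neg,
                polar_neg_right] at h6
              refine mul_ne_zero h4 hw0 ?_
              linear_combination h5 + h6 - 2 * hu2
            have h7 : u = (u - w) + w := by abel
            rw [h7]
            exact add_mem (hm _ (sub_mem huW hwW) (sub_mem hu hw) h6) hwT
          · have h7 : u = (u + w) - w := by abel
            rw [h7]
            exact sub_mem (hm _ (add_mem huW hwW) (add_mem hu hw) h5) hwT
        · exact hm u huW hu hu2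
    have hspan : Submodule.span F T = W := by
      refine le_antisymm (Submodule.span_le.mpr ?_) fun x hx => ?_
      · rintro v ⟨u, huW, -, -, rfl⟩
        exact add_mem (add_mem heW (W.smul_mem _ hfW)) huW
      · obtain ⟨u, huW, hu, hxu⟩ := FormGeometry.mem_of_hyperbolic_pair (G := G) he hf hef W heW
          hfW hx
        have h4 : e = (e + Q p • f) - Q p • f := by abel
        have heT : e ∈ Submodule.span F T := by
          rw [h4]
          exact sub_mem (Submodule.subset_span hv₀) (Submodule.smul_mem _ _ hkey.1)
        rw [hxu]
        exact add_mem (add_mem (Submodule.smul_mem _ _ heT) (Submodule.smul_mem _ _ hkey.1))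
          (hkey.2 u huW hu)
    rw [← hspan]
    exact FormGeometry.baseSize_anisotropic_line_le hpl mem_quadraticIsometryGroup_iff hp hτp hTτ
      (fun v hv => ⟨f, by change polar Q v f ≠ 0; rw [hBf v hv]; exact one_ne_zero⟩) hv₀ hstar
      (by rwa [hspan])

/-- If the polar form is nondegenerate, then an isometry fixing the hyperplane orthogonal to a
singular vector `f` pointwise is trivial. -/
theorem eq_one_of_fixes_perp {e f : V} (hnd : ∀ v, (∀ w, polar Q v w = 0) → v = 0)
    (hf : Q f = 0) (hef : polar Q e f = 1) {g : V ≃ₗ[F] V}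
    (hg : g ∈ quadraticIsometryGroup Q) (hfix : ∀ x, polar Q x f = 0 → g x = x) : g = 1 := by
  have hgQ : ∀ v, Q (g v) = Q v := hg
  have hgB : ∀ u v, polar Q (g u) (g v) = polar Q u v := fun u v => by
    rw [polar, polar, ← map_add, hgQ, hgQ, hgQ]
  have hfe : polar Q f e = 1 := by rw [polar_comm, hef]
  have hff : polar Q f f = 0 := by rw [polar_self, hf, smul_zero]
  have hd : ∀ x, polar Q x f = 0 → polar Q (g e - e) x = 0 := by
    intro x hx
    rw [polar_sub_left]
    have := hgB e x
    rw [hfix x hx] at this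
    rw [this, sub_self]
  set c := polar Q (g e - e) e with hc
  have h1 : g e - e - c • f = 0 := by
    refine hnd _ fun w => ?_
    have hw : w = (w - polar Q w f • e) + polar Q w f • e := by abel
    have hw' : polar Q (w - polar Q w f • e) f = 0 := by
      rw [polar_sub_left, polar_smul_left, hef, smul_eq_mul, mul_one, sub_self]
    rw [hw, polar_add_right, polar_smul_right, polar_sub_left, hd _ hw', polar_sub_left,
      polar_smul_left, polar_smul_left, hfe, polar_comm Q f, hw', ← hc]
    simp
  have h2 : g e = e + c • f := by rw [← sub_eq_zero, ← h1]; abel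
  have hc0 : c = 0 := by
    have h3 := hgQ e
    rw [h2, QuadraticMap.map_add Q, QuadraticMap.map_smul, hf, polar_smul_right, hef] at h3
    simpa using h3
  rw [hc0, zero_smul, add_zero] at h2
  ext x
  change g x = x
  have hx : x = (x - polar Q x f • e) + polar Q x f • e := by abel
  have hx' : polar Q (x - polar Q x f • e) f = 0 := by
    rw [polar_sub_left, polar_smul_left, hef, smul_eq_mul, mul_one, sub_self]
  rw [hx, map_add, map_smul, h2, hfix _ hx']

/-! ### Lower bounds -/

/-- A pointwise stabilizer of a subspace of codimension at least two is nontrivial: it contains a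
reflection, or else a Siegel transformation. -/
theorem exists_ne_one_of_finrank_add_two_le [Finite F] [FiniteDimensional F V]
    (hQ : ∀ v, (∀ w, polar Q v w = 0) → Q v = 0 → v = 0)
    (W : Submodule F V) (hW : Module.finrank F W + 2 ≤ Module.finrank F V) :
    ∃ g ∈ quadraticIsometryGroup Q, g ≠ 1 ∧ ∀ w ∈ W, g w = w := by
  set G := quadraticGeometry Q hQ with hG
  set M := LinearMap.BilinForm.orthogonal (polarBilin Q) W with hM
  have hMW : ∀ m ∈ M, ∀ w ∈ W, polar Q w m = 0 := fun m hm w hw => hm w hw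
  have hrank : 2 ≤ Module.finrank F M := by
    have hR : (polarBilin Q).IsRefl := fun u v h => (polar_comm Q v u).trans h
    have := LinearMap.BilinForm.finrank_add_finrank_orthogonal hR W
    change _ + Module.finrank F M = _ at this
    have := Submodule.finrank_le ((⊤ : Submodule F V))
    omega
  by_cases hrefl : ∃ x ∈ M, Q x ≠ 0 ∧ ∃ y, polar Q y x ≠ 0
  · obtain ⟨x, hxM, hx, y, hy⟩ := hrefl
    obtain ⟨c, hc, h1, h2⟩ := isReflective_of_ne_zero (hQ := hQ) hx
    obtain ⟨g, hg, hgv⟩ := G.exists_isIsom_reflection hc h1 h2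
    refine ⟨g, (mem_quadraticIsometryGroup_iff (hQ := hQ) g).mpr hg, fun h => ?_, fun w hw => ?_⟩
    · have h3 := hgv y
      rw [h] at h3
      have h4 : (c * polar Q y x) • x = 0 := by
        have h5 : y = y + (c * polar Q y x) • x := h3
        simpa using h5.symm
      rcases smul_eq_zero.mp h4 with h5 | h5
      · exact mul_ne_zero hc hy h5
      · exact hx (by rw [h5, QuadraticMap.map_zero])
    · have h3 : g w = w + (c * polar Q w x) • x := hgv w
      rw [h3, hMW x hxM w hw, mul_zero, zero_smul, add_zero]
  · push Not at hrefl
    obtain ⟨x, y, hxy⟩ : ∃ x y : M, LinearIndependent F ![x, y] := by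
      have : Nontrivial M := Module.nontrivial_of_finrank_pos (R := F) (by omega)
      obtain ⟨x, hx⟩ := exists_ne (0 : M)
      obtain ⟨y, hy⟩ := exists_linearIndependent_pair_of_one_lt_finrank (R := F) (by omega) hx
      exact ⟨x, y, hy⟩
    have hind : ∀ a b : F, a • (x : V) + b • (y : V) = 0 → a = 0 ∧ b = 0 := fun a b hab =>
      LinearIndependent.pair_iff.mp hxy a b (Subtype.ext hab)
    -- All vectors in the orthogonal complement of `W` are singular.
    have hsing : ∀ v ∈ M, Q v = 0 := by
      intro v hvM
      by_contra hv
      have hvr := hrefl v hvM hv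
      have h2 : (2 : F) = 0 := by
        have h3 := hvr v
        rw [polar_self, two_nsmul, ← two_mul] at h3
        exact (mul_eq_zero.mp h3).resolve_right hv
      have hmul : ∀ u ∈ M, ∃ c : F, c • v + u = 0 := by
        intro u hu
        by_cases hur : ∀ z, polar Q z u = 0
        · obtain ⟨c, hc⟩ := exists_sq_eq_of_two_eq_zero h2 (-(Q u) / Q v)
          refine ⟨c, hQ _ (fun w => ?_) ?_⟩
          · rw [polar_comm, polar_add_right, polar_smul_right, hvr, hur, smul_zero, add_zero]
          · rw [QuadraticMap.map_add Q, QuadraticMap.map_smul, polar_smul_left, polar_comm, hvr, hc,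
              smul_eq_mul, smul_zero, div_mul_cancel₀ _ hv]
            ring
        · exfalso
          push Not at hur
          obtain ⟨z, hz⟩ := hur
          have hQu : Q u = 0 := by
            by_contra h3
            exact hz (hrefl u hu h3 z)
          refine hz ?_
          have h3 := hrefl (v + u) (add_mem hvM hu) (by
            rw [QuadraticMap.map_add Q, hQu, polar_comm, hvr]; simpa using hv) z
          rwa [polar_add_right, hvr, zero_add] at h3
      obtain ⟨c, hc⟩ := hmul x x.2
      obtain ⟨d, hd⟩ := hmul y y.2
      have h3 := hind d (-c) (by
        have h4 : d • (x : V) + (-c) • (y : V) = d • (c • v + x) - c • (d • v + y) := by module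
        rw [h4, hc, hd, smul_zero, smul_zero, sub_zero])
      rw [h3.1, zero_smul, zero_add] at hd
      exact one_ne_zero (hind 0 1 (by rw [hd]; simp)).2
    -- The Siegel transformation `z ↦ z + B(z, x) y - B(z, y) x`.
    have hQx := hsing x x.2
    have hQy := hsing y y.2
    have hxy0 : polar Q x y = 0 := by
      rw [polar, hsing _ (add_mem x.2 y.2), hQx, hQy]; ring
    have hxx : polar Q (x : V) x = 0 := by rw [polar_self, hQx, smul_zero]
    have hyy : polar Q (y : V) y = 0 := by rw [polar_self, hQy, smul_zero]
    have hyx0 : polar Q (y : V) x = 0 := by rw [polar_comm, hxy0]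
    let s : V →ₗ[F] V := LinearMap.id + (G.left x).smulRight (y : V) - (G.left y).smulRight (x : V)
    have hs : ∀ z, s z = z + polar Q z x • (y : V) - polar Q z y • (x : V) := fun z => rfl
    have hinj : Function.Injective s := by
      rw [← LinearMap.ker_eq_bot, LinearMap.ker_eq_bot']
      intro z hz
      rw [hs] at hz
      have h1 := congrArg (fun v => polar Q v x) hz
      have h2 := congrArg (fun v => polar Q v y) hz
      simp only [polar_sub_left, polar_add_left, polar_smul_left, hxx, hyx0, hxy0, hyy,
        polar_zero_left, smul_zero, add_zero, sub_zero] at h1 h2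
      rwa [h1, h2, zero_smul, zero_smul, add_zero, sub_zero] at hz
    refine ⟨LinearEquiv.ofInjectiveEndo s hinj, fun z => ?_, fun h => ?_, fun w hw => ?_⟩
    · change Q (s z) = Q z
      have h1 : s z = z + (polar Q z x • (y : V) + (-polar Q z y) • (x : V)) := by
        rw [hs]; module
      rw [h1, QuadraticMap.map_add Q, QuadraticMap.map_add Q, QuadraticMap.map_smul,
        QuadraticMap.map_smul, hQx, hQy]
      simp only [polar_add_right, polar_smul_right, polar_smul_left, hyx0, smul_eq_mul]
      ring
    · have hx0 : (x : V) ≠ 0 := fun h0 => one_ne_zero (hind 1 0 (by simp [h0])).1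
      refine hx0 (hQ x (fun z => ?_) hQx)
      have h1 : s z = z := congrArg (fun k : V ≃ₗ[F] V => k z) h
      rw [hs] at h1
      have h2 : (-polar Q z y) • (x : V) + polar Q z x • (y : V) = 0 := by
        have h3 : (-polar Q z y) • (x : V) + polar Q z x • (y : V) =
          (z + polar Q z x • (y : V) - polar Q z y • (x : V)) - z := by module
        rw [h3, h1, sub_self]
      rw [polar_comm]
      exact (hind _ _ h2).2
    · change s w = w
      rw [hs, hMW x x.2 w hw, hMW y y.2 w hw]
      simp

/-- A base consisting of lines spans a subspace of codimension at most one. -/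
theorem le_baseSize_quadratic_line [Finite F] [FiniteDimensional F V]
    (hQ : ∀ v, (∀ w, polar Q v w = 0) → Q v = 0 → v = 0) (hd : 3 ≤ Module.finrank F V) (p : V) :
    ((Module.finrank F V - 1 : ℕ) : ℕ∞) ≤ baseSize (ProjectiveGroup (quadraticIsometryGroup Q))
      (MulAction.orbit (ProjectiveGroup (quadraticIsometryGroup Q)) (Submodule.span F {p})) := by
  classical
  refine le_iInf₂ fun B hB => ?_
  by_contra! hlt
  have hfin : B.Finite := Set.finite_of_encard_le_coe (hlt.le)
  have hline : ∀ b : MulAction.orbit (ProjectiveGroup (quadraticIsometryGroup Q))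
      (Submodule.span F {p}), ∃ v, (b : Submodule F V) = Submodule.span F {v} := by
    rintro ⟨_, x, rfl⟩
    obtain ⟨g, rfl⟩ : ∃ g, ProjectiveGroup.mk _ g = x := QuotientGroup.mk'_surjective _ x
    refine ⟨(g : V ≃ₗ[F] V) p, ?_⟩
    change (Submodule.span F {p}).map ((g : V ≃ₗ[F] V) : V →ₗ[F] V) = _
    rw [Submodule.map_span, Set.image_singleton]
    rfl
  choose v hv using hline
  set S : Finset V := hfin.toFinset.image v with hS
  have hScard : S.card + 2 ≤ Module.finrank F V := by
    have h1 : S.card ≤ hfin.toFinset.card := Finset.card_image_le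
    rw [hfin.encard_eq_coe_toFinset_card] at hlt
    have h2 : hfin.toFinset.card < Module.finrank F V - 1 := by exact_mod_cast hlt
    omega
  obtain ⟨W, hSW, hWne, hWr⟩ : ∃ W : Submodule F V, Submodule.span F (S : Set V) ≤ W ∧ W ≠ ⊥ ∧
      Module.finrank F W + 2 ≤ Module.finrank F V := by
    by_cases h0 : Submodule.span F (S : Set V) = ⊥
    · have : Nontrivial V := Module.nontrivial_of_finrank_pos (R := F) (by omega)
      obtain ⟨x, hx⟩ := exists_ne (0 : V)
      refine ⟨Submodule.span F {x}, by rw [h0]; exact bot_le, by simpa using hx, ?_⟩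
      rw [finrank_span_singleton hx]
      omega
    · exact ⟨_, le_rfl, h0, (add_le_add_left (finrank_span_finset_le_card S) 2).trans hScard⟩
  obtain ⟨g, hg, hg1, hgW⟩ := exists_ne_one_of_finrank_add_two_le hQ W hWr
  have hmem : ProjectiveGroup.mk _ ⟨g, hg⟩ ∈ fixingSubgroup _ B := by
    rw [mem_fixingSubgroup_iff]
    intro b hb
    refine Subtype.ext ?_
    change (b : Submodule F V).map (g : V →ₗ[F] V) = b
    rw [hv b, Submodule.map_span, Set.image_singleton]
    change Submodule.span F {g (v b)} = _
    rw [hgW _ (hSW (Submodule.subset_span (by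
      rw [hS, Finset.coe_image]
      exact ⟨b, by simpa using hb, rfl⟩)))]
  rw [hB, Subgroup.mem_bot] at hmem
  obtain ⟨c, hc⟩ := Subgroup.mem_subgroupOf.mp ((QuotientGroup.eq_one_iff _).mp hmem)
  obtain ⟨w, hwW, hw0⟩ := Submodule.exists_mem_ne_zero_of_ne_bot hWne
  have hcg : ∀ x, g x = (c : F) • x := fun x => by
    have := congrArg (fun k : V ≃ₗ[F] V => k x) hc
    exact this.symm
  have hc1 : (c : F) = 1 := by
    have h1 := hcg w
    rw [hgW w hwW] at h1
    have h2 : ((c : F) - 1) • w = 0 := by rw [sub_smul, ← h1, one_smul, sub_self]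
    exact sub_eq_zero.mp ((smul_eq_zero.mp h2).resolve_right hw0)
  refine hg1 (LinearEquiv.ext fun x => ?_)
  rw [hcg, hc1, one_smul]
  rfl

end Quadratic

/-! ### The standard quadratic forms -/

section StandardQuadratic

open QuadraticMap

variable {F : Type*} [Field F] {a r : ℕ} {ζ : F}

theorem standardQuadraticForm_apply (v : FormSpace F a r) :
    standardQuadraticForm a r ζ v =
      ∑ i : Fin a, eCoord i v * fCoord i v + anisotropicPart a ζ r v := by
  simp [standardQuadraticForm]

theorem polar_standardQuadraticForm (u v : FormSpace F a r) :
    polar (standardQuadraticForm a r ζ) u v =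
      ∑ i : Fin a, (eCoord i u * fCoord i v + fCoord i u * eCoord i v) +
        polar (anisotropicPart a ζ r) u v := by
  have h : ∑ i : Fin a, (eCoord i u * fCoord i v + fCoord i u * eCoord i v) =
      ∑ i : Fin a, eCoord i (u + v) * fCoord i (u + v) - ∑ i : Fin a, eCoord i u * fCoord i u -
        ∑ i : Fin a, eCoord i v * fCoord i v := by
    rw [← Finset.sum_sub_distrib, ← Finset.sum_sub_distrib]
    refine Finset.sum_congr rfl fun i _ => ?_
    rw [map_add, map_add]
    ring
  rw [h, polar, polar, standardQuadraticForm_apply, standardQuadraticForm_apply,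
    standardQuadraticForm_apply]
  ring

theorem anisotropicPart_one (v : FormSpace F a 1) :
    anisotropicPart a ζ 1 v = xCoord 0 v * xCoord 0 v := rfl

theorem anisotropicPart_two (v : FormSpace F a 2) :
    anisotropicPart a ζ 2 v = xCoord 0 v * xCoord 0 v + xCoord 0 v * xCoord 1 v +
      ζ * (xCoord 1 v * xCoord 1 v) := rfl

/-- The anisotropic part depends on the coordinates `x_j` only. -/
theorem anisotropicPart_congr {u v : FormSpace F a r} (h : ∀ j, xCoord j u = xCoord j v) :
    anisotropicPart a ζ r u = anisotropicPart a ζ r v := by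
  match r, u, v, h with
  | 0, _, _, _ => rfl
  | 1, u, v, h => rw [anisotropicPart_one, anisotropicPart_one, h]
  | 2, u, v, h => rw [anisotropicPart_two, anisotropicPart_two, h, h]
  | _ + 3, _, _, _ => rfl

theorem anisotropicPart_eq_zero {v : FormSpace F a r} (h : ∀ j, xCoord j v = 0) :
    anisotropicPart a ζ r v = 0 := by
  rw [anisotropicPart_congr (v := 0) (by simpa using h), QuadraticMap.map_zero]

theorem polar_anisotropicPart_eq_zero (u : FormSpace F a r) {v : FormSpace F a r}
    (h : ∀ j, xCoord j v = 0) : polar (anisotropicPart a ζ r) u v = 0 := by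
  rw [polar, anisotropicPart_eq_zero h, anisotropicPart_congr (u := u + v) (v := u) (by simp [h])]
  ring

theorem standardQuadraticForm_eVec (i : Fin a) :
    standardQuadraticForm a r ζ (eVec i : FormSpace F a r) = 0 := by
  rw [standardQuadraticForm_apply, anisotropicPart_eq_zero (by simp)]
  simp

theorem standardQuadraticForm_fVec (i : Fin a) :
    standardQuadraticForm a r ζ (fVec i : FormSpace F a r) = 0 := by
  rw [standardQuadraticForm_apply, anisotropicPart_eq_zero (by simp)]
  simp

theorem polar_standardQuadraticForm_eVec (u : FormSpace F a r) (i : Fin a) :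
    polar (standardQuadraticForm a r ζ) u (eVec i) = fCoord i u := by
  rw [polar_standardQuadraticForm, polar_anisotropicPart_eq_zero _ (by simp)]
  simp

theorem polar_standardQuadraticForm_fVec (u : FormSpace F a r) (i : Fin a) :
    polar (standardQuadraticForm a r ζ) u (fVec i) = eCoord i u := by
  rw [polar_standardQuadraticForm, polar_anisotropicPart_eq_zero _ (by simp)]
  simp

/-- A root of `X ^ 2 + X + ζ` is excluded, so `x ^ 2 + x y + ζ y ^ 2` is anisotropic. -/
theorem eq_zero_of_irreducible (hζ : Irreducible (Polynomial.X ^ 2 + Polynomial.X + Polynomial.C ζ))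
    {x y : F} (h : x * x + x * y + ζ * (y * y) = 0) : x = 0 ∧ y = 0 := by
  have hroot : ∀ t : F, t ^ 2 + t + ζ ≠ 0 := by
    intro t ht
    have h1 := Polynomial.degree_eq_one_of_irreducible_of_root hζ (x := t) (by simpa using ht)
    have h2 : (Polynomial.X ^ 2 + Polynomial.X + Polynomial.C ζ).degree = 2 := by compute_degree!
    rw [h2] at h1
    exact absurd h1 (by decide)
  by_cases hy : y = 0
  · rw [hy] at h ⊢
    exact ⟨by simpa using h, rfl⟩
  · refine absurd ?_ (hroot (x / y))
    field_simp
    linear_combination h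

theorem ne_zero_of_irreducible
    (hζ : Irreducible (Polynomial.X ^ 2 + Polynomial.X + Polynomial.C ζ)) : ζ ≠ 0 := by
  rintro rfl
  exact one_ne_zero (eq_zero_of_irreducible hζ (x := 0) (y := (1 : F)) (by simp)).2

theorem standardQuadraticForm_regular (hr : r ≤ 2)
    (hζ : r = 2 → Irreducible (Polynomial.X ^ 2 + Polynomial.X + Polynomial.C ζ))
    (v : FormSpace F a r) (hv : ∀ w, polar (standardQuadraticForm a r ζ) v w = 0)
    (hQ : standardQuadraticForm a r ζ v = 0) : v = 0 := by
  have he : ∀ i, eCoord i v = 0 := fun i => by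
    rw [← polar_standardQuadraticForm_fVec (ζ := ζ), hv]
  have hf : ∀ i, fCoord i v = 0 := fun i => by
    rw [← polar_standardQuadraticForm_eVec (ζ := ζ), hv]
  rw [standardQuadraticForm_apply] at hQ
  simp only [he, zero_mul, Finset.sum_const_zero, zero_add] at hQ
  refine FormSpace.eq_zero he hf ?_
  clear he hf hv
  interval_cases r
  · exact fun j => j.elim0
  · rw [anisotropicPart_one] at hQ
    intro j
    rw [Subsingleton.elim j 0]
    exact mul_self_eq_zero.mp hQ
  · rw [anisotropicPart_two] at hQ
    obtain ⟨h0, h1⟩ := eq_zero_of_irreducible (hζ rfl) hQ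
    intro j
    fin_cases j
    · exact h0
    · exact h1

/-- The polar form is nondegenerate except in odd dimension and characteristic two. -/
theorem standardQuadraticForm_nondegenerate (hr : r ≤ 2)
    (hζ : r = 2 → Irreducible (Polynomial.X ^ 2 + Polynomial.X + Polynomial.C ζ))
    (h : r = 1 → (2 : F) ≠ 0)
    (v : FormSpace F a r) (hv : ∀ w, polar (standardQuadraticForm a r ζ) v w = 0) : v = 0 := by
  have he : ∀ i, eCoord i v = 0 := fun i => by
    rw [← polar_standardQuadraticForm_fVec (ζ := ζ), hv]
  have hf : ∀ i, fCoord i v = 0 := fun i => by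
    rw [← polar_standardQuadraticForm_eVec (ζ := ζ), hv]
  by_cases h2 : (2 : F) = 0
  · have hr1 : r ≠ 1 := fun h1 => h h1 h2
    refine FormSpace.eq_zero he hf ?_
    have hx : ∀ j, polar (anisotropicPart a ζ r) v (xVec j) = 0 := fun j => by
      have := hv (xVec j)
      rw [polar_standardQuadraticForm] at this
      simpa using this
    clear he hf hv
    interval_cases r
    · exact fun j => j.elim0
    · exact absurd rfl hr1
    · have h0 := hx 0
      have h1 := hx 1
      simp only [polar, anisotropicPart_two, map_add, xCoord_xVec] at h0 h1
      simp at h0 h1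
      intro j
      fin_cases j
      · change xCoord 0 v = 0
        linear_combination h1 - ζ * xCoord 1 v * h2
      · change xCoord 1 v = 0
        linear_combination h0 - xCoord 0 v * h2
  · refine standardQuadraticForm_regular hr hζ v hv ?_
    have := hv v
    rw [polar_self, two_nsmul, ← two_mul] at this
    exact (mul_eq_zero.mp this).resolve_left h2

theorem quadraticGeometry_isStandard (hQ : ∀ v : FormSpace F a r,
      (∀ w, polar (standardQuadraticForm a r ζ) v w = 0) →
        standardQuadraticForm a r ζ v = 0 → v = 0) :
    (quadraticGeometry (standardQuadraticForm a r ζ) hQ).IsStandard where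
  right_e u i := (polar_standardQuadraticForm_eVec u i).trans (one_mul _).symm
  right_f := polar_standardQuadraticForm_fVec
  τe := standardQuadraticForm_eVec
  τf := standardQuadraticForm_fVec

/-- The upper bound if the polar form is nondegenerate, from lines spanning the hyperplane
orthogonal to `f_2`. -/
theorem baseSize_PGO_line_le_of_nondegenerate (hr : r ≤ 2)
    (hζ : r = 2 → Irreducible (Polynomial.X ^ 2 + Polynomial.X + Polynomial.C ζ))
    (h : r = 1 → (2 : F) ≠ 0) (hd : 6 ≤ 2 * a + r) {p : FormSpace F a r}
    (hp : ∃ x, polar (standardQuadraticForm a r ζ) p x ≠ 0) :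
    baseSize (PGOGroup a r ζ) (MulAction.orbit (PGOGroup a r ζ) (Submodule.span F {p})) ≤
      ((2 * a + r - 1 : ℕ) : ℕ∞) := by
  set Q := standardQuadraticForm a r ζ with hQdef
  have hQ : ∀ v, (∀ w, polar Q v w = 0) → Q v = 0 → v = 0 := standardQuadraticForm_regular hr hζ
  let W : Submodule F (FormSpace F a r) := LinearMap.ker (eCoord (⟨1, by omega⟩ : Fin a))
  have hWr : Module.finrank F W = 2 * a + r - 1 := by
    have h1 := LinearMap.finrank_range_add_finrank_ker
      (eCoord (⟨1, by omega⟩ : Fin a) : FormSpace F a r →ₗ[F] F)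
    have h2 : LinearMap.range (eCoord (⟨1, by omega⟩ : Fin a) : FormSpace F a r →ₗ[F] F) = ⊤ :=
      LinearMap.range_eq_top.mpr fun c => ⟨c • eVec ⟨1, by omega⟩, by simp⟩
    rw [h2, finrank_top, Module.finrank_self, finrank_formSpace] at h1
    change Module.finrank F (LinearMap.ker _) = _
    omega
  have hperp : ∀ u : FormSpace F a r, fCoord ⟨0, by omega⟩ u = 0 → eCoord ⟨0, by omega⟩ u = 0 →
      u ∈ (quadraticGeometry Q hQ).perp {eVec (⟨0, by omega⟩ : Fin a), fVec ⟨0, by omega⟩} := by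
    rintro u h1 h2 _ (rfl | rfl)
    · exact (polar_standardQuadraticForm_eVec u _).trans h1
    · exact (polar_standardQuadraticForm_fVec u _).trans h2
  -- A plane in `W` on which `Q` is not identically zero, orthogonal to `e_1` and `f_1`.
  obtain ⟨x, hxW, hx, y, hyW, hy, hxy, hval⟩ : ∃ x ∈ W, x ∈ (quadraticGeometry Q hQ).perp
      {eVec (⟨0, by omega⟩ : Fin a), fVec ⟨0, by omega⟩} ∧ ∃ y ∈ W,
        y ∈ (quadraticGeometry Q hQ).perp {eVec (⟨0, by omega⟩ : Fin a), fVec ⟨0, by omega⟩} ∧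
          polar Q x y = 1 ∧ ((Q x = 0 ∧ Q y = 0) ∨ (Q x = 1 ∧ Q y ≠ 0 ∧ Q (x + y) ≠ 0)) := by
    by_cases hr2 : r = 2
    · subst hr2
      refine ⟨xVec 0, by simp [W], hperp _ (by simp) (by simp), xVec 1, by simp [W],
        hperp _ (by simp) (by simp), ?_, Or.inr ⟨?_, ?_, ?_⟩⟩
      · rw [polar_standardQuadraticForm]
        simp [polar, anisotropicPart_two]
        ring
      · rw [hQdef, standardQuadraticForm_apply]
        simp [anisotropicPart_two]
      · rw [hQdef, standardQuadraticForm_apply]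
        simpa [anisotropicPart_two] using ne_zero_of_irreducible (hζ rfl)
      · rw [hQdef, standardQuadraticForm_apply]
        intro h0
        refine one_ne_zero (α := F) (eq_zero_of_irreducible (hζ rfl) (x := 1) (y := 1) ?_).1
        simpa [anisotropicPart_two] using h0
    · have ha : 3 ≤ a := by omega
      refine ⟨eVec ⟨2, by omega⟩, by simp [W], hperp _ (by simp) (by simp), fVec ⟨2, by omega⟩,
        by simp [W], hperp _ (by simp) (by simp), ?_,
        Or.inl ⟨standardQuadraticForm_eVec _, standardQuadraticForm_fVec _⟩⟩
      rw [polar_standardQuadraticForm_fVec]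
      simp
  have hQs : ∀ s t : F, Q (s • x + t • y) = s * s * Q x + t * t * Q y + s * t := fun s t => by
    rw [QuadraticMap.map_add Q, QuadraticMap.map_smul, QuadraticMap.map_smul, polar_smul_left,
      polar_smul_right, hxy]
    simp only [smul_eq_mul]
    ring
  have hval2 : (2 : F) ≠ 0 → ∀ c : F, c ≠ 0 → ∃ s t : F, Q (s • x + t • y) ≠ 0 ∧
      Q (s • x + t • y) ≠ 2 * c := by
    intro h2 c hc
    simp only [hQs]
    rcases hval with ⟨h3, h4⟩ | ⟨h3, h4, h8⟩
    · rw [h3, h4]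
      refine ⟨1, -(2 * c), ?_, ?_⟩
      · simpa using ⟨h2, hc⟩
      · intro h5
        refine mul_ne_zero (mul_ne_zero h2 h2) hc ?_
        linear_combination -h5
    · rw [h3]
      by_cases h5 : (1 : F) = 2 * c
      · rw [← h5]
        by_cases h6 : Q y = 1
        · refine ⟨1, 1, ?_, ?_⟩
          · rw [QuadraticMap.map_add Q, hxy, h3] at h8
            simpa using h8
          · rw [h6]
            intro h7
            exact h2 (by linear_combination h7)
        · exact ⟨0, 1, by simpa using h4, by simpa using h6⟩
      · exact ⟨1, 0, by simp, by simpa using h5⟩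
  have hmain := baseSize_quadratic_line_le (hQ := hQ) (by rw [finrank_formSpace]; omega) hp
    (standardQuadraticForm_eVec ⟨0, by omega⟩) (standardQuadraticForm_fVec ⟨0, by omega⟩)
    (by rw [polar_standardQuadraticForm_fVec]; simp) (W := W)
    (by simp [W]) (by simp [W]) ?_ ?_ ⟨x, hxW, hx, y, hyW, hy, by rw [hxy]; exact one_ne_zero⟩ ?_
  · rwa [hWr] at hmain
  · rcases hval with ⟨h3, h4⟩ | ⟨h3, h4, h8⟩
    · refine ⟨x + y, add_mem hxW hyW, add_mem hx hy, ?_⟩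
      rw [QuadraticMap.map_add Q, h3, h4, hxy]
      simp
    · exact ⟨x, hxW, hx, by rw [h3]; exact one_ne_zero⟩
  · intro h2 c hc
    obtain ⟨s, t, h3, h4⟩ := hval2 h2 c hc
    exact ⟨_, add_mem (W.smul_mem s hxW) (W.smul_mem t hyW),
      add_mem (Submodule.smul_mem _ s hx) (Submodule.smul_mem _ t hy), h3, h4⟩
  · intro g hg hgW
    refine eq_one_of_fixes_perp (e := eVec ⟨1, by omega⟩) (f := fVec ⟨1, by omega⟩)
      (standardQuadraticForm_nondegenerate hr hζ h) (standardQuadraticForm_fVec _)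
      (by rw [polar_standardQuadraticForm_fVec]; simp) hg fun v hv => hgW v ?_
    rw [polar_standardQuadraticForm_fVec] at hv
    exact hv

/-- The upper bound if the polar form has a radical, from lines spanning the complement
`⟨e_i, f_i⟩` of the radical. -/
theorem baseSize_PGO_line_le_of_radical (h2 : (2 : F) = 0) (hd : 6 ≤ 2 * a + 1)
    {p : FormSpace F a 1} (hp : ∃ x, polar (standardQuadraticForm a 1 ζ) p x ≠ 0) :
    baseSize (PGOGroup a 1 ζ) (MulAction.orbit (PGOGroup a 1 ζ) (Submodule.span F {p})) ≤
      (2 * a : ℕ) := by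
  set Q := standardQuadraticForm a 1 ζ with hQdef
  have hQ : ∀ v, (∀ w, polar Q v w = 0) → Q v = 0 → v = 0 :=
    standardQuadraticForm_regular (by omega) (by simp)
  let W : Submodule F (FormSpace F a 1) := LinearMap.ker (xCoord 0)
  have hWr : Module.finrank F W = 2 * a := by
    have h1 := LinearMap.finrank_range_add_finrank_ker (xCoord 0 : FormSpace F a 1 →ₗ[F] F)
    have h2 : LinearMap.range (xCoord 0 : FormSpace F a 1 →ₗ[F] F) = ⊤ :=
      LinearMap.range_eq_top.mpr fun c => ⟨c • xVec 0, by simp⟩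
    rw [h2, finrank_top, Module.finrank_self, finrank_formSpace] at h1
    change Module.finrank F (LinearMap.ker _) = _
    omega
  have hperp : ∀ u : FormSpace F a 1, fCoord ⟨0, by omega⟩ u = 0 → eCoord ⟨0, by omega⟩ u = 0 →
      u ∈ (quadraticGeometry Q hQ).perp {eVec (⟨0, by omega⟩ : Fin a), fVec ⟨0, by omega⟩} := by
    rintro u h1 h2 _ (rfl | rfl)
    · exact (polar_standardQuadraticForm_eVec u _).trans h1
    · exact (polar_standardQuadraticForm_fVec u _).trans h2
  have hef : polar Q (eVec ⟨1, by omega⟩) (fVec ⟨1, by omega⟩) = 1 := by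
    rw [polar_standardQuadraticForm_fVec]; simp
  have he := hperp (eVec ⟨1, by omega⟩) (by simp) (by simp)
  have hf := hperp (fVec ⟨1, by omega⟩) (by simp) (by simp)
  have hmain := baseSize_quadratic_line_le (hQ := hQ) (by rw [finrank_formSpace]; omega) hp
    (standardQuadraticForm_eVec ⟨0, by omega⟩) (standardQuadraticForm_fVec ⟨0, by omega⟩)
    (by rw [polar_standardQuadraticForm_fVec]; simp) (W := W)
    (by simp [W]) (by simp [W])
    ⟨eVec ⟨1, by omega⟩ + fVec ⟨1, by omega⟩, by simp [W], add_mem he hf, by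
      rw [QuadraticMap.map_add Q, hef, standardQuadraticForm_eVec, standardQuadraticForm_fVec]
      simp⟩ (fun h => absurd h2 h)
    ⟨eVec ⟨1, by omega⟩, by simp [W], he, fVec ⟨1, by omega⟩, by simp [W], hf, by
      rw [hef]; exact one_ne_zero⟩ ?_
  · rwa [hWr] at hmain
  · intro g hg hgW
    have hgQ : ∀ v, Q (g v) = Q v := hg
    have hrad : ∀ v : FormSpace F a 1, polar Q v (xVec 0) = 0 := fun v => by
      rw [polar_standardQuadraticForm]
      simp only [polar, anisotropicPart_one, map_add, xCoord_xVec]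
      simp
      linear_combination xCoord 0 v * h2
    have hgx : g (xVec 0) = xVec 0 := by
      rw [← sub_eq_zero]
      have h3 : ∀ w ∈ W, polar Q (g (xVec 0) - xVec 0) w = 0 := fun w hw => by
        have h4 : polar Q (g (xVec 0)) w = polar Q (xVec 0) w := by
          conv_lhs => rw [← hgW w hw]
          rw [polar, polar, ← map_add, hgQ, hgQ, hgQ]
        rw [polar_sub_left, h4, sub_self]
      refine hQ _ (fun w => ?_) ?_
      · have h5 : w = (w - xCoord 0 w • xVec 0) + xCoord 0 w • xVec 0 := by abel
        rw [h5, polar_add_right, h3 _ (by simp [W]), polar_smul_right, hrad, smul_zero, add_zero]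
      · rw [sub_eq_add_neg, QuadraticMap.map_add Q, hgQ, QuadraticMap.map_neg, polar_neg_right,
          hrad]
        linear_combination Q (xVec 0) * h2
    refine LinearEquiv.ext fun x => ?_
    change g x = x
    have h5 : x = (x - xCoord 0 x • xVec 0) + xCoord 0 x • xVec 0 := by abel
    rw [h5, map_add, map_smul, hgx, hgW _ (by simp [W])]

variable [Finite F]

theorem baseSize_PGO_plane_le (hr : r ≤ 2)
    (hζ : r = 2 → Irreducible (Polynomial.X ^ 2 + Polynomial.X + Polynomial.C ζ))
    (hd : 7 ≤ 2 * a + r) {U : Submodule F (FormSpace F a r)} (hU : Module.finrank F U = 2)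
    (h : IsTotallySingular (standardQuadraticForm a r ζ) U ∨
      IsNondegenerateOn (polar (standardQuadraticForm a r ζ)) U) :
    baseSize (PGOGroup a r ζ) (MulAction.orbit (PGOGroup a r ζ) U) ≤
      (⌈((2 * a + r : ℕ) : ℚ) / 2⌉₊ : ℕ) := by
  have hQ := standardQuadraticForm_regular (a := a) hr hζ
  have hG := quadraticGeometry_isStandard hQ
  have hpl : (quadraticGeometry (standardQuadraticForm a r ζ) hQ).Plentiful 3 :=
    quadraticGeometry_plentiful (by rw [finrank_formSpace]; omega)
  rcases h with h | h
  · refine hG.baseSize_isotropic_plane_le hpl mem_quadraticIsometryGroup_iff (by omega) hd hU h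
      fun u hu v hv => ?_
    change polar _ u v = 0
    rw [polar, h _ (add_mem hu hv), h u hu, h v hv]
    ring
  · by_cases hp : ∃ p ∈ U, p ≠ 0 ∧ standardQuadraticForm a r ζ p = 0
    · obtain ⟨p, hpU, hp0, hQp⟩ := hp
      exact hG.baseSize_hyperbolic_plane_le hpl mem_quadraticIsometryGroup_iff (by omega) hd hU h
        hpU hp0 hQp
    · push Not at hp
      obtain ⟨p, hpU, p', hpU', hind, h1, h2, h3⟩ := exists_opposite_basis hU h
        fun u hu h0 => by_contra fun hu0 => hp u hu hu0 h0
      exact hG.baseSize_nondegenerate_plane_le hpl mem_quadraticIsometryGroup_iff (by omega) hd hU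
        h hpU hpU' hind (s := standardQuadraticForm a r ζ p) rfl h1 h2
        (by
          intro h4
          refine h3 (Eq.trans h4 ?_)
          change (_ + 1 * _) ^ 3 = _
          rw [one_mul]
          rfl)
        (Or.inr ⟨fun _ => rfl, rfl⟩)

theorem baseSize_PGO_line_eq (hr : r ≤ 2)
    (hζ : r = 2 → Irreducible (Polynomial.X ^ 2 + Polynomial.X + Polynomial.C ζ))
    (hd : 6 ≤ 2 * a + r) {U : Submodule F (FormSpace F a r)} (hU : Module.finrank F U = 1)
    (h : IsTotallySingular (standardQuadraticForm a r ζ) U ∨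
      IsNondegenerateOn (polar (standardQuadraticForm a r ζ)) U ∨
      IsNonsingularLine (standardQuadraticForm a r ζ) U) :
    baseSize (PGOGroup a r ζ) (MulAction.orbit (PGOGroup a r ζ) U) =
      ((2 * a + r - 1 : ℕ) : ℕ∞) := by
  have hQ := standardQuadraticForm_regular (a := a) hr hζ
  obtain ⟨p, hpU, hp0, hp⟩ := exists_eq_span_singleton hU
  have hrad : ∃ x, polar (standardQuadraticForm a r ζ) p x ≠ 0 := by
    by_contra! hcon
    rcases h with h | h | h
    · exact hp0 (hQ p hcon (h p hpU))
    · exact hp0 (h p hpU fun v _ => hcon v)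
    · obtain ⟨u, hu, v, huv⟩ := h.2.2
      rw [hp] at hu
      obtain ⟨c, rfl⟩ := Submodule.mem_span_singleton.mp hu
      rw [polar_smul_left, hcon, smul_zero] at huv
      exact huv rfl
  subst hp
  refine le_antisymm ?_ ?_
  · by_cases h2 : r = 1 ∧ (2 : F) = 0
    · obtain ⟨rfl, h2⟩ := h2
      exact baseSize_PGO_line_le_of_radical h2 hd hrad
    · exact baseSize_PGO_line_le_of_nondegenerate hr hζ (fun h3 h4 => h2 ⟨h3, h4⟩) hd hrad
  · have := le_baseSize_quadratic_line hQ (by rw [finrank_formSpace]; omega) p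
    rwa [finrank_formSpace] at this

end StandardQuadratic

/-! ### The symplectic group on the cosets of an orthogonal group -/

section Cosets

open QuadraticMap

variable {F V : Type*} [Field F] [AddCommGroup V] [Module F V] {Q : QuadraticForm F V}

theorem mul_self_inj_of_two_eq_zero (h2 : (2 : F) = 0) {x y : F} (h : x * x = y * y) : x = y := by
  rw [← sub_eq_zero, ← mul_self_eq_zero]
  linear_combination h + (y * y - x * y) * h2

theorem quotient_smul_eq_iff {K : Type*} [Group K] {H : Subgroup K} (h g : K) :
    h • (g : K ⧸ H) = g ↔ g⁻¹ * h * g ∈ H := by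
  rw [MulAction.Quotient.smul_coe, smul_eq_mul, eq_comm, QuotientGroup.eq, mul_assoc]

/-- A hyperplane `f'ᗮ` containing a hyperbolic pair is spanned by its singular vectors `v`, and the
images of the stabilizer of `Q` under the transvections `x ↦ x + B(x, v) v` for `v` in a basis,
together with that stabilizer itself, form a base: if `h` lies in all of them, then
`B(h x, v) ^ 2 = B(x, v) ^ 2`, that is, `h v = v`. -/
theorem baseSize_coset_le [FiniteDimensional F V] (h2 : (2 : F) = 0)
    (hnd : ∀ v, (∀ w, polar Q v w = 0) → v = 0) {e f e' f' : V} (he : Q e = 0) (hf : Q f = 0)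
    (hef : polar Q e f = 1) (hf' : Q f' = 0) (hef' : polar Q e' f' = 1)
    (h1 : polar Q e f' = 0) (h3 : polar Q f f' = 0) :
    baseSize (formIsometryGroup (polar Q))
      (formIsometryGroup (polar Q) ⧸
        (quadraticIsometryGroup Q).subgroupOf (formIsometryGroup (polar Q))) ≤
      (Module.finrank F V : ℕ∞) := by
  classical
  set G := quadraticGeometry Q (fun v hv _ => hnd v hv) with hG
  let W : Submodule F V := LinearMap.ker (G.left f')
  have hmemW : ∀ x, x ∈ W ↔ polar Q x f' = 0 := fun x => Iff.rfl
  have hWr : Module.finrank F W + 1 = Module.finrank F V := by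
    have h1 := LinearMap.finrank_range_add_finrank_ker (G.left f')
    have h2 : LinearMap.range (G.left f') = ⊤ :=
      LinearMap.range_eq_top.mpr fun c => ⟨c • e', by
        change polar Q (c • e') f' = c
        rw [polar_smul_left, hef', smul_eq_mul, mul_one]⟩
    rw [h2, finrank_top, Module.finrank_self] at h1
    change Module.finrank F (LinearMap.ker _) + 1 = _
    omega
  set T : Set V := {v | v ∈ W ∧ Q v = 0} with hT
  have hspan : Submodule.span F T = W := by
    refine le_antisymm (Submodule.span_le.mpr fun v hv => hv.1) fun x hx => ?_
    have heW : e ∈ W := h1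
    have hfW : f ∈ W := h3
    have heT : e ∈ Submodule.span F T := Submodule.subset_span ⟨heW, he⟩
    have hfT : f ∈ Submodule.span F T := Submodule.subset_span ⟨hfW, hf⟩
    obtain ⟨u, huW, hu, hxu⟩ := FormGeometry.mem_of_hyperbolic_pair (G := G) he hf hef W heW hfW hx
    rw [hxu]
    refine add_mem (add_mem (Submodule.smul_mem _ _ heT) (Submodule.smul_mem _ _ hfT)) ?_
    have h4 : u = (e + (-Q u) • f + u) - e + Q u • f := by module
    rw [h4]
    refine add_mem (sub_mem (Submodule.subset_span ⟨?_, ?_⟩) heT) (Submodule.smul_mem _ _ hfT)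
    · exact add_mem (add_mem heW (W.smul_mem _ hfW)) huW
    · have := FormGeometry.τ_hyperbolic_pair (G := G) he hf hef hu (s := -Q u)
      exact this.trans (by change -Q u + Q u = 0; ring)
  obtain ⟨b, -, hbT, hbs, hbfin, hbc⟩ := exists_finite_basis_subset (F := F) (Set.empty_subset T)
    (linearIndepOn_empty F id)
  rw [hspan] at hbs hbc
  set S := formIsometryGroup (polar Q) with hS
  set O := (quadraticIsometryGroup Q).subgroupOf S with hO
  have hmemO : ∀ g : S, g ∈ O ↔ ∀ x, Q ((g : V ≃ₗ[F] V) x) = Q x := fun g => Iff.rfl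
  have hvv : ∀ v, polar Q v v = 0 := fun v => by
    rw [polar_self, two_nsmul]
    linear_combination Q v * h2
  have htrans : ∀ v : V, ∃ t : S, ∀ x, (t : V ≃ₗ[F] V) x = x + polar Q x v • v := by
    intro v
    let t : V ≃ₗ[F] V := LinearEquiv.transvection (f := G.left v) (v := v) (hvv v)
    have ht : ∀ x, t x = x + polar Q x v • v := fun x => rfl
    refine ⟨⟨t, fun x y => ?_⟩, ht⟩
    rw [ht, ht]
    simp only [polar_add_left, polar_add_right, polar_smul_left, polar_smul_right, hvv, smul_eq_mul,
      polar_comm Q v y]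
    linear_combination (polar Q x v * polar Q y v) * h2
  choose t ht using htrans
  have hQt : ∀ v ∈ b, ∀ x, Q ((t v : V ≃ₗ[F] V) x) = Q x + polar Q x v * polar Q x v := by
    intro v hv x
    rw [ht, QuadraticMap.map_add Q, QuadraticMap.map_smul, (hbT hv).2, polar_smul_right,
      smul_eq_mul, smul_eq_mul, mul_zero, add_zero]
  refine (iInf₂_le (insert ((1 : S) : S ⧸ O) ((fun v => (((t v)⁻¹ : S) : S ⧸ O)) '' b)) ?_).trans ?_
  · rw [eq_bot_iff]
    intro h hh
    rw [mem_fixingSubgroup_iff] at hh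
    have h5 := hh _ (Set.mem_insert _ _)
    rw [quotient_smul_eq_iff, inv_one, one_mul, mul_one] at h5
    have hhQ : (h : V ≃ₗ[F] V) ∈ quadraticIsometryGroup Q := h5
    have hhB : ∀ x y, polar Q ((h : V ≃ₗ[F] V) x) ((h : V ≃ₗ[F] V) y) = polar Q x y := h.2
    have hfix : ∀ v ∈ b, (h : V ≃ₗ[F] V) v = v := by
      intro v hv
      have h6 := hh _ (Set.mem_insert_of_mem _ ⟨v, hv, rfl⟩)
      rw [quotient_smul_eq_iff, inv_inv] at h6
      have h7 : ∀ y, polar Q ((h : V ≃ₗ[F] V) y) v = polar Q y v := by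
        intro y
        have h8 := (hmemO _).mp h6 ((t v : V ≃ₗ[F] V) y)
        have h9 : ((t v * h * (t v)⁻¹ : S) : V ≃ₗ[F] V) ((t v : V ≃ₗ[F] V) y) =
            (t v : V ≃ₗ[F] V) ((h : V ≃ₗ[F] V) y) := by
          have h10 : t v * h * (t v)⁻¹ * t v = t v * h := by group
          exact congrArg (fun k : S => (k : V ≃ₗ[F] V) y) h10
        rw [h9, hQt v hv, hQt v hv, (hmemO _).mp h5] at h8
        exact mul_self_inj_of_two_eq_zero h2 (add_left_cancel h8)
      rw [← sub_eq_zero]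
      refine hnd _ fun w => ?_
      obtain ⟨y, rfl⟩ := (h : V ≃ₗ[F] V).surjective w
      rw [polar_sub_left, hhB, polar_comm Q v, polar_comm Q v, h7, sub_self]
    have h11 : Submodule.span F b ≤ LinearMap.eqLocus ((h : V ≃ₗ[F] V) : V →ₗ[F] V) LinearMap.id :=
      Submodule.span_le.mpr hfix
    rw [hbs] at h11
    rw [Subgroup.mem_bot]
    exact Subtype.ext (eq_one_of_fixes_perp hnd hf' hef' hhQ fun x hx => h11 hx)
  · refine (Set.encard_insert_le _ _).trans ?_
    refine (add_le_add_left (Set.encard_image_le _ _) 1).trans ?_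
    rw [hbfin.encard_eq_coe_toFinset_card, ← Set.ncard_eq_toFinset_card b hbfin, hbc, ← hWr]
    push_cast
    exact le_rfl

/-- In characteristic two, two quadratic forms with the same nondegenerate polar form `B` differ by
`x ↦ B(x, v) ^ 2` for some vector `v`. -/
theorem exists_sub_eq_polar_sq [Finite F] [FiniteDimensional F V] (h2 : (2 : F) = 0)
    (hnd : ∀ v, (∀ w, polar Q v w = 0) → v = 0) (Q' Q'' : QuadraticForm F V)
    (hQ : ∀ u v, polar Q' u v = polar Q'' u v) :
    ∃ v, ∀ x, Q' x = Q'' x + polar Q x v * polar Q x v := by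
  choose s hs using exists_sq_eq_of_two_eq_zero h2
  let l : V →ₗ[F] F :=
    { toFun := fun x => s (Q' x - Q'' x)
      map_add' := fun x y => by
        refine mul_self_inj_of_two_eq_zero h2 ?_
        have h3 := hs (Q' x - Q'' x)
        have h4 := hs (Q' y - Q'' y)
        rw [hs, QuadraticMap.map_add Q', QuadraticMap.map_add Q'', hQ]
        linear_combination -h3 - h4 - s (Q' x - Q'' x) * s (Q' y - Q'' y) * h2
      map_smul' := fun c x => by
        refine mul_self_inj_of_two_eq_zero h2 ?_
        have h3 := hs (Q' x - Q'' x)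
        rw [hs, QuadraticMap.map_smul, QuadraticMap.map_smul]
        simp only [smul_eq_mul, RingHom.id_apply]
        linear_combination (-(c * c)) * h3 }
  have hB : (polarBilin Q).Nondegenerate :=
    ⟨fun v hv => hnd v hv, fun v hv => hnd v fun w => (polar_comm Q v w).trans (hv w)⟩
  refine ⟨(LinearMap.BilinForm.toDual (polarBilin Q) hB).symm l, fun x => ?_⟩
  have h3 : polar Q x ((LinearMap.BilinForm.toDual (polarBilin Q) hB).symm l) = l x := by
    rw [polar_comm]
    exact LinearMap.BilinForm.apply_toDual_symm_apply (hB := hB) l x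
  rw [h3]
  change _ = _ + s _ * s _
  rw [hs]
  ring

/-- The stabilizer of fewer than `d` cosets fixes a quadratic form and, up to that form, at most
`d - 2` vectors. -/
theorem le_baseSize_coset [Finite F] [FiniteDimensional F V] (h2 : (2 : F) = 0)
    (hnd : ∀ v, (∀ w, polar Q v w = 0) → v = 0) (hd : 2 ≤ Module.finrank F V) :
    (Module.finrank F V : ℕ∞) ≤ baseSize (formIsometryGroup (polar Q))
      (formIsometryGroup (polar Q) ⧸
        (quadraticIsometryGroup Q).subgroupOf (formIsometryGroup (polar Q))) := by
  classical
  set S := formIsometryGroup (polar Q) with hS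
  set O := (quadraticIsometryGroup Q).subgroupOf S with hO
  have hmemO : ∀ g : S, g ∈ O ↔ ∀ x, Q ((g : V ≃ₗ[F] V) x) = Q x := fun g => Iff.rfl
  refine le_iInf₂ fun B hB => ?_
  by_contra! hlt
  have hfin : B.Finite := Set.finite_of_encard_le_coe hlt.le
  rw [hfin.encard_eq_coe_toFinset_card, Nat.cast_lt] at hlt
  -- An empty base is covered by the coset of `1`.
  obtain ⟨β₀, C, hBC, hC⟩ : ∃ (β₀ : S ⧸ O) (C : Finset (S ⧸ O)), (∀ β ∈ B, β = β₀ ∨ β ∈ C) ∧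
      C.card + 2 ≤ Module.finrank F V := by
    by_cases h : B.Nonempty
    · obtain ⟨β₀, hβ₀⟩ := h
      refine ⟨β₀, hfin.toFinset.erase β₀, fun β hβ => ?_, ?_⟩
      · by_cases h3 : β = β₀
        · exact Or.inl h3
        · exact Or.inr (Finset.mem_erase.mpr ⟨h3, hfin.mem_toFinset.mpr hβ⟩)
      · rw [Finset.card_erase_of_mem (hfin.mem_toFinset.mpr hβ₀)]
        have : 0 < hfin.toFinset.card := Finset.card_pos.mpr ⟨β₀, hfin.mem_toFinset.mpr hβ₀⟩
        omega
    · refine ⟨((1 : S) : S ⧸ O), ∅, fun β hβ => absurd ⟨β, hβ⟩ h, by simpa using hd⟩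
  choose g hg using fun β : S ⧸ O => QuotientGroup.mk_surjective β
  -- The form stabilized by the stabilizer of the coset `β`.
  let q : S ⧸ O → QuadraticForm F V := fun β =>
    Q.comp (((g β)⁻¹ : S) : V ≃ₗ[F] V).toLinearMap
  have hq : ∀ β x, q β x = Q ((((g β)⁻¹ : S) : V ≃ₗ[F] V) x) := fun β x => rfl
  have hqp : ∀ β u v, polar (q β) u v = polar Q u v := fun β u v => by
    rw [← (g β)⁻¹.2 u v, polar, polar, hq, hq, hq, map_add]
  choose v hv using fun β => exists_sub_eq_polar_sq h2 hnd (q β) (q β₀)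
    fun u v => (hqp β u v).trans (hqp β₀ u v).symm
  obtain ⟨h, hh, hh1, hhv⟩ := exists_ne_one_of_finrank_add_two_le (Q := q β₀)
    (fun w hw _ => hnd w fun x => (hqp β₀ w x).symm.trans (hw x))
    (Submodule.span F ((C.image v : Finset V) : Set V))
    ((add_le_add_left ((finrank_span_finset_le_card _).trans Finset.card_image_le) 2).trans hC)
  have hhq : ∀ x, q β₀ (h x) = q β₀ x := hh
  have hhB : ∀ x y, polar Q (h x) (h y) = polar Q x y := fun x y => by
    rw [← hqp β₀, ← hqp β₀, polar, polar, ← map_add, hhq, hhq, hhq]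
  have hmem : (⟨h, hhB⟩ : S) ∈ fixingSubgroup S B := by
    rw [mem_fixingSubgroup_iff]
    intro β hβ
    have hβq : ∀ y, q β (h y) = q β y := by
      rcases hBC β hβ with rfl | hβC
      · exact hhq
      · intro y
        have h3 := hhB y (v β)
        rw [hhv _ (Submodule.subset_span
          (Finset.mem_coe.mpr (Finset.mem_image_of_mem v hβC)))] at h3
        rw [hv β (h y), hv β y, hhq, h3]
    rw [← hg β, quotient_smul_eq_iff, hmemO]
    intro x
    have h3 := hβq ((g β : V ≃ₗ[F] V) x)
    rw [hq, hq] at h3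
    have h4 : (((g β)⁻¹ : S) : V ≃ₗ[F] V) ((g β : V ≃ₗ[F] V) x) = x := by
      have h5 : (g β)⁻¹ * g β = 1 := inv_mul_cancel _
      exact congrArg (fun k : S => (k : V ≃ₗ[F] V) x) h5
    rw [h4] at h3
    exact h3
  rw [hB, Subgroup.mem_bot] at hmem
  exact hh1 (congrArg Subtype.val hmem)

end Cosets

theorem two_eq_zero_of_even_card {F : Type*} [Field F] [Finite F] (h : Even (Nat.card F)) :
    (2 : F) = 0 := by
  have := Fintype.ofFinite F
  rw [Nat.card_eq_fintype_card, Nat.even_iff] at h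
  have h1 := FiniteField.even_card_iff_char_two.mpr h
  have h2 := ringChar.Nat.cast_ringChar (R := F)
  rw [h1] at h2
  exact_mod_cast h2

theorem baseSize_SpGroup_coset_eq {F : Type*} [Field F] [Finite F] (h2 : (2 : F) = 0)
    {a c s : ℕ} {ζ : F} (hc : 2 ≤ c) (ha : 1 ≤ a) {Q : QuadraticForm F (FormSpace F a 0)}
    (hQ : ∀ u v, QuadraticMap.polar Q u v = symplecticForm a u v)
    (φ : Q.IsometryEquiv (standardQuadraticForm c s ζ)) :
    baseSize (SpGroup F a)
      (SpGroup F a ⧸ (quadraticIsometryGroup Q).subgroupOf (SpGroup F a)) = (2 * a : ℕ) := by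
  have hpol : symplecticForm a = QuadraticMap.polar Q := by
    funext u v
    exact (hQ u v).symm
  have hnd : ∀ v, (∀ w, QuadraticMap.polar Q v w = 0) → v = 0 := fun v hv =>
    (symplecticGeometry F a).regular v (fun w => (hQ v w).symm.trans (hv w)) rfl
  have hφ : ∀ v, Q (φ.symm v) = standardQuadraticForm c s ζ v := φ.symm.map_app
  have hφp : ∀ u v, QuadraticMap.polar Q (φ.symm u) (φ.symm v) =
      QuadraticMap.polar (standardQuadraticForm c s ζ) u v := fun u v => by
    rw [QuadraticMap.polar, QuadraticMap.polar, ← hφ, ← hφ, ← hφ]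
    congr 3
    exact (map_add φ.symm.toLinearEquiv u v).symm
  unfold SpGroup
  have hr : 2 * a = Module.finrank F (FormSpace F a 0) :=
    (finrank_formSpace (a := a) (r := 0)).symm
  rw [hpol, hr]
  refine le_antisymm (baseSize_coset_le h2 hnd (e := φ.symm (eVec ⟨0, by omega⟩))
    (f := φ.symm (fVec ⟨0, by omega⟩)) (e' := φ.symm (eVec ⟨1, by omega⟩))
    (f' := φ.symm (fVec ⟨1, by omega⟩)) ?_ ?_ ?_ ?_ ?_ ?_ ?_)
    (le_baseSize_coset h2 hnd (by rw [finrank_formSpace]; omega)) <;>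
  simp only [hφ, hφp, standardQuadraticForm_eVec, standardQuadraticForm_fVec,
      polar_standardQuadraticForm_fVec] <;> simp

/-! ### General linear groups on planes -/

section GeneralLinear

variable {F V : Type*} [Field F] [AddCommGroup V] [Module F V]

theorem finrank_span_pair {p p' : V} (h : ∀ a b : F, a • p + b • p' = 0 → a = 0 ∧ b = 0) :
    Module.finrank F (Submodule.span F {p, p'}) = 2 := by
  have hli : LinearIndependent F ![p, p'] := LinearIndependent.pair_iff.mpr h
  have := finrank_span_eq_card hli
  rw [Matrix.range_cons, Matrix.range_cons, Matrix.range_empty, Set.union_empty] at this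
  exact this

theorem exists_linearEquiv_map_eq [FiniteDimensional F V] {U U' : Submodule F V}
    (h : Module.finrank F U = Module.finrank F U') :
    ∃ g : V ≃ₗ[F] V, U.map (g : V →ₗ[F] V) = U' := by
  obtain ⟨g, hg⟩ := Submodule.exists_linearEquiv_restrict_eq (LinearEquiv.ofFinrankEq U U' h)
  refine ⟨g, Submodule.eq_of_le_of_finrank_eq ?_ ((LinearEquiv.finrank_map_eq g U).trans h)⟩
  rintro _ ⟨u, hu, rfl⟩
  change g ((⟨u, hu⟩ : U) : V) ∈ U'
  rw [← hg]
  exact Subtype.property _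

variable {a r : ℕ}

/-- A linear map that preserves the blocks `⟨e_i, f_i⟩` and the diagonal plane acts on all blocks by
the same matrix. -/
theorem exists_matrix_of_blocks (g : FormSpace F a r →ₗ[F] FormSpace F a r)
    (hg : ∀ i, (Submodule.span F {eVec i, fVec i}).map g ≤ Submodule.span F {eVec i, fVec i})
    (hD : (Submodule.span F {∑ i, eVec i, ∑ i, fVec i}).map g ≤
      Submodule.span F {∑ i, eVec i, ∑ i, fVec i}) :
    ∃ A B C D : F, ∀ i, g (eVec i) = A • eVec i + B • fVec i ∧
      g (fVec i) = C • eVec i + D • fVec i := by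
  have h1 : ∀ i, ∃ A B : F, A • eVec i + B • fVec i = g (eVec i) := fun i =>
    Submodule.mem_span_pair.mp (hg i ⟨_, Submodule.subset_span (by simp), rfl⟩)
  have h2 : ∀ i, ∃ A B : F, A • eVec i + B • fVec i = g (fVec i) := fun i =>
    Submodule.mem_span_pair.mp (hg i ⟨_, Submodule.subset_span (by simp), rfl⟩)
  choose A B hAB using h1
  choose C D hCD using h2
  obtain ⟨A', B', hE⟩ := Submodule.mem_span_pair.mp
    (hD ⟨_, Submodule.subset_span (Set.mem_insert _ _), rfl⟩)
  obtain ⟨C', D', hF⟩ := Submodule.mem_span_pair.mp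
    (hD ⟨_, Submodule.subset_span (Set.mem_insert_of_mem _ rfl), rfl⟩)
  rw [map_sum] at hE hF
  simp only [← hAB] at hE
  simp only [← hCD] at hF
  refine ⟨A', B', C', D', fun i => ?_⟩
  rw [← hAB, ← hCD]
  have e1 := congrArg (eCoord i) hE
  have e2 := congrArg (fCoord i) hE
  have e3 := congrArg (eCoord i) hF
  have e4 := congrArg (fCoord i) hF
  simp [map_sum, Finset.sum_add_distrib] at e1 e2 e3 e4
  rw [e1, e2, e3, e4]
  exact ⟨rfl, rfl⟩

/-- The blocks `⟨e_i, f_i⟩`, the diagonal plane and the planes `⟨p k, p' k⟩` give a base if, for a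
map acting on all blocks by the same matrix, stabilizing the latter planes implies being a scalar. -/
theorem baseSize_PGL_plane_le [FiniteDimensional F V] (ψ : FormSpace F a r ≃ₗ[F] V)
    {U : Submodule F V} (hU : Module.finrank F U = 2) {κ : Type*} [Fintype κ] (i₀ : Fin a)
    (p p' : κ → FormSpace F a r)
    (hp : ∀ k, ∀ s t : F, s • p k + t • p' k = 0 → s = 0 ∧ t = 0)
    (hstab : ∀ (g : FormSpace F a r →ₗ[F] FormSpace F a r) (A B C D : F),
      (∀ i, g (eVec i) = A • eVec i + B • fVec i ∧ g (fVec i) = C • eVec i + D • fVec i) →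
      (∀ k, (∃ s t : F, s • p k + t • p' k = g (p k)) ∧ ∃ s t : F, s • p k + t • p' k = g (p' k)) →
      B = 0 ∧ C = 0 ∧ A = D ∧ ∀ j, g (xVec j) = A • xVec j) :
    baseSize (ProjectiveGroup (⊤ : Subgroup (V ≃ₗ[F] V)))
      (MulAction.orbit (ProjectiveGroup (⊤ : Subgroup (V ≃ₗ[F] V))) U) ≤
      (a + (Fintype.card κ + 1) : ℕ) := by
  have : Nontrivial V := by
    refine ⟨ψ (eVec i₀), 0, fun h => ?_⟩
    have h1 := congrArg (eCoord i₀) ((map_eq_zero_iff ψ ψ.injective).mp h)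
    simp at h1
  let T : Fin a ⊕ Option κ → Submodule F (FormSpace F a r)
    | Sum.inl i => Submodule.span F {eVec i, fVec i}
    | Sum.inr none => Submodule.span F {∑ i, eVec i, ∑ i, fVec i}
    | Sum.inr (some k) => Submodule.span F {p k, p' k}
  have hT : ∀ k, Module.finrank F (T k) = 2 := by
    rintro (i | _ | k)
    · refine finrank_span_pair fun s t h => ?_
      have h1 := congrArg (eCoord i) h
      have h2 := congrArg (fCoord i) h
      simp at h1 h2
      exact ⟨h1, h2⟩
    · refine finrank_span_pair fun s t h => ?_
      have h1 := congrArg (eCoord i₀) h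
      have h2 := congrArg (fCoord i₀) h
      simp [map_sum] at h1 h2
      exact ⟨h1, h2⟩
    · exact finrank_span_pair (hp k)
  have h := baseSize_orbit_le ⊤ U (fun k => (T k).map (ψ : FormSpace F a r →ₗ[F] V))
    (fun k => ?_) ?_
  · simpa using h
  · obtain ⟨g, hg⟩ := exists_linearEquiv_map_eq (U := U)
      (U' := (T k).map (ψ : FormSpace F a r →ₗ[F] V)) (by
        rw [hU]
        exact ((LinearEquiv.finrank_map_eq ψ (T k)).trans (hT k)).symm)
    exact ⟨g, trivial, hg⟩
  · intro g _ hg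
    let g' : FormSpace F a r →ₗ[F] FormSpace F a r := (ψ ≪≫ₗ g ≪≫ₗ ψ.symm).toLinearMap
    have hg' : ∀ v, g' v = ψ.symm (g (ψ v)) := fun v => rfl
    have hinv : ∀ k, (T k).map g' ≤ T k := by
      rintro k _ ⟨v, hv, rfl⟩
      have h1 : g (ψ v) ∈ (T k).map (ψ : FormSpace F a r →ₗ[F] V) := by
        rw [← hg k]
        exact ⟨ψ v, ⟨v, hv, rfl⟩, rfl⟩
      obtain ⟨w, hw, hwv⟩ := h1
      have h2 : g' v = w := by rw [hg', ← hwv]; exact ψ.symm_apply_apply w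
      rw [h2]
      exact hw
    obtain ⟨A, B, C, D, hABCD⟩ := exists_matrix_of_blocks g' (fun i => hinv (Sum.inl i))
      (hinv (Sum.inr none))
    obtain ⟨rfl, rfl, rfl, hx⟩ := hstab g' A B C D hABCD fun k =>
      ⟨Submodule.mem_span_pair.mp (hinv (Sum.inr (some k))
        ⟨_, Submodule.subset_span (Set.mem_insert _ _), rfl⟩),
      Submodule.mem_span_pair.mp (hinv (Sum.inr (some k))
        ⟨_, Submodule.subset_span (Set.mem_insert_of_mem _ rfl), rfl⟩)⟩
    have htop : LinearMap.eqLocus g' (A • LinearMap.id) = ⊤ := by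
      refine FormSpace.eq_top (fun i => ?_) (fun i => ?_) fun j => ?_
      · change g' (eVec i) = A • eVec i
        rw [(hABCD i).1, zero_smul, add_zero]
      · change g' (fVec i) = A • fVec i
        rw [(hABCD i).2, zero_smul, zero_add]
      · exact hx j
    refine ⟨A, fun v => ?_⟩
    have h1 : ψ.symm v ∈ LinearMap.eqLocus g' (A • LinearMap.id) := by rw [htop]; trivial
    have h2 : g' (ψ.symm v) = A • ψ.symm v := h1
    rw [hg', ψ.apply_symm_apply, ← map_smul] at h2
    exact ψ.symm.injective h2

/-- In even dimension, the plane `⟨e_1 + f_3, f_1 + e_2⟩` completes the base. -/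
theorem baseSize_PGL_even_le [FiniteDimensional F V] (ha : 3 ≤ a) (ψ : FormSpace F a 0 ≃ₗ[F] V)
    {U : Submodule F V} (hU : Module.finrank F U = 2) :
    baseSize (ProjectiveGroup (⊤ : Subgroup (V ≃ₗ[F] V)))
      (MulAction.orbit (ProjectiveGroup (⊤ : Subgroup (V ≃ₗ[F] V))) U) ≤ (a + 2 : ℕ) := by
  set i₀ : Fin a := ⟨0, by omega⟩ with hi₀
  set i₁ : Fin a := ⟨1, by omega⟩ with hi₁
  set i₂ : Fin a := ⟨2, by omega⟩ with hi₂
  have h01 : i₀ ≠ i₁ := by simp [hi₀, hi₁]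
  have h02 : i₀ ≠ i₂ := by simp [hi₀, hi₂]
  have h12 : i₁ ≠ i₂ := by simp [hi₁, hi₂]
  refine baseSize_PGL_plane_le ψ hU (κ := Unit) i₀ (fun _ => eVec i₀ + fVec i₂)
    (fun _ => fVec i₀ + eVec i₁) (fun _ s t h => ?_) fun g A B C D hg hk => ?_
  · have h1 := congrArg (eCoord i₀) h
    have h2 := congrArg (fCoord i₀) h
    simp [h01, h02] at h1 h2
    exact ⟨h1, h2⟩
  · obtain ⟨⟨s, t, h1⟩, -⟩ := hk ()
    rw [map_add, (hg i₀).1, (hg i₂).2] at h1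
    have e1 := congrArg (eCoord i₀) h1
    have e2 := congrArg (fCoord i₀) h1
    have e3 := congrArg (eCoord i₁) h1
    have e4 := congrArg (eCoord i₂) h1
    have e5 := congrArg (fCoord i₂) h1
    simp [h01, h02, h12, h01.symm, h02.symm, h12.symm] at e1 e2 e3 e4 e5
    refine ⟨by rw [← e2, e3], e4.symm, by rw [← e1, e5], fun j => j.elim0⟩

/-- In odd dimension, the planes `⟨e_1, f_1 + e_2 + x⟩` and `⟨e_1 + x, f_2⟩` complete the base. -/
theorem baseSize_PGL_odd_le [FiniteDimensional F V] (ha : 2 ≤ a) (ψ : FormSpace F a 1 ≃ₗ[F] V)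
    {U : Submodule F V} (hU : Module.finrank F U = 2) :
    baseSize (ProjectiveGroup (⊤ : Subgroup (V ≃ₗ[F] V)))
      (MulAction.orbit (ProjectiveGroup (⊤ : Subgroup (V ≃ₗ[F] V))) U) ≤ (a + 3 : ℕ) := by
  set i₀ : Fin a := ⟨0, by omega⟩ with hi₀
  set i₁ : Fin a := ⟨1, by omega⟩ with hi₁
  have h01 : i₀ ≠ i₁ := by simp [hi₀, hi₁]
  refine baseSize_PGL_plane_le ψ hU (κ := Fin 2) i₀ ![eVec i₀, eVec i₀ + xVec 0]
    ![fVec i₀ + eVec i₁ + xVec 0, fVec i₁] (fun k s t h => ?_) fun g A B C D hg hk => ?_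
  · have h1 := congrArg (eCoord i₀) h
    have h2 := congrArg (fCoord i₀) h
    have h3 := congrArg (fCoord i₁) h
    fin_cases k <;> simp [h01, h01.symm] at h1 h2 h3
    · exact ⟨h1, h2⟩
    · exact ⟨h1, h3⟩
  · have hk0 := hk 0
    have hk1 := hk 1
    simp only [Matrix.cons_val_zero, Matrix.cons_val_one] at hk0 hk1
    obtain ⟨⟨s₁, t₁, h1⟩, s₂, t₂, h2⟩ := hk0
    obtain ⟨⟨s₃, t₃, h3⟩, s₄, t₄, h4⟩ := hk1
    have hz : g (xVec 0) = s₃ • (eVec i₀ + xVec 0) + t₃ • fVec i₁ -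
        (A • eVec i₀ + B • fVec i₀) := by
      rw [h3, map_add, (hg i₀).1]; abel
    rw [(hg i₀).1] at h1
    rw [map_add, map_add, (hg i₀).2, (hg i₁).1, hz] at h2
    rw [(hg i₁).2] at h4
    have e1 := congrArg (fCoord i₀) h1
    have e2 := congrArg (eCoord i₁) h1
    have e3 := congrArg (eCoord i₁) h4
    have e4 := congrArg (fCoord i₀) h2
    have e5 := congrArg (eCoord i₁) h2
    have e6 := congrArg (xCoord 0) h2
    have e7 := congrArg (fCoord i₁) h2
    simp [h01, h01.symm] at e1 e2 e3 e4 e5 e6 e7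
    have hB : B = 0 := by rw [← e1, e2]
    subst hB
    have hs : s₃ = A := by rw [← e6, e5]
    have ht : t₃ = 0 := by simpa using e7.symm
    refine ⟨rfl, e3.symm, ?_, fun j => ?_⟩
    · rw [← e5, e4]; ring
    · rw [Subsingleton.elim j 0, hz, hs, ht]
      module

end GeneralLinear

theorem baseSize_PGLGroup_le (F : Type*) [Field F] {d : ℕ} (hd : 5 ≤ d)
    {U : Submodule F (Fin d → F)} (hU : Module.finrank F U = 2) :
    baseSize (PGLGroup F d) (MulAction.orbit (PGLGroup F d) U) ≤
      ((⌈(d : ℚ) / 2⌉₊ + 2 : ℕ) : ℕ∞) := by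
  rw [natCeil_half]
  have hfin : ∀ a r, 2 * a + r = d → Nonempty (FormSpace F a r ≃ₗ[F] (Fin d → F)) := fun a r h =>
    ⟨LinearEquiv.ofFinrankEq _ _ (by rw [finrank_formSpace, Module.finrank_fin_fun, h])⟩
  rcases Nat.even_or_odd' d with ⟨a, h | h⟩
  · obtain ⟨ψ⟩ := hfin a 0 h.symm
    rw [show (d + 1) / 2 = a by omega]
    exact baseSize_PGL_even_le (by omega) ψ hU
  · obtain ⟨ψ⟩ := hfin a 1 h.symm
    rw [show (d + 1) / 2 + 2 = a + 3 by omega]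
    exact baseSize_PGL_odd_le (by omega) ψ hU

/-! ### Base sizes of the classical groups -/

theorem theorem2 (F : Type*) [Field F] [Finite F] :
    -- PGL, 2-spaces
    (∀ d : ℕ, 5 ≤ d → ∀ U : Submodule F (Fin d → F), Module.finrank F U = 2 →
      baseSize (PGLGroup F d) (MulAction.orbit (PGLGroup F d) U) ≤
        ((⌈(d : ℚ) / 2⌉₊ + 2 : ℕ) : ℕ∞)) ∧
    -- PGU, 1-spaces
    (∀ q d a r : ℕ, Nat.card F = q ^ 2 → r ≤ 1 → d = 2 * a + r → 3 ≤ d →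
      ∀ U : Submodule F (FormSpace F a r), Module.finrank F U = 1 →
        (IsTotallyIsotropic (unitaryForm q a r) U ∨ IsNondegenerateOn (unitaryForm q a r) U) →
        baseSize (PGUGroup F q a r) (MulAction.orbit (PGUGroup F q a r) U) ≤ (d : ℕ∞)) ∧
    -- PSp, 1-spaces
    (∀ d a : ℕ, d = 2 * a → 3 ≤ d →
      ∀ U : Submodule F (FormSpace F a 0), Module.finrank F U = 1 →
        (IsTotallyIsotropic (symplecticForm a) U ∨ IsNondegenerateOn (symplecticForm a) U) →
        baseSize (PSpGroup F a) (MulAction.orbit (PSpGroup F a) U) ≤ (d : ℕ∞)) ∧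
    -- PGO, 1-spaces
    (∀ (d a r : ℕ) (ζ : F), r ≤ 2 →
      (r = 2 → Irreducible (Polynomial.X ^ 2 + Polynomial.X + Polynomial.C ζ)) →
      d = 2 * a + r → 6 ≤ d →
      ∀ U : Submodule F (FormSpace F a r), Module.finrank F U = 1 →
        (IsTotallySingular (standardQuadraticForm a r ζ) U ∨
          IsNondegenerateOn (QuadraticMap.polar (standardQuadraticForm a r ζ)) U ∨
          IsNonsingularLine (standardQuadraticForm a r ζ) U) →
        baseSize (PGOGroup a r ζ) (MulAction.orbit (PGOGroup a r ζ) U) = ((d - 1 : ℕ) : ℕ∞)) ∧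
    -- PGU, 2-spaces
    (∀ q d a r : ℕ, Nat.card F = q ^ 2 → r ≤ 1 → d = 2 * a + r → 7 ≤ d →
      ∀ U : Submodule F (FormSpace F a r), Module.finrank F U = 2 →
        (IsTotallyIsotropic (unitaryForm q a r) U ∨ IsNondegenerateOn (unitaryForm q a r) U) →
        baseSize (PGUGroup F q a r) (MulAction.orbit (PGUGroup F q a r) U) ≤
          ((⌈(d : ℚ) / 2⌉₊ : ℕ) : ℕ∞)) ∧
    -- PSp, 2-spaces
    (∀ d a : ℕ, d = 2 * a → 7 ≤ d →
      ∀ U : Submodule F (FormSpace F a 0), Module.finrank F U = 2 →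
        (IsTotallyIsotropic (symplecticForm a) U ∨ IsNondegenerateOn (symplecticForm a) U) →
        baseSize (PSpGroup F a) (MulAction.orbit (PSpGroup F a) U) ≤
          ((⌈(d : ℚ) / 2⌉₊ : ℕ) : ℕ∞)) ∧
    -- PGO, 2-spaces
    (∀ (d a r : ℕ) (ζ : F), r ≤ 2 →
      (r = 2 → Irreducible (Polynomial.X ^ 2 + Polynomial.X + Polynomial.C ζ)) →
      d = 2 * a + r → 7 ≤ d →
      ∀ U : Submodule F (FormSpace F a r), Module.finrank F U = 2 →
        (IsTotallySingular (standardQuadraticForm a r ζ) U ∨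
          IsNondegenerateOn (QuadraticMap.polar (standardQuadraticForm a r ζ)) U) →
        baseSize (PGOGroup a r ζ) (MulAction.orbit (PGOGroup a r ζ) U) ≤
          ((⌈(d : ℚ) / 2⌉₊ : ℕ) : ℕ∞)) ∧
    -- Sp, cosets of the orthogonal groups of plus (`s = 0`) and minus (`s = 2`) type, `q` even
    (Even (Nat.card F) → ∀ (d a c s : ℕ) (ζ : F), d = 2 * a → 6 ≤ d → d = 2 * c + s →
      (s = 0 ∨ s = 2) →
      (s = 2 → Irreducible (Polynomial.X ^ 2 + Polynomial.X + Polynomial.C ζ)) →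
      ∀ Q : QuadraticForm F (FormSpace F a 0),
        (∀ u v, QuadraticMap.polar Q u v = symplecticForm a u v) →
        QuadraticMap.Equivalent Q (standardQuadraticForm c s ζ) →
        baseSize (SpGroup F a)
          (SpGroup F a ⧸ (quadraticIsometryGroup Q).subgroupOf (SpGroup F a)) = (d : ℕ∞)) := by
  refine ⟨fun d hd U hU => baseSize_PGLGroup_le F hd hU, ?_, ?_, ?_, ?_, ?_, ?_, ?_⟩
  · rintro q d a r hq hr rfl hd U hU -
    exact baseSize_PGU_line_le hq hr hd hU
  · rintro d a rfl hd U hU -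
    exact baseSize_PSp_line_le (by omega) hU
  · rintro d a r ζ hr hζ rfl hd U hU h
    exact baseSize_PGO_line_eq hr hζ hd hU h
  · rintro q d a r hq hr rfl hd U hU h
    exact baseSize_PGU_plane_le hq hr hd hU h
  · rintro d a rfl hd U hU h
    exact baseSize_PSp_plane_le hd hU h
  · rintro d a r ζ hr hζ rfl hd U hU h
    exact baseSize_PGO_plane_le hr hζ hd hU h
  · rintro hF d a c s ζ rfl hd hcs hs - Q hQ ⟨φ⟩
    exact baseSize_SpGroup_coset_eq (two_eq_zero_of_even_card hF) (by omega) (by omega) hQ φ
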